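/- **Setting.** Let $k$ be a field of characteristic $p>0$ (not necessarily algebraically closed) and $N$ a normal subgroup of a finite group $G$. All algebras are finite-dimensional, associative and unital. For a group $L$ acting on a $k$-algebra $B$ by algebra automorphisms ($B$ is an *$L$-algebra*) and $S\le R\le L$, write $B^R$ for the fixed subalgebra, $\mathrm{Tr}_S^R:B^S\to B^R$ for the relative trace, $B_S^R$ for its image, $B(R)=B^R/\sum_{S<R}B_S^R$ for the Brauer quotient and $\mathrm{Br}_R:B^R\to B(R)$ for the quotient map; $N_L(R)$ acts on $B(R)$. A *block* of an algebra is a primitive idempotent of its centre. A *point* of $L$ on $B$ is a $(B^L)^\times$-conjugacy class of primitive idempotents of $B^L$; a *defect group* of it (or of one of its elements $i$) is a minimal subgroup $P$ with $i\in B_P^L$. For $c\in B^L$, a *$(B,c,L)$-Brauer pair* is a pair $(R,f)$ with $R$ a $p$-subgroup of $L$ and $f$ a block of $B(R)$ with $\mathrm{Br}_R(c)f\ne 0$; $(S,e)\le(T,f)$ means that $S\le T$ and $\mathrm{Br}_S(i)e\neq0$ for every primitive idempotent $i$ of $B^T$ with $\mathrm{Br}_T(i)f\ne0$. For a maximal $(B,c,L)$-Brauer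 pair $(U,f_U)$, the fusion system $\mathcal F_{(U,f_U)}(B,c,L)$ is the category of Brauer pairs contained in $(U,f_U)$, whose morphisms $(S,f_S)\to(T,f_T)$ are the homomorphisms $S\to T$, $u\mapsto xux^{-1}$, with $x\in L$ and ${}^x(S,f_S)\le(T,f_T)$. **Hypotheses.** Let $A$ be an interior $G$-algebra with a $G\times G$-stable $k$-basis, projective as a $k[N\times1]$-module and as a $k[1\times N]$-module. Let $C$ be an $N$-interior $G$-algebra which is a $p$-permutation algebra (it has an $R$-stable $k$-basis for every $p$-subgroup $R\le G$) and which is contained in $A$ as an $N$-interior $G$-algebra and as a direct summand of $k$-modules. Let $c$ be a $G$-invariant primitive idempotent of $C^N$, let $Q\le N$ be a defect group of $c$ in $N$, and let $(Q,f_Q)$ be a $(C,c,G)$-Brauer pair such that $f_Q$ is primitive in $C(Q)^{C_N(Q)}$. Put $H=N_G(Q,f_Q)$. Let $X=\overline N_A^{\mathrm{Aut}(Q)}(Q)=\bigoplus_{\varphi\in\mathrm{Aut}(Q)}\overline N^{\varphi}$ be the extended Brauer quotient. Here $\overline N^\varphi$ is the quotient of $\{a\in A:\varphi(u)a=au\ \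 \forall u\in Q\}$ by the sum of the relative traces from all proper subgroups of $Q$, for the action $a\mapsto\varphi(u)au^{-1}$ of $u\in Q$ on $A$. The product of $X$ is induced by that of $A$, and $N_G(Q)$ acts by conjugation. The inclusion $C\subseteq A$ induces $C(Q)\to X$ (in degree $\varphi=\mathrm{id}$). Let $\gamma$ be a point of $H$ on $X$ that *covers* $f_Q$, that is: with $M=QC_N(Q)$ there are $i\in\gamma$ and a point $\epsilon$ of $M$ on $X$ with defect group $Q$ such that $if_Q=f_Qi=i$ in $X$, such that $if=fi=f$ for some $f\in\epsilon$, and such that $f_Qf_1=f_1f_Q=f_1$ for some $f_1\in\epsilon$. Let $P\le H$ be a defect group of $\gamma$. **Theorem.** Then $P\cap N=Q$, and there is a block $f_P$ of $C(P)$ such that $(P,f_P)$ is a $(C,c,G)$-Brauer pair with $(Q,f_Q)\le(P,f_P)$. For every such $f_P$, the corresponding pair for $C(Q)$ (under the canonical isomorphism $C(Q)(P)\cong C(P)$) is a $(C(Q),f_Q,H)$-Brauer pair containing $(Q,f_Q)$. Let $(U,f_U)$ be any maximal $(C,c,G)$-Brauer pair containing $(P,f_P)$. The pair corresponding to $(U,f_U)$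 for $C(Q)$ is a maximal $(C(Q),f_Q,H)$-Brauer pair containing the one corresponding to $(P,f_P)$. Let $\mathcal C(P,f_P)$ be the full subcategory of $\mathcal F_{(U,f_U)}(C,c,G)$ of the pairs $(T,f_T)$ with $(Q,f_Q)\le(T,f_T)\le(P,f_P)$, and let $\mathcal D(P,f_P)$ be the full subcategory of $\mathcal F_{(U,f_U)}(C(Q),f_Q,H)$ defined by the same condition, for Brauer pairs of $(C(Q),f_Q,H)$. Then the categories $\mathcal C(P,f_P)$ and $\mathcal D(P,f_P)$ are isomorphic. More precisely, there are mutually inverse functors between them which, under the canonical identifications $C(Q)(T)=C(T)$, are the identity on objects and on the underlying group homomorphisms. -/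

import Mathlib

/-! ### Relative traces and the Brauer quotient of a representation -/

/-- The relative trace `Tr_S^L(m) = ∑_{x ∈ L/S} x m`, meant for an `S`-fixed element `m`
(the value then does not depend on the chosen representatives). -/
noncomputable def relTrace {k L M : Type*} [Field k] [Group L] [AddCommGroup M] [Module k M]
    (ρ : Representation k L M) (S : Subgroup L) (m : M) : M :=
  ∑ᶠ q : L ⧸ S, ρ q.out m

/-- The sum over all proper subgroups `S < L` of the images of the relative traces
`Tr_S^L : M^S → M^L`. -/
noncomputable def properTraces {k L M : Type*} [Field k] [Group L] [AddCommGroup M] [Module k M]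
    (ρ : Representation k L M) : Submodule k M :=
  Submodule.span k {x | ∃ S : Subgroup L, S ≠ ⊤ ∧ ∃ m : M, (∀ s ∈ S, ρ s m = m) ∧
    x = relTrace ρ S m}

theorem map_relTrace {k L L' M M' : Type*} [Field k] [Group L] [Finite L] [Group L']
    [AddCommGroup M] [Module k M] [AddCommGroup M'] [Module k M']
    (ρ : Representation k L M) (ρ' : Representation k L' M') (θ : L ≃* L') (f : M →ₗ[k] M')
    (hf : ∀ l m, f (ρ l m) = ρ' (θ l) (f m)) (S : Subgroup L) (m : M)
    (hm : ∀ s ∈ S, ρ s m = m) :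
    f (relTrace ρ S m) = relTrace ρ' (S.map θ.toMonoidHom) (f m) := by
  unfold relTrace
  have hfin : (Function.support fun q : L ⧸ S => ρ q.out m).Finite := Set.toFinite _
  rw [map_finsum f (f := fun q : L ⧸ S => ρ q.out m) hfin]
  have key : ∀ a b : L, (QuotientGroup.leftRel S) a b ↔
      (QuotientGroup.leftRel (S.map θ.toMonoidHom)) (θ a) (θ b) := by
    intro a b
    rw [QuotientGroup.leftRel_apply, QuotientGroup.leftRel_apply]
    constructor
    · intro h
      exact ⟨a⁻¹ * b, h, by simp⟩
    · rintro ⟨c, hc, hc'⟩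
      have : c = a⁻¹ * b := by
        apply θ.injective
        simpa using hc'
      exact this ▸ hc
  let e : L ⧸ S ≃ L' ⧸ (S.map θ.toMonoidHom) := Quotient.congr θ.toEquiv key
  rw [← finsum_comp_equiv e]
  refine finsum_congr fun q => ?_
  rw [hf]
  have h1 : (QuotientGroup.mk (e q).out : L' ⧸ (S.map θ.toMonoidHom)) =
      QuotientGroup.mk (θ q.out) := by
    rw [QuotientGroup.out_eq']
    conv_lhs => rw [← QuotientGroup.out_eq' q]
    rfl
  rw [QuotientGroup.eq] at h1
  obtain ⟨s, hs, hs'⟩ := h1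
  have h2 : θ q.out = (e q).out * θ s := by
    have h3 : θ s = (e q).out⁻¹ * θ q.out := hs'
    rw [h3]; group
  rw [h2, map_mul, Module.End.mul_apply, ← hf, hm s hs]

theorem map_properTraces {k L L' M M' : Type*} [Field k] [Group L] [Finite L] [Group L']
    [AddCommGroup M] [Module k M] [AddCommGroup M'] [Module k M']
    (ρ : Representation k L M) (ρ' : Representation k L' M') (θ : L ≃* L') (f : M →ₗ[k] M')
    (hf : ∀ l m, f (ρ l m) = ρ' (θ l) (f m)) {x : M} (hx : x ∈ properTraces ρ) :
    f x ∈ properTraces ρ' := by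
  have : properTraces ρ ≤ (properTraces ρ').comap f := by
    refine Submodule.span_le.2 ?_
    rintro _ ⟨S, hS, m, hm, rfl⟩
    refine Submodule.subset_span ⟨S.map θ.toMonoidHom, ?_, f m, ?_, ?_⟩
    · intro h
      apply hS
      rw [eq_top_iff]
      intro l _
      have : θ l ∈ S.map θ.toMonoidHom := h ▸ Subgroup.mem_top _
      obtain ⟨l', hl', h'⟩ := this
      exact θ.injective h' ▸ hl'
    · rintro _ ⟨s, hs, rfl⟩
      change ρ' (θ s) (f m) = f m
      rw [← hf, hm s hs]
    · exact map_relTrace ρ ρ' θ f hf S m hm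
  exact this hx

/-! ### Idempotents, points and blocks -/

/-- `e` is a primitive idempotent of the subalgebra `S`. -/
def IsPrimitiveIdempotentIn {k B : Type*} [Field k] [Ring B] [Algebra k B]
    (S : Subalgebra k B) (e : B) : Prop :=
  e ∈ S ∧ e * e = e ∧ e ≠ 0 ∧
    ∀ f ∈ S, ∀ g ∈ S, f * f = f → g * g = g → f * g = 0 → g * f = 0 → f + g = e →
      f = 0 ∨ g = 0

/-- A block of the `k`-algebra `B`: a primitive idempotent of its centre. -/
def IsBlock (k : Type*) {B : Type*} [Field k] [Ring B] [Algebra k B] (e : B) : Prop :=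
  IsPrimitiveIdempotentIn (Subalgebra.center k B) e

/-- In a finite-dimensional algebra, an idempotent which an additive map does not kill dominates
a primitive idempotent which it does not kill. -/
theorem exists_primitive_of_ne_zero {k B Z : Type*} [Field k] [Ring B] [Algebra k B]
    [FiniteDimensional k B] [AddCommGroup Z] (S : Subalgebra k B) (Φ : S →+ Z) :
    ∀ (n : ℕ) (i : S), Module.finrank k (LinearMap.range (LinearMap.mulLeft k (i : B))) ≤ n →
      i * i = i → Φ i ≠ 0 →
      ∃ j : S, IsPrimitiveIdempotentIn S (j : B) ∧ i * j = j ∧ j * i = j ∧ Φ j ≠ 0 := by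
  intro n
  induction n with
  | zero =>
    intro i hn hi hΦ
    exfalso
    apply hΦ
    have h0 : LinearMap.range (LinearMap.mulLeft k (i : B)) = ⊥ :=
      Submodule.finrank_eq_zero.1 (Nat.le_zero.1 hn)
    have : (i : B) ∈ LinearMap.range (LinearMap.mulLeft k (i : B)) := ⟨1, by simp⟩
    rw [h0, Submodule.mem_bot] at this
    have h' : i = 0 := Subtype.ext this
    rw [h', map_zero]
  | succ n ih =>
    intro i hn hi hΦ
    by_cases hp : IsPrimitiveIdempotentIn S (i : B)
    · exact ⟨i, hp, hi, hi, hΦ⟩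
    have hi0 : (i : B) ≠ 0 := by
      intro h
      have h' : i = 0 := Subtype.ext h
      exact hΦ (by rw [h', map_zero])
    have hex : ∃ f g : S, f * f = f ∧ g * g = g ∧ f * g = 0 ∧ g * f = 0 ∧ f + g = i ∧
        f ≠ 0 ∧ g ≠ 0 := by
      by_contra hcon
      apply hp
      refine ⟨i.2, congrArg Subtype.val hi, hi0, ?_⟩
      intro f hf g hg h1 h2 h3 h4 h5
      by_contra hfg
      rw [not_or] at hfg
      exact hcon ⟨⟨f, hf⟩, ⟨g, hg⟩, Subtype.ext h1, Subtype.ext h2, Subtype.ext h3,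
        Subtype.ext h4, Subtype.ext h5, fun h => hfg.1 (congrArg Subtype.val h),
        fun h => hfg.2 (congrArg Subtype.val h)⟩
    obtain ⟨f, g, hf, hg, hfg, hgf, hsum, hf0, hg0⟩ := hex
    have step : ∀ f g : S, f * f = f → g * g = g → f * g = 0 → g * f = 0 → f + g = i → g ≠ 0 →
        Φ f ≠ 0 →
        ∃ j : S, IsPrimitiveIdempotentIn S (j : B) ∧ i * j = j ∧ j * i = j ∧ Φ j ≠ 0 := by
      intro f g hf hg hfg hgf hsum hg0 hΦf
      have hif : i * f = f := by rw [← hsum, add_mul, hf, hgf, add_zero]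
      have hfi : f * i = f := by rw [← hsum, mul_add, hf, hfg, add_zero]
      have hig : i * g = g := by rw [← hsum, add_mul, hfg, hg, zero_add]
      have hlt : LinearMap.range (LinearMap.mulLeft k (f : B)) <
          LinearMap.range (LinearMap.mulLeft k (i : B)) := by
        refine lt_of_le_of_ne ?_ ?_
        · rintro _ ⟨x, rfl⟩
          refine ⟨f * x, ?_⟩
          have : (i : B) * f = f := congrArg Subtype.val hif
          simp [← mul_assoc, this]
        · intro heq
          have : (g : B) ∈ LinearMap.range (LinearMap.mulLeft k (i : B)) :=
            ⟨g, congrArg Subtype.val hig⟩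
          rw [← heq] at this
          obtain ⟨x, hx⟩ := this
          have hx : (f : B) * x = g := hx
          have hfg' : (f : B) * g = 0 := congrArg Subtype.val hfg
          have hf' : (f : B) * f = f := congrArg Subtype.val hf
          apply hg0
          apply Subtype.ext
          rw [← hx, ← mul_assoc, hf', hx] at hfg'
          simpa using hfg'
      have := Submodule.finrank_lt_finrank_of_lt hlt
      obtain ⟨j, hj, h1, h2, h3⟩ := ih f (by omega) hf hΦf
      refine ⟨j, hj, ?_, ?_, h3⟩
      · rw [← h1, ← mul_assoc, hif]
      · rw [← h2, mul_assoc, hfi]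
    by_cases hΦf : Φ f = 0
    · refine step g f hg hf hgf hfg (by rw [add_comm, hsum]) hf0 ?_
      intro h
      apply hΦ
      rw [← hsum, map_add, hΦf, h, add_zero]
    · exact step f g hf hg hfg hgf hsum hg0 hΦf

/-- A point of the group `L` on the `L`-algebra `B`: a conjugacy class, under the units of the
fixed subalgebra `B^L`, of a primitive idempotent of `B^L`. -/
def IsPoint (k L : Type*) {B : Type*} [Field k] [Group L] [Ring B] [Algebra k B]
    [MulSemiringAction L B] [SMulCommClass L k B] (α : Set B) : Prop :=
  ∃ i : B, IsPrimitiveIdempotentIn (FixedPoints.subalgebra k B L) i ∧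
    α = {x | ∃ u : (FixedPoints.subalgebra k B L)ˣ,
      x = ((u : FixedPoints.subalgebra k B L) : B) * i *
        ((u⁻¹ : (FixedPoints.subalgebra k B L)ˣ) : FixedPoints.subalgebra k B L)}

/-- The image `B_S^L` of the relative trace `Tr_S^L : B^S → B^L` on an `L`-algebra `B`. -/
def traceImage (k L : Type*) (B : Type*) [Field k] [Group L] [Ring B] [Algebra k B]
    [MulSemiringAction L B] [SMulCommClass L k B] (S : Subgroup L) : Set B :=
  {x | ∃ a : B, (∀ s ∈ S, s • a = a) ∧ x = relTrace (Representation.ofDistribMulAction k L B) S a}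

/-- `P` is a defect group of the (primitive) idempotent `i` of `B^L`: a minimal subgroup `P` of
`L` with `i ∈ B_P^L`. -/
def IsDefectGroup (k : Type*) {L B : Type*} [Field k] [Group L] [Ring B] [Algebra k B]
    [MulSemiringAction L B] [SMulCommClass L k B] (P : Subgroup L) (i : B) : Prop :=
  i ∈ traceImage k L B P ∧ ∀ S : Subgroup L, S < P → i ∉ traceImage k L B S

/-- `P` is a defect group of the point `α`. -/
def IsDefectGroupOfPoint (k : Type*) {L B : Type*} [Field k] [Group L] [Ring B] [Algebra k B]
    [MulSemiringAction L B] [SMulCommClass L k B] (P : Subgroup L) (α : Set B) : Prop :=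
  ∀ i ∈ α, IsDefectGroup k P i

/-- Let `M ≤ L` act on `B`, and let `j` be an `L`-invariant idempotent with defect group `Q`
in `M`. The set `α` is a point of `L` on `B` which covers `j`. -/
def CoversIdempotent (k : Type*) {L B : Type*} [Field k] [Group L] [Ring B] [Algebra k B]
    [MulSemiringAction L B] [SMulCommClass L k B] (M : Subgroup L) (Q : Subgroup M)
    (j : B) (α : Set B) : Prop :=
  IsPoint k L α ∧ ∃ i ∈ α, ∃ ε : Set B, IsPoint k M ε ∧ IsDefectGroupOfPoint k Q ε ∧
    i * j = i ∧ j * i = i ∧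
    (∃ f ∈ ε, i * f = f ∧ f * i = f) ∧ (∃ f₁ ∈ ε, j * f₁ = f₁ ∧ f₁ * j = f₁)

/-! ### The Brauer quotient of an algebra with group action -/

/-- The ideal `∑_{S < R} B_S^R` of the fixed subalgebra `B^R`. -/
noncomputable def brauerIdeal (k : Type*) {G : Type*} (B : Type*) [Field k] [Group G] [Finite G]
    [Ring B] [Algebra k B] [MulSemiringAction G B] [SMulCommClass G k B] (R : Subgroup G) :
    Ideal (FixedPoints.subalgebra k B R) where
  carrier := {x | (x : B) ∈ properTraces (Representation.ofDistribMulAction k R B)}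
  add_mem' {a b} ha hb := Submodule.add_mem
    (properTraces (Representation.ofDistribMulAction k R B)) (x := (a : B)) (y := (b : B)) ha hb
  zero_mem' := Submodule.zero_mem (properTraces (Representation.ofDistribMulAction k R B))
  smul_mem' := by
    intro c x hx
    refine map_properTraces (Representation.ofDistribMulAction k R B) _ (MulEquiv.refl R)
      (LinearMap.mulLeft k (c : B)) ?_ hx
    intro l m
    have hc : l • (c : B) = c := c.2 l
    simp [smul_mul', hc]

theorem mem_brauerIdeal (k : Type*) {G : Type*} {B : Type*} [Field k] [Group G] [Finite G]
    [Ring B] [Algebra k B] [MulSemiringAction G B] [SMulCommClass G k B] (R : Subgroup G)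
    (x : FixedPoints.subalgebra k B R) : x ∈ brauerIdeal k B R ↔
      (x : B) ∈ properTraces (Representation.ofDistribMulAction k R B) := Iff.rfl

instance brauerIdeal_isTwoSided (k : Type*) {G : Type*} (B : Type*) [Field k] [Group G] [Finite G]
    [Ring B] [Algebra k B] [MulSemiringAction G B] [SMulCommClass G k B] (R : Subgroup G) :
    (brauerIdeal k B R).IsTwoSided where
  mul_mem_of_left := by
    intro x c hx
    refine map_properTraces (Representation.ofDistribMulAction k R B) _ (MulEquiv.refl R)
      (LinearMap.mulRight k (c : B)) ?_ ((mem_brauerIdeal k R _).1 hx)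
    intro l m
    have hc : l • (c : B) = c := c.2 l
    simp [smul_mul', hc]

/-- The Brauer quotient `B(R) = B^R / ∑_{S < R} B_S^R`. -/
def BrauerQuotient (k : Type*) {G : Type*} (B : Type*) [Field k] [Group G] [Finite G]
    [Ring B] [Algebra k B] [MulSemiringAction G B] [SMulCommClass G k B] (R : Subgroup G) :=
  FixedPoints.subalgebra k B R ⧸ brauerIdeal k B R

namespace BrauerQuotient

noncomputable instance (k : Type*) {G : Type*} (B : Type*) [Field k] [Group G] [Finite G]
    [Ring B] [Algebra k B] [MulSemiringAction G B] [SMulCommClass G k B] (R : Subgroup G) :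
    Ring (BrauerQuotient k B R) :=
  inferInstanceAs (Ring (FixedPoints.subalgebra k B R ⧸ brauerIdeal k B R))

noncomputable instance (k : Type*) {G : Type*} (B : Type*) [Field k] [Group G] [Finite G]
    [Ring B] [Algebra k B] [MulSemiringAction G B] [SMulCommClass G k B] (R : Subgroup G) :
    Algebra k (BrauerQuotient k B R) :=
  inferInstanceAs (Algebra k (FixedPoints.subalgebra k B R ⧸ brauerIdeal k B R))

/-- The Brauer homomorphism `Br_R : B^R → B(R)`. -/
noncomputable def br (k : Type*) {G B : Type*} [Field k] [Group G] [Finite G]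
    [Ring B] [Algebra k B] [MulSemiringAction G B] [SMulCommClass G k B] (R : Subgroup G) :
    FixedPoints.subalgebra k B R →ₐ[k] BrauerQuotient k B R :=
  Ideal.Quotient.mkₐ k (brauerIdeal k B R)

theorem br_surjective (k : Type*) {G B : Type*} [Field k] [Group G] [Finite G]
    [Ring B] [Algebra k B] [MulSemiringAction G B] [SMulCommClass G k B] (R : Subgroup G) :
    Function.Surjective (br k (B := B) R) :=
  Ideal.Quotient.mkₐ_surjective k _

instance (k : Type*) {G : Type*} (B : Type*) [Field k] [Group G] [Finite G]
    [Ring B] [Algebra k B] [MulSemiringAction G B] [SMulCommClass G k B] (R : Subgroup G)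
    [FiniteDimensional k B] : FiniteDimensional k (BrauerQuotient k B R) :=
  Module.Finite.of_surjective (br k (B := B) R).toLinearMap (br_surjective k R)

/-- For `T = xRx⁻¹`, the map `B^R → B^T`, `b ↦ x • b`. -/
def conjFixed (k : Type*) {G B : Type*} [Field k] [Group G]
    [Ring B] [Algebra k B] [MulSemiringAction G B] [SMulCommClass G k B] (x : G)
    (R T : Subgroup G) (h : ∀ g, g ∈ R ↔ x * g * x⁻¹ ∈ T) :
    FixedPoints.subalgebra k B R →ₐ[k] FixedPoints.subalgebra k B T where
  toFun b := ⟨x • (b : B), by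
    rintro ⟨t, ht⟩
    have hr : x⁻¹ * t * x ∈ R := (h _).2 (by simpa [mul_assoc] using ht)
    have hb : (x⁻¹ * t * x) • (b : B) = b := b.2 ⟨_, hr⟩
    change t • x • (b : B) = x • (b : B)
    conv_rhs => rw [← hb]
    simp only [← mul_smul, mul_assoc, mul_inv_cancel_left]⟩
  map_one' := Subtype.ext (smul_one x)
  map_mul' a b := Subtype.ext (smul_mul' x (a : B) (b : B))
  map_zero' := Subtype.ext (smul_zero x)
  map_add' a b := Subtype.ext (smul_add x (a : B) (b : B))
  commutes' r := Subtype.ext (smul_algebraMap x r)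

/-- For `T = xRx⁻¹`, the isomorphism `B(R) → B(T)`, `Br_R(b) ↦ Br_T(x • b)`. -/
noncomputable def conj (k : Type*) {G B : Type*} [Field k] [Group G] [Finite G]
    [Ring B] [Algebra k B] [MulSemiringAction G B] [SMulCommClass G k B] (x : G)
    (R T : Subgroup G) (h : ∀ g, g ∈ R ↔ x * g * x⁻¹ ∈ T) :
    BrauerQuotient k B R →ₐ[k] BrauerQuotient k B T :=
  Ideal.Quotient.liftₐ (brauerIdeal k B R) ((br k T).comp (conjFixed k x R T h)) (by
    intro a ha
    refine Ideal.Quotient.eq_zero_iff_mem.2 ?_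
    let θ : R ≃* T :=
      { toFun := fun r => ⟨x * r * x⁻¹, (h _).1 r.2⟩
        invFun := fun t => ⟨x⁻¹ * t * x, (h _).2 (by simp [mul_assoc])⟩
        left_inv := fun r => Subtype.ext (by simp [mul_assoc])
        right_inv := fun r => Subtype.ext (by simp [mul_assoc])
        map_mul' := fun r s => Subtype.ext (by simp [mul_assoc]) }
    refine map_properTraces (Representation.ofDistribMulAction k R B)
      (Representation.ofDistribMulAction k T B) θ
      (Representation.ofDistribMulAction k G B x) ?_ ((mem_brauerIdeal k R _).1 ha)
    rintro ⟨r, hr⟩ m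
    change x • r • m = (x * r * x⁻¹) • x • m
    simp [← mul_smul])

theorem conj_br (k : Type*) {G B : Type*} [Field k] [Group G] [Finite G]
    [Ring B] [Algebra k B] [MulSemiringAction G B] [SMulCommClass G k B] (x : G)
    (R T : Subgroup G) (h : ∀ g, g ∈ R ↔ x * g * x⁻¹ ∈ T) (b : FixedPoints.subalgebra k B R) :
    conj k x R T h (br k R b) = br k T (conjFixed k x R T h b) := rfl

theorem conj_injective (k : Type*) {G B : Type*} [Field k] [Group G] [Finite G]
    [Ring B] [Algebra k B] [MulSemiringAction G B] [SMulCommClass G k B] (x : G)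
    (R T : Subgroup G) (h : ∀ g, g ∈ R ↔ x * g * x⁻¹ ∈ T) :
    Function.Injective (conj k (B := B) x R T h) := by
  have h' : ∀ g, g ∈ T ↔ x⁻¹ * g * x⁻¹⁻¹ ∈ R := fun g => by
    rw [h]; simp [mul_assoc]
  refine Function.LeftInverse.injective (g := conj k (B := B) x⁻¹ T R h') ?_
  intro y
  obtain ⟨b, rfl⟩ := br_surjective k R y
  rw [conj_br, conj_br]
  congr 1
  exact Subtype.ext (inv_smul_smul x (b : B))

/-- The action of `N_G(R)` on `B(R)` induced by the action of `G` on `B`. -/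
noncomputable instance (k : Type*) {G : Type*} (B : Type*) [Field k] [Group G] [Finite G]
    [Ring B] [Algebra k B] [MulSemiringAction G B] [SMulCommClass G k B] (R : Subgroup G) :
    MulSemiringAction (Subgroup.normalizer (R : Set G)) (BrauerQuotient k B R) where
  smul x y := conj k (x : G) R R x.2 y
  one_smul y := by
    obtain ⟨b, rfl⟩ := br_surjective k R y
    exact congrArg (br k R) (Subtype.ext (one_smul G (b : B)))
  mul_smul x x' y := by
    obtain ⟨b, rfl⟩ := br_surjective k R y
    exact congrArg (br k R) (Subtype.ext (mul_smul (x : G) (x' : G) (b : B)))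
  smul_zero x := map_zero _
  smul_add x := map_add _
  smul_one x := map_one _
  smul_mul x := map_mul _

instance (k : Type*) {G : Type*} (B : Type*) [Field k] [Group G] [Finite G]
    [Ring B] [Algebra k B] [MulSemiringAction G B] [SMulCommClass G k B] (R : Subgroup G) :
    SMulCommClass (Subgroup.normalizer (R : Set G)) k (BrauerQuotient k B R) where
  smul_comm x r y := map_smul (conj k (x : G) R R x.2) r y

end BrauerQuotient

/-! ### Brauer pairs and their fusion systems -/

/-- A pair `(R, e)` consisting of a subgroup `R` of `G` and an element `e` of `B(R)`. -/
structure BPair (k : Type*) {G : Type*} (B : Type*) [Field k] [Group G] [Finite G]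
    [Ring B] [Algebra k B] [MulSemiringAction G B] [SMulCommClass G k B] where
  /-- the subgroup of the pair -/
  subgroup : Subgroup G
  /-- the element of the Brauer quotient (a block, for a Brauer pair) -/
  elt : BrauerQuotient k B subgroup

/-- `(R, e)` is a `(B, c, G)`-Brauer pair: `R` is a `p`-subgroup of `G`, `e` is a block of `B(R)`
and `Br_R(c) e ≠ 0`. -/
def IsBrauerPair (p : ℕ) {k G B : Type*} [Field k] [Group G] [Finite G]
    [Ring B] [Algebra k B] [MulSemiringAction G B] [SMulCommClass G k B] (c : B)
    (X : BPair k (G := G) B) : Prop :=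
  IsPGroup p X.subgroup ∧ IsBlock k X.elt ∧
    ∃ hc : c ∈ FixedPoints.subalgebra k B X.subgroup,
      BrauerQuotient.br k X.subgroup ⟨c, hc⟩ * X.elt ≠ 0

/-- The inclusion `(S, e) ≤ (T, f)` of pairs: `S ≤ T`, and `Br_S(i) e ≠ 0` for every primitive
idempotent `i` of `B^T` with `Br_T(i) f ≠ 0`. -/
def BPair.Le {k G B : Type*} [Field k] [Group G] [Finite G]
    [Ring B] [Algebra k B] [MulSemiringAction G B] [SMulCommClass G k B]
    (X Y : BPair k (G := G) B) : Prop :=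
  X.subgroup ≤ Y.subgroup ∧
    ∀ (i : B) (hT : i ∈ FixedPoints.subalgebra k B Y.subgroup)
      (hS : i ∈ FixedPoints.subalgebra k B X.subgroup),
      IsPrimitiveIdempotentIn (FixedPoints.subalgebra k B Y.subgroup) i →
      BrauerQuotient.br k Y.subgroup ⟨i, hT⟩ * Y.elt ≠ 0 →
      BrauerQuotient.br k X.subgroup ⟨i, hS⟩ * X.elt ≠ 0

/-- The conjugate pair `ˣ(R, e) = (xRx⁻¹, ˣe)`. -/
noncomputable def BPair.conj {k G B : Type*} [Field k] [Group G] [Finite G]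
    [Ring B] [Algebra k B] [MulSemiringAction G B] [SMulCommClass G k B]
    (x : G) (X : BPair k (G := G) B) : BPair k (G := G) B where
  subgroup := X.subgroup.map (MulAut.conj x).toMonoidHom
  elt := BrauerQuotient.conj k x X.subgroup _ (fun g => by
    constructor
    · intro hg
      exact ⟨g, hg, rfl⟩
    · rintro ⟨h, hh, h'⟩
      have : h = g := by simpa using h'
      exact this ▸ hh) X.elt

/-- Maximal `(B, c, G)`-Brauer pairs. -/
def IsMaximalBrauerPair (p : ℕ) {k G B : Type*} [Field k] [Group G] [Finite G]
    [Ring B] [Algebra k B] [MulSemiringAction G B] [SMulCommClass G k B] (c : B)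
    (U : BPair k (G := G) B) : Prop :=
  IsBrauerPair p c U ∧ ∀ V : BPair k (G := G) B, IsBrauerPair p c V → U.Le V → V = U

theorem BPair.conj_le_iff {k G B : Type*} [Field k] [Group G] [Finite G]
    [Ring B] [Algebra k B] [MulSemiringAction G B] [SMulCommClass G k B]
    (x : G) (X Y : BPair k (G := G) B) : (X.conj x).Le Y ↔
      (∀ s ∈ X.subgroup, x * s * x⁻¹ ∈ Y.subgroup) ∧
      ∀ (i : B) (hT : i ∈ FixedPoints.subalgebra k B Y.subgroup)
        (hS : x⁻¹ • i ∈ FixedPoints.subalgebra k B X.subgroup),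
        IsPrimitiveIdempotentIn (FixedPoints.subalgebra k B Y.subgroup) i →
        BrauerQuotient.br k Y.subgroup ⟨i, hT⟩ * Y.elt ≠ 0 →
        BrauerQuotient.br k X.subgroup ⟨x⁻¹ • i, hS⟩ * X.elt ≠ 0 := by
  have hsub : (X.conj x).subgroup ≤ Y.subgroup ↔
      ∀ s ∈ X.subgroup, x * s * x⁻¹ ∈ Y.subgroup := by
    constructor
    · intro h s hs
      exact h ⟨s, hs, rfl⟩
    · rintro h _ ⟨s, hs, rfl⟩
      exact h s hs
  have hfix : ∀ i : B, i ∈ FixedPoints.subalgebra k B (X.conj x).subgroup ↔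
      x⁻¹ • i ∈ FixedPoints.subalgebra k B X.subgroup := by
    intro i
    constructor
    · rintro hi ⟨s, hs⟩
      have h1 : (x * s * x⁻¹) • i = i := hi ⟨x * s * x⁻¹, ⟨s, hs, rfl⟩⟩
      change s • x⁻¹ • i = x⁻¹ • i
      conv_rhs => rw [← h1]
      simp only [← mul_smul, mul_assoc, inv_mul_cancel_left]
    · rintro hi ⟨_, ⟨s, hs, rfl⟩⟩
      have h1 : s • x⁻¹ • i = x⁻¹ • i := hi ⟨s, hs⟩
      change (x * s * x⁻¹) • i = i
      rw [mul_smul, mul_smul, h1, smul_inv_smul]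
  have hne : ∀ (i : B) (h1 : i ∈ FixedPoints.subalgebra k B (X.conj x).subgroup)
      (h2 : x⁻¹ • i ∈ FixedPoints.subalgebra k B X.subgroup),
      BrauerQuotient.br k (X.conj x).subgroup ⟨i, h1⟩ * (X.conj x).elt ≠ 0 ↔
      BrauerQuotient.br k X.subgroup ⟨x⁻¹ • i, h2⟩ * X.elt ≠ 0 := by
    intro i h1 h2
    have hmem : ∀ g, g ∈ X.subgroup ↔ x * g * x⁻¹ ∈ (X.conj x).subgroup := by
      intro g
      constructor
      · intro hg
        exact ⟨g, hg, rfl⟩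
      · rintro ⟨h, hh, h'⟩
        have : h = g := by simpa using h'
        exact this ▸ hh
    have e1 : BrauerQuotient.br k (X.conj x).subgroup ⟨i, h1⟩ =
        BrauerQuotient.conj k x X.subgroup (X.conj x).subgroup hmem
          (BrauerQuotient.br k X.subgroup ⟨x⁻¹ • i, h2⟩) := by
      rw [BrauerQuotient.conj_br]
      congr 1
      exact Subtype.ext (smul_inv_smul x i).symm
    have e2 : (X.conj x).elt =
        BrauerQuotient.conj k x X.subgroup (X.conj x).subgroup hmem X.elt := rfl
    rw [e1, e2, ← map_mul, map_ne_zero_iff _ (BrauerQuotient.conj_injective k x _ _ hmem)]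
  unfold BPair.Le
  rw [hsub]
  refine and_congr_right fun _ => ?_
  constructor
  · intro h i hT hS hp hi
    exact (hne i ((hfix i).2 hS) hS).1 (h i hT ((hfix i).2 hS) hp hi)
  · intro h i hT hS hp hi
    exact (hne i hS ((hfix i).1 hS)).2 (h i hT ((hfix i).1 hS) hp hi)

theorem BPair.conj_one_le {k G B : Type*} [Field k] [Group G] [Finite G]
    [Ring B] [Algebra k B] [MulSemiringAction G B] [SMulCommClass G k B]
    (X : BPair k (G := G) B) : (X.conj 1).Le X := by
  rw [BPair.conj_le_iff]
  refine ⟨fun s hs => by simpa using hs, fun i hT hS _ hi => ?_⟩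
  have : (⟨(1 : G)⁻¹ • i, hS⟩ : FixedPoints.subalgebra k B X.subgroup) = ⟨i, hT⟩ :=
    Subtype.ext (by simp)
  rwa [this]

theorem BPair.conj_mul_le {k G B : Type*} [Field k] [Group G] [Finite G]
    [Ring B] [Algebra k B] [FiniteDimensional k B] [MulSemiringAction G B] [SMulCommClass G k B]
    {x y : G} {X Y Z : BPair k (G := G) B} (hx : (X.conj x).Le Y) (hy : (Y.conj y).Le Z) :
    (X.conj (y * x)).Le Z := by
  rw [BPair.conj_le_iff] at hx hy ⊢
  refine ⟨fun s hs => ?_, fun i hT hS hp hi => ?_⟩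
  · have := hy.1 _ (hx.1 s hs)
    simpa [mul_assoc] using this
  · have hY : y⁻¹ • i ∈ FixedPoints.subalgebra k B Y.subgroup := by
      rintro ⟨s, hs⟩
      have h1 : (y * s * y⁻¹) • i = i := hT ⟨_, hy.1 s hs⟩
      change s • y⁻¹ • i = y⁻¹ • i
      conv_rhs => rw [← h1]
      simp only [← mul_smul, mul_assoc, inv_mul_cancel_left]
    have hYi := hy.2 i hT hY hp hi
    obtain ⟨j, hj, h1, h2, h3⟩ := exists_primitive_of_ne_zero
      (FixedPoints.subalgebra k B Y.subgroup)
      ((AddMonoidHom.mulRight Y.elt).comp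
        ((BrauerQuotient.br k (B := B) Y.subgroup).toRingHom.toAddMonoidHom))
      _ ⟨y⁻¹ • i, hY⟩ le_rfl
      (Subtype.ext (by
        change (y⁻¹ • i) * (y⁻¹ • i) = y⁻¹ • i
        rw [← smul_mul', hp.2.1])) hYi
    have hX : x⁻¹ • (j : B) ∈ FixedPoints.subalgebra k B X.subgroup := by
      rintro ⟨s, hs⟩
      have h1 : (x * s * x⁻¹) • (j : B) = j := j.2 ⟨_, hx.1 s hs⟩
      change s • x⁻¹ • (j : B) = x⁻¹ • (j : B)
      conv_rhs => rw [← h1]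
      simp only [← mul_smul, mul_assoc, inv_mul_cancel_left]
    have hXj := hx.2 j j.2 hX hj h3
    intro h0
    apply hXj
    have hji : (⟨x⁻¹ • (j : B), hX⟩ : FixedPoints.subalgebra k B X.subgroup) =
        ⟨x⁻¹ • (j : B), hX⟩ * ⟨(y * x)⁻¹ • i, hS⟩ := by
      apply Subtype.ext
      change x⁻¹ • (j : B) = (x⁻¹ • (j : B)) * ((y * x)⁻¹ • i)
      have h2' : (j : B) * (y⁻¹ • i) = j := congrArg Subtype.val h2
      rw [mul_inv_rev, mul_smul, ← smul_mul', h2']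
    rw [hji, map_mul, mul_assoc, h0, mul_zero]

/-- The objects of the fusion system `F_U(B, c, G)`: the `(B, c, G)`-Brauer pairs contained in the
pair `U` (for a maximal Brauer pair `U = (T, f)`, these correspond to the subgroups of `T`). -/
structure FusionSystem (p : ℕ) {k G B : Type*} [Field k] [Group G] [Finite G]
    [Ring B] [Algebra k B] [MulSemiringAction G B] [SMulCommClass G k B] (c : B)
    (U : BPair k (G := G) B) where
  /-- the underlying pair -/
  pair : BPair k (G := G) B
  isBrauerPair : IsBrauerPair p c pair
  le : pair.Le U

/-- Morphisms `(S, e) → (T, f)` in the fusion system: the group homomorphisms `S → T` of the form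
`u ↦ xux⁻¹` for some `x ∈ G` with `ˣ(S, e) ≤ (T, f)`. -/
def FusionSystem.Hom {p : ℕ} {k G B : Type*} [Field k] [Group G] [Finite G]
    [Ring B] [Algebra k B] [MulSemiringAction G B] [SMulCommClass G k B] {c : B}
    {U : BPair k (G := G) B} (X Y : FusionSystem p c U) :=
  {φ : X.pair.subgroup →* Y.pair.subgroup // ∃ x : G, (X.pair.conj x).Le Y.pair ∧
    ∀ u : X.pair.subgroup, (φ u : G) = x * u * x⁻¹}

instance {p : ℕ} {k G B : Type*} [Field k] [Group G] [Finite G]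
    [Ring B] [Algebra k B] [FiniteDimensional k B] [MulSemiringAction G B] [SMulCommClass G k B]
    {c : B} {U : BPair k (G := G) B} : CategoryTheory.Category (FusionSystem p c U) where
  Hom := FusionSystem.Hom
  id X := ⟨MonoidHom.id _, 1, X.pair.conj_one_le, fun u => by simp⟩
  comp f g := ⟨g.1.comp f.1, by
    obtain ⟨x, hx, hx'⟩ := f.2
    obtain ⟨y, hy, hy'⟩ := g.2
    refine ⟨y * x, BPair.conj_mul_le hx hy, fun u => ?_⟩
    rw [MonoidHom.comp_apply, hy', hx']
    group⟩

/-- The group homomorphism underlying a morphism of the fusion system. -/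
def FusionSystem.toMonoidHom {p : ℕ} {k G B : Type*} [Field k] [Group G] [Finite G]
    [Ring B] [Algebra k B] [FiniteDimensional k B] [MulSemiringAction G B] [SMulCommClass G k B]
    {c : B} {U : BPair k (G := G) B} {X Y : FusionSystem p c U} (φ : X ⟶ Y) :
    X.pair.subgroup →* Y.pair.subgroup :=
  Subtype.val (show FusionSystem.Hom X Y from φ)

/-- The full subcategory of the fusion system `F_U(B, c, G)` on the Brauer pairs `X` with
`Q ≤ X` and `X ≤ P`, for given pairs `Q` and `P`. -/
abbrev FusionInterval (p : ℕ) {k G B : Type*} [Field k] [Group G] [Finite G]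
    [Ring B] [Algebra k B] [FiniteDimensional k B] [MulSemiringAction G B] [SMulCommClass G k B]
    (c : B) (U Q P : BPair k (G := G) B) :=
  CategoryTheory.ObjectProperty.FullSubcategory
    (fun X : FusionSystem p c U => Q.Le X.pair ∧ X.pair.Le P)

/-! ### The triple `(C(Q), f_Q, H)` with `H = N_G(Q, f_Q)` -/

/-- `H = N_G(Q, f)`: the stabilizer in `N_G(Q)` of the element `f` of `C(Q)`. -/
noncomputable abbrev pairNormalizer {k G C : Type*} [Field k] [Group G] [Finite G]
    [Ring C] [Algebra k C] [MulSemiringAction G C] [SMulCommClass G k C] (Q : Subgroup G)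
    (f : BrauerQuotient k C Q) : Subgroup (Subgroup.normalizer (Q : Set G)) :=
  MulAction.stabilizer (Subgroup.normalizer (Q : Set G)) f

/-- The inclusion of `N_G(Q, f)` into `G`. -/
noncomputable def pairNormalizerIncl {k G C : Type*} [Field k] [Group G] [Finite G]
    [Ring C] [Algebra k C] [MulSemiringAction G C] [SMulCommClass G k C] (Q : Subgroup G)
    (f : BrauerQuotient k C Q) : pairNormalizer Q f →* G :=
  (Subgroup.normalizer (Q : Set G)).subtype.comp (pairNormalizer Q f).subtype

/-- The pair `(Q, f)`, seen as a pair for the `N_G(Q, f)`-algebra `C(Q)`; the block is the image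
of `f` under the isomorphism `Br_Q : C(Q) → C(Q)(Q)`. -/
noncomputable def basePair {k G C : Type*} [Field k] [Group G] [Finite G]
    [Ring C] [Algebra k C] [MulSemiringAction G C] [SMulCommClass G k C] (Q : Subgroup G)
    (f : BrauerQuotient k C Q) : BPair k (G := pairNormalizer Q f) (BrauerQuotient k C Q) where
  subgroup := Q.comap (pairNormalizerIncl Q f)
  elt := BrauerQuotient.br k _ ⟨f, fun g => g.1.2⟩

/-- For `Q ≤ R ≤ N_G(Q, f)`, the pairs `(R, e)` (with `e ∈ C(R)`) and `(R, e')` (with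
`e' ∈ C(Q)(R)`) are identified if `e'` corresponds to `e` under the canonical isomorphism
`C(R) → C(Q)(R)`, `Br_R(a) ↦ Br_R(Br_Q(a))`. -/
def Corresponds {k G C : Type*} [Field k] [Group G] [Finite G]
    [Ring C] [Algebra k C] [MulSemiringAction G C] [SMulCommClass G k C] (Q : Subgroup G)
    (f : BrauerQuotient k C Q) (X : BPair k (G := G) C)
    (X' : BPair k (G := pairNormalizer Q f) (BrauerQuotient k C Q)) : Prop :=
  X.subgroup = X'.subgroup.map (pairNormalizerIncl Q f) ∧ Q ≤ X.subgroup ∧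
    ∃ (a : C) (hR : a ∈ FixedPoints.subalgebra k C X.subgroup)
      (hQ : a ∈ FixedPoints.subalgebra k C Q)
      (hQR : BrauerQuotient.br k Q ⟨a, hQ⟩ ∈
        FixedPoints.subalgebra k (BrauerQuotient k C Q) X'.subgroup),
      BrauerQuotient.br k X.subgroup ⟨a, hR⟩ = X.elt ∧
      BrauerQuotient.br k X'.subgroup ⟨BrauerQuotient.br k Q ⟨a, hQ⟩, hQR⟩ = X'.elt

/-! ### Interior algebras and their extended Brauer quotients -/

/-- Left multiplication by the elements of a subgroup `N` on an interior `G`-algebra `A`: this is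
the `k[N × 1]`-module structure of `A`. -/
def leftMulRep (k : Type*) {G A : Type*} [Field k] [Group G] [Ring A] [Algebra k A]
    (σ : G →* Aˣ) (N : Subgroup G) : Representation k N A where
  toFun n := LinearMap.mulLeft k (σ n : A)
  map_one' := by ext; simp
  map_mul' m n := by ext; simp

/-- Right multiplication `n ↦ (a ↦ a n⁻¹)` by the elements of a subgroup `N` on an interior
`G`-algebra `A`: this is the `k[1 × N]`-module structure of `A`. -/
def rightMulRep (k : Type*) {G A : Type*} [Field k] [Group G] [Ring A] [Algebra k A]
    (σ : G →* Aˣ) (N : Subgroup G) : Representation k N A where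
  toFun n := LinearMap.mulRight k ((σ n)⁻¹ : Aˣ)
  map_one' := by ext; simp
  map_mul' m n := by ext; simp

/-- `A` has a `G × G`-stable `k`-basis. -/
def HasBiStableBasis (k : Type*) {G A : Type*} [Field k] [Group G] [Ring A] [Algebra k A]
    (σ : G →* Aˣ) : Prop :=
  ∃ b : Module.Basis (Fin (Module.finrank k A)) k A,
    ∀ (g h : G) i, ∃ j, (σ g : A) * b i * (σ h : A) = b j

/-- `B` is a `p`-permutation `G`-algebra: it has an `R`-stable basis for every `p`-subgroup `R`. -/
def IsPPermutationAlgebra (p : ℕ) (k G B : Type*) [Field k] [Group G] [Ring B] [Algebra k B]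
    [MulSemiringAction G B] : Prop :=
  ∀ R : Subgroup G, IsPGroup p R →
    ∃ b : Module.Basis (Fin (Module.finrank k B)) k B, ∀ r ∈ R, ∀ i, ∃ j, r • b i = b j

/-- The twisted conjugation `u ↦ (a ↦ φ(u) a u⁻¹)` of `Q` on an interior `G`-algebra, for an
automorphism `φ` of `Q`. -/
def twistedRep (k : Type*) {G A : Type*} [Field k] [Group G] [Ring A] [Algebra k A]
    (σ : G →* Aˣ) (Q : Subgroup G) (φ : MulAut Q) : Representation k Q A where
  toFun u := LinearMap.mulLeft k (σ (φ u) : A) ∘ₗ LinearMap.mulRight k ((σ u)⁻¹ : Aˣ)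
  map_one' := by ext; simp
  map_mul' m n := by ext; simp [mul_assoc]

theorem twistedRep_apply (k : Type*) {G A : Type*} [Field k] [Group G] [Ring A] [Algebra k A]
    (σ : G →* Aˣ) (Q : Subgroup G) (φ : MulAut Q) (u : Q) (a : A) :
    twistedRep k σ Q φ u a = (σ (φ u) : A) * (a * ((σ u)⁻¹ : Aˣ)) := rfl

/-- The algebra `⨁_φ N_A^φ(Q)`, `φ ∈ Aut(Q)`, where `N_A^φ(Q)` is the space of all `a ∈ A` with
`φ(u) a = a u` for `u ∈ Q`, as a subalgebra of the group algebra of `Aut(Q)` over `A` (so the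
product of the terms of degrees `φ` and `ψ` is a term of degree `φψ`). -/
noncomputable def extendedFixed (k : Type*) {G A : Type*} [Field k] [Group G] [Ring A]
    [Algebra k A] (σ : G →* Aˣ) (Q : Subgroup G) : Subalgebra k (MonoidAlgebra A (MulAut Q)) where
  carrier := {x | ∀ φ : MulAut Q, ∀ u : Q, (σ (φ u) : A) * x.coeff φ = x.coeff φ * (σ u : A)}
  mul_mem' := by
    classical
    intro x y hx hy φ u
    rw [MonoidAlgebra.coeff_mul]
    simp only [Finsupp.sum, Finset.mul_sum, Finset.sum_mul]
    refine Finset.sum_congr rfl fun α _ => Finset.sum_congr rfl fun β _ => ?_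
    split_ifs with h
    · rw [← h, MulAut.mul_apply, ← mul_assoc, hx, mul_assoc, hy, mul_assoc]
    · simp
  add_mem' := by
    intro x y hx hy φ u
    rw [MonoidAlgebra.coeff_add, Finsupp.add_apply, mul_add, add_mul, hx, hy]
  algebraMap_mem' := by
    classical
    intro r φ u
    rw [MonoidAlgebra.coe_algebraMap, Function.comp_apply, MonoidAlgebra.coeff_single,
      Finsupp.single_apply]
    split_ifs with h
    · rw [← h, MulAut.one_apply]
      exact (Algebra.commutes r _).symm
    · simp

theorem mem_extendedFixed (k : Type*) {G A : Type*} [Field k] [Group G] [Ring A]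
    [Algebra k A] (σ : G →* Aˣ) (Q : Subgroup G) (x : MonoidAlgebra A (MulAut Q)) :
    x ∈ extendedFixed k σ Q ↔
      ∀ φ : MulAut Q, ∀ u : Q, (σ (φ u) : A) * x.coeff φ = x.coeff φ * (σ u : A) := Iff.rfl

/-- The ideal of `⨁_φ N_A^φ(Q)` whose component of degree `φ` is spanned by the relative traces,
for the action `u ↦ (a ↦ φ(u) a u⁻¹)` of `Q` on `A`, from the proper subgroups of `Q`. -/
noncomputable def extendedIdeal (k : Type*) {G A : Type*} [Field k] [Group G] [Finite G] [Ring A]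
    [Algebra k A] (σ : G →* Aˣ) (Q : Subgroup G) : Ideal (extendedFixed k σ Q) where
  carrier := {x | ∀ φ : MulAut Q,
    (x : MonoidAlgebra A (MulAut Q)).coeff φ ∈ properTraces (twistedRep k σ Q φ)}
  add_mem' {x y} hx hy φ := by
    have := Submodule.add_mem _ (hx φ) (hy φ)
    simpa using this
  zero_mem' φ := by
    simp
  smul_mem' := by
    classical
    rintro ⟨x, hx⟩ ⟨y, hy'⟩ hy φ
    change (x * y).coeff φ ∈ _
    rw [MonoidAlgebra.coeff_mul]
    refine Submodule.sum_mem _ fun α _ => Submodule.sum_mem _ fun β _ => ?_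
    dsimp only
    split_ifs with h
    · subst h
      refine map_properTraces (twistedRep k σ Q β) _ (MulEquiv.refl Q)
        (LinearMap.mulLeft k (x.coeff α)) ?_ (hy β)
      intro u m
      simp only [twistedRep_apply, LinearMap.mulLeft_apply, MulEquiv.refl_apply,
        MulAut.mul_apply, ← mul_assoc]
      rw [hx]
    · exact Submodule.zero_mem _

theorem mem_extendedIdeal (k : Type*) {G A : Type*} [Field k] [Group G] [Finite G] [Ring A]
    [Algebra k A] (σ : G →* Aˣ) (Q : Subgroup G) (x : extendedFixed k σ Q) :
    x ∈ extendedIdeal k σ Q ↔ ∀ φ : MulAut Q,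
      (x : MonoidAlgebra A (MulAut Q)).coeff φ ∈ properTraces (twistedRep k σ Q φ) := Iff.rfl

instance (k : Type*) {G A : Type*} [Field k] [Group G] [Finite G] [Ring A]
    [Algebra k A] (σ : G →* Aˣ) (Q : Subgroup G) : (extendedIdeal k σ Q).IsTwoSided where
  mul_mem_of_left := by
    classical
    rintro ⟨x, hx'⟩ ⟨y, hy⟩ hx φ
    change (x * y).coeff φ ∈ _
    rw [MonoidAlgebra.coeff_mul]
    refine Submodule.sum_mem _ fun α _ => Submodule.sum_mem _ fun β _ => ?_
    dsimp only
    split_ifs with h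
    · subst h
      refine map_properTraces (twistedRep k σ Q α) _ β.symm
        (LinearMap.mulRight k (y.coeff β)) ?_ (hx α)
      intro u m
      have h1 := hy β (β.symm u)
      have h2 : ((σ u)⁻¹ : Aˣ) * y.coeff β = y.coeff β * ((σ (β.symm u))⁻¹ : Aˣ) := by
        rw [Units.inv_mul_eq_iff_eq_mul, ← mul_assoc, Units.eq_mul_inv_iff_mul_eq, ← h1]
        simp
      simp only [twistedRep_apply, LinearMap.mulRight_apply, MulAut.mul_apply, mul_assoc]
      rw [h2]
      simp
    · exact Submodule.zero_mem _

/-- The extended Brauer quotient `X = ⨁_φ N_A^φ(Q) / ∑_{S < Q} (traces from S)`, where `φ` runs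
over `Aut(Q)`. -/
def ExtendedBrauerQuotient (k : Type*) {G A : Type*} [Field k] [Group G] [Finite G] [Ring A]
    [Algebra k A] (σ : G →* Aˣ) (Q : Subgroup G) :=
  extendedFixed k σ Q ⧸ extendedIdeal k σ Q

namespace ExtendedBrauerQuotient

noncomputable instance (k : Type*) {G A : Type*} [Field k] [Group G] [Finite G] [Ring A]
    [Algebra k A] (σ : G →* Aˣ) (Q : Subgroup G) : Ring (ExtendedBrauerQuotient k σ Q) :=
  inferInstanceAs (Ring (extendedFixed k σ Q ⧸ extendedIdeal k σ Q))

noncomputable instance (k : Type*) {G A : Type*} [Field k] [Group G] [Finite G] [Ring A]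
    [Algebra k A] (σ : G →* Aˣ) (Q : Subgroup G) : Algebra k (ExtendedBrauerQuotient k σ Q) :=
  inferInstanceAs (Algebra k (extendedFixed k σ Q ⧸ extendedIdeal k σ Q))

/-- The quotient map from `⨁_φ N_A^φ(Q)` to the extended Brauer quotient. -/
noncomputable def mk (k : Type*) {G A : Type*} [Field k] [Group G] [Finite G] [Ring A]
    [Algebra k A] (σ : G →* Aˣ) (Q : Subgroup G) :
    extendedFixed k σ Q →ₐ[k] ExtendedBrauerQuotient k σ Q :=
  Ideal.Quotient.mkₐ k (extendedIdeal k σ Q)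

/-- The element of `⨁_φ N_A^φ(Q)` given by `g ∈ N_G(Q)`: the image of `g` in `A`, in the degree of
the automorphism `u ↦ gug⁻¹` of `Q`. -/
noncomputable def interiorElt (k : Type*) {G A : Type*} [Field k] [Group G] [Ring A]
    [Algebra k A] (σ : G →* Aˣ) (Q : Subgroup G) :
    Subgroup.normalizer (Q : Set G) →* extendedFixed k σ Q where
  toFun g := ⟨MonoidAlgebra.single (Q.normalizerMonoidHom g) (σ g : A), by
    classical
    intro φ u
    rw [MonoidAlgebra.coeff_single, Finsupp.single_apply]
    split_ifs with h
    · rw [← h, ← Units.val_mul, ← Units.val_mul, ← map_mul, ← map_mul]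
      congr 2
      change (g : G) * u * (g : G)⁻¹ * g = g * u
      group
    · simp⟩
  map_one' := Subtype.ext (by simp [MonoidAlgebra.one_def])
  map_mul' g h := Subtype.ext (by
    simp [MonoidAlgebra.single_mul_single])

/-- The structural homomorphism making the extended Brauer quotient an interior
`N_G(Q)`-algebra. -/
noncomputable def interior (k : Type*) {G A : Type*} [Field k] [Group G] [Finite G] [Ring A]
    [Algebra k A] (σ : G →* Aˣ) (Q : Subgroup G) :
    Subgroup.normalizer (Q : Set G) →* (ExtendedBrauerQuotient k σ Q)ˣ :=
  MonoidHom.toHomUnits ((mk k σ Q).toRingHom.toMonoidHom.comp (interiorElt k σ Q))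

/-- `N_G(Q)` acts on the extended Brauer quotient by conjugation; on `N_A^φ(Q)` this is
`a ↦ gag⁻¹`, with values in `N_A^{c_g φ c_g⁻¹}(Q)`. -/
noncomputable instance (k : Type*) {G A : Type*} [Field k] [Group G] [Finite G] [Ring A]
    [Algebra k A] (σ : G →* Aˣ) (Q : Subgroup G) :
    MulSemiringAction (Subgroup.normalizer (Q : Set G)) (ExtendedBrauerQuotient k σ Q) :=
  MulSemiringAction.compHom _ (ConjAct.toConjAct.toMonoidHom.comp (interior k σ Q))

theorem smul_def (k : Type*) {G A : Type*} [Field k] [Group G] [Finite G] [Ring A]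
    [Algebra k A] (σ : G →* Aˣ) (Q : Subgroup G) (g : Subgroup.normalizer (Q : Set G))
    (x : ExtendedBrauerQuotient k σ Q) :
    g • x = (interior k σ Q g : ExtendedBrauerQuotient k σ Q) * x *
      ((interior k σ Q g)⁻¹ : (ExtendedBrauerQuotient k σ Q)ˣ) := rfl

instance (k : Type*) {G A : Type*} [Field k] [Group G] [Finite G] [Ring A]
    [Algebra k A] (σ : G →* Aˣ) (Q : Subgroup G) :
    SMulCommClass (Subgroup.normalizer (Q : Set G)) k (ExtendedBrauerQuotient k σ Q) where
  smul_comm g r x := by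
    rw [smul_def, smul_def, mul_smul_comm, smul_mul_assoc]

/-- For a `G`-equivariant homomorphism `ι : C → A` to the interior `G`-algebra `A`, the induced
homomorphism `C(Q) → X`, `Br_Q(a) ↦ (the class of ι(a) in degree id)`. -/
noncomputable def ofBrauerQuotient (k : Type*) {G C A : Type*} [Field k] [Group G] [Finite G]
    [Ring C] [Algebra k C] [MulSemiringAction G C] [SMulCommClass G k C] [Ring A] [Algebra k A]
    (σ : G →* Aˣ) (ι : C →ₐ[k] A)
    (hι : ∀ (g : G) (a : C), ι (g • a) = (σ g : A) * ι a * ((σ g)⁻¹ : Aˣ)) (Q : Subgroup G) :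
    BrauerQuotient k C Q →+* ExtendedBrauerQuotient k σ Q :=
  Ideal.Quotient.lift (brauerIdeal k C Q)
    ((mk k σ Q).toRingHom.comp
      { toFun := fun a => ⟨MonoidAlgebra.single 1 (ι a), by
          classical
          intro φ u
          rw [MonoidAlgebra.coeff_single, Finsupp.single_apply]
          split_ifs with h
          · have h1 : ι (u • (a : C)) = ι a := congrArg ι (a.2 u)
            have h2 : (σ u : A) * ι a * ((σ u)⁻¹ : Aˣ) = ι a := (hι u a).symm.trans h1
            rw [← h, MulAut.one_apply]
            exact (Units.mul_inv_eq_iff_eq_mul (σ u)).1 h2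
          · simp⟩
        map_one' := Subtype.ext (by simp [MonoidAlgebra.one_def])
        map_mul' := fun a b => Subtype.ext (by simp [MonoidAlgebra.single_mul_single])
        map_zero' := Subtype.ext (by simp)
        map_add' := fun a b => Subtype.ext (by simp [MonoidAlgebra.single_add]) }) (by
    classical
    intro a ha
    refine Ideal.Quotient.eq_zero_iff_mem.2 ?_
    rw [mem_extendedIdeal]
    intro φ
    change (MonoidAlgebra.single (1 : MulAut Q) (ι (a : C))).coeff φ ∈ _
    rw [MonoidAlgebra.coeff_single, Finsupp.single_apply]
    split_ifs with h
    · subst h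
      refine map_properTraces (Representation.ofDistribMulAction k Q C) _ (MulEquiv.refl Q)
        ι.toLinearMap ?_ ((mem_brauerIdeal k Q a).1 ha)
      intro u m
      change ι ((u : G) • m) = _
      rw [hι, twistedRep_apply]
      simp [mul_assoc]
    · exact Submodule.zero_mem _)

end ExtendedBrauerQuotient

/-! ### Interior algebras with respect to a normal subgroup, and the comparison of categories -/

/-- The `G`-algebra `C` is `N`-interior with structural homomorphism `τ : N → Cˣ`. -/
def IsInteriorStructure {G C : Type*} [Group G] [Ring C] [MulSemiringAction G C]
    (N : Subgroup G) [N.Normal] (τ : N →* Cˣ) : Prop :=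
  (∀ (n : N) (a : C), (n : G) • a = (τ n : C) * a * ((τ n)⁻¹ : Cˣ)) ∧
    ∀ (g : G) (n : N), g • (τ n : C) = (τ (MulAut.conjNormal g n) : C)

/-- The subgroup `Q C_N(Q)` of `H = N_G(Q, f)`. -/
noncomputable abbrev baseNormal {k G C : Type*} [Field k] [Group G] [Finite G]
    [Ring C] [Algebra k C] [MulSemiringAction G C] [SMulCommClass G k C] (N Q : Subgroup G)
    (f : BrauerQuotient k C Q) : Subgroup (pairNormalizer Q f) :=
  (Q ⊔ (N ⊓ Subgroup.centralizer (Q : Set G))).comap (pairNormalizerIncl Q f)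

/-- With `X` the extended Brauer quotient of `A` at `Q` and `H = N_G(Q, f)`: `γ` is a point of `H`
on `X` which covers `f`, where `f` is regarded as an `H`-invariant idempotent of `X` with defect
group `Q` in the normal subgroup `Q C_N(Q)` of `H`. -/
def CoversBlock (k : Type*) {G C A : Type*} [Field k] [Group G] [Finite G]
    [Ring C] [Algebra k C] [MulSemiringAction G C] [SMulCommClass G k C] [Ring A] [Algebra k A]
    (σ : G →* Aˣ) (ι : C →ₐ[k] A)
    (hι : ∀ (g : G) (a : C), ι (g • a) = (σ g : A) * ι a * ((σ g)⁻¹ : Aˣ)) (N Q : Subgroup G)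
    (f : BrauerQuotient k C Q) (γ : Set (ExtendedBrauerQuotient k σ Q)) : Prop :=
  CoversIdempotent k (L := pairNormalizer Q f) (baseNormal N Q f)
    ((Q.comap (pairNormalizerIncl Q f)).subgroupOf (baseNormal N Q f))
    (ExtendedBrauerQuotient.ofBrauerQuotient k σ ι hι Q f) γ

open CategoryTheory in
/-- The category `D(P, f_P)` of `(C(Q), f_Q, H)`-Brauer pairs and the category `C(P, f_P)` of
`(C, c, G)`-Brauer pairs are isomorphic, through mutually inverse functors which, after the
canonical identifications `C(Q)(R) = C(R)`, are the identity on objects and on morphisms. -/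
def IdentityIsIsoOfCategories (p : ℕ) {k G C : Type*} [Field k] [Group G] [Finite G]
    [Ring C] [Algebra k C] [FiniteDimensional k C] [MulSemiringAction G C] [SMulCommClass G k C]
    (c : C) (Q : Subgroup G) (f : BrauerQuotient k C Q) (U P : BPair k (G := G) C)
    (U' P' : BPair k (G := pairNormalizer Q f) (BrauerQuotient k C Q)) : Prop :=
  ∃ (F : FusionInterval p f U' (basePair Q f) P' ⥤ FusionInterval p c U ⟨Q, f⟩ P)
    (E : FusionInterval p c U ⟨Q, f⟩ P ⥤ FusionInterval p f U' (basePair Q f) P'),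
    F ⋙ E = 𝟭 _ ∧ E ⋙ F = 𝟭 _ ∧
    (∀ Y, Corresponds Q f (F.obj Y).obj.pair Y.obj.pair) ∧
    ∀ (Y Z : FusionInterval p f U' (basePair Q f) P') (φ : Y ⟶ Z) (s : Y.obj.pair.subgroup)
      (t : (F.obj Y).obj.pair.subgroup), (t : G) = pairNormalizerIncl Q f s →
      (FusionSystem.toMonoidHom (F.map φ).hom t : G) =
        pairNormalizerIncl Q f (FusionSystem.toMonoidHom φ.hom s)

/-! The two categories differ in the algebra, `C` or `C(Q)`, and in the conjugating group, `G` or `H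
= N_G(Q, f_Q)`. Both differences disappear above `(Q, f_Q)`.

The algebra. In a basis permuted by a `p`-group `T`, the map `Br_T` keeps exactly the coordinates at
the `T`-fixed basis elements (`mem_properTraces_iff`). If `Q ≤ T ≤ N_G(Q)`, keeping the `Q`-fixed
elements first changes nothing, whence `C(T) ≅ C(Q)(T)` (`IsInducedAction.exists_algEquiv`). This
isomorphism matches blocks and, since idempotents lift along `C^T → C(Q)^T`, also inclusions of
pairs (`IsInducedAction.le_iff`). For `Q` normal in `T`, the inclusion `(Q, f) ≤ (T, f_T)` amounts
to `f` being `T`-stable with `Br_T(f) f_T = f_T`; so `f` is determined by `(T, f_T)`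
(`IsInducedAction.stable_of_le`, `IsInducedAction.eq_of_le_of_le`).

The group. Since `c` is a trace from `Q` to `N`, the Mackey formula gives `T ∩ N = Q` for every `(C,
c, G)`-Brauer pair `(T, f_T)` with `Q ≤ T` (`inf_eq_of_notMem_properTraces`). As `N` is normal, `T`
normalizes `Q`, and stability of `f_Q` puts `T` into `H`. If `x` conjugates one pair between `(Q,
f_Q)` and `(P, f_P)` into another, then `x` maps `Q` into `P ∩ N = Q`, and uniqueness of the block
at `Q` gives `x ∈ H`. So both categories have the same conjugating elements.

The point `γ` enters only through its defect group `P`. Rosenberg's lemma shows that `Br_P` does not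
kill `i ∈ γ`; as `i = i f_Q`, it does not kill `f_Q`, and a block `f_P` exists. In the same way the
defect group `Q` of `ε` forces `Q ≤ P`. -/

set_option linter.unusedSectionVars false

/-! ### Equivariant sums, Mackey decomposition and transitivity of relative traces -/

section Traces

variable {k L M : Type*} [Field k] [Group L] [Finite L] [AddCommGroup M] [Module k M]

theorem apply_out_eq (ρ : Representation k L M) (S : Subgroup L) (m : M)
    (hm : ∀ s ∈ S, ρ s m = m) (g : L) : ρ (g : L ⧸ S).out m = ρ g m := by
  obtain ⟨s, hs⟩ := QuotientGroup.mk_out_eq_mul S g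
  rw [hs, map_mul, Module.End.mul_apply, hm s s.2]

theorem relTrace_eq_sum (ρ : Representation k L M) (S : Subgroup L) [Fintype (L ⧸ S)] (m : M) :
    relTrace ρ S m = ∑ q : L ⧸ S, ρ q.out m :=
  finsum_eq_sum_of_fintype _

/-- Group the sum by orbits. By orbit-stabilizer, the part over one orbit is a relative trace from
the stabilizer of a representative. -/
theorem sum_equivariant {X : Type*} [Fintype X] [MulAction L X] (ρ : Representation k L M)
    (F : X → M) (hF : ∀ l x, F (l • x) = ρ l (F x)) :
    ∑ x, F x = ∑ᶠ ω : MulAction.orbitRel.Quotient L X,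
      relTrace ρ (MulAction.stabilizer L ω.out) (F ω.out) := by
  classical
  have : Fintype (MulAction.orbitRel.Quotient L X) := Fintype.ofFinite _
  rw [finsum_eq_sum_of_fintype,
    ← Finset.sum_fiberwise _ (fun x => (Quotient.mk'' x : MulAction.orbitRel.Quotient L X))]
  refine Finset.sum_congr rfl fun ω _ => ?_
  have : Fintype (L ⧸ MulAction.stabilizer L ω.out) := Fintype.ofFinite _
  rw [relTrace_eq_sum]
  symm
  refine Finset.sum_nbij (fun q => MulAction.ofQuotientStabilizer L ω.out q) ?_ ?_ ?_ ?_
  · intro q _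
    induction q using QuotientGroup.induction_on with | H g => ?_
    rw [Finset.mem_filter]
    refine ⟨Finset.mem_univ _, ?_⟩
    conv_rhs => rw [← Quotient.out_eq' ω]
    exact Quotient.sound' ⟨g, rfl⟩
  · exact (MulAction.injective_ofQuotientStabilizer L ω.out).injOn
  · intro x hx
    have hx' : (Quotient.mk'' x : MulAction.orbitRel.Quotient L X) = ω := by simpa using hx
    have : (Quotient.mk'' x : MulAction.orbitRel.Quotient L X) = Quotient.mk'' ω.out := by
      rw [hx', Quotient.out_eq']
    obtain ⟨g, hg⟩ := Quotient.exact' this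
    exact ⟨(g : L ⧸ MulAction.stabilizer L ω.out), by simp, hg⟩
  · intro q _
    induction q using QuotientGroup.induction_on with | H g => ?_
    rw [apply_out_eq]
    · exact (hF g _).symm
    · intro s hs
      rw [← hF, MulAction.mem_stabilizer_iff.1 hs]

theorem relTrace_zero (ρ : Representation k L M) (S : Subgroup L) : relTrace ρ S 0 = 0 := by
  simp [relTrace]

/-- Orbits with more than one element contribute proper traces, and fixed points contribute nothing.
The index set will be a coset space (Mackey formula), a permuted basis, or the orbit of a block. -/
theorem sum_mem_properTraces {X : Type*} [Fintype X] [MulAction L X] (ρ : Representation k L M)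
    (F : X → M) (hF : ∀ l x, F (l • x) = ρ l (F x))
    (h0 : ∀ x, (∀ l : L, l • x = x) → F x = 0) : ∑ x, F x ∈ properTraces ρ := by
  rw [sum_equivariant ρ F hF]
  refine finsum_induction (· ∈ properTraces ρ) (Submodule.zero_mem _)
    (fun _ _ => Submodule.add_mem _) fun ω => ?_
  by_cases hω : MulAction.stabilizer L ω.out = ⊤
  · rw [h0, relTrace_zero]
    · exact Submodule.zero_mem _
    · intro l
      have : l ∈ MulAction.stabilizer L ω.out := hω ▸ Subgroup.mem_top _
      exact this
  · exact Submodule.subset_span ⟨_, hω, _, fun s hs => by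
      rw [← hF, MulAction.mem_stabilizer_iff.1 hs], rfl⟩

theorem apply_out_smul (ρ : Representation k L M) (S : Subgroup L) (m : M)
    (hm : ∀ s ∈ S, ρ s m = m) (g : L) (q : L ⧸ S) : ρ (g • q).out m = ρ g (ρ q.out m) := by
  induction q using QuotientGroup.induction_on with | H a => ?_
  rw [MulAction.Quotient.smul_coe, apply_out_eq ρ S m hm, apply_out_eq ρ S m hm, smul_eq_mul,
    map_mul, Module.End.mul_apply]

theorem apply_relTrace (ρ : Representation k L M) (S : Subgroup L) (m : M)
    (hm : ∀ s ∈ S, ρ s m = m) (g : L) : ρ g (relTrace ρ S m) = relTrace ρ S m := by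
  have : Fintype (L ⧸ S) := Fintype.ofFinite _
  rw [relTrace_eq_sum, map_sum]
  simp_rw [← apply_out_smul ρ S m hm]
  exact Fintype.sum_equiv (MulAction.toPerm g) _ _ fun _ => rfl

/-- The Mackey formula: the restriction of `Tr_S^L(m)` to a group `R` with a homomorphism to `L`
whose image lies in no conjugate of `S` is a sum of relative traces from proper subgroups. -/
theorem relTrace_mem_properTraces {R : Type*} [Group R] [Finite R] (j : R →* L)
    (ρ : Representation k L M) (ρ' : Representation k R M) (hρ : ∀ r m, ρ' r m = ρ (j r) m)
    (S : Subgroup L) (m : M) (hm : ∀ s ∈ S, ρ s m = m)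
    (hS : ∀ x : L, ∃ r, x⁻¹ * j r * x ∉ S) : relTrace ρ S m ∈ properTraces ρ' := by
  have : Fintype (L ⧸ S) := Fintype.ofFinite _
  let _ : MulAction R (L ⧸ S) := MulAction.compHom _ j
  rw [relTrace_eq_sum]
  refine sum_mem_properTraces ρ' (fun q : L ⧸ S => ρ q.out m) ?_ ?_
  · intro r q
    rw [hρ]
    exact apply_out_smul ρ S m hm (j r) q
  · intro q hq
    -- A coset `aS` fixed by all of `R` would give `a⁻¹ j(R) a ≤ S`.
    exfalso
    induction q using QuotientGroup.induction_on with | H a => ?_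
    obtain ⟨r, hr⟩ := hS a
    apply hr
    have h1 : ((j r * a : L) : L ⧸ S) = (a : L ⧸ S) := hq r
    rw [eq_comm, QuotientGroup.eq] at h1
    rwa [mul_assoc]

theorem relTrace_relTrace (ρ : Representation k L M) (P : Subgroup L)
    (ρ' : Representation k P M) (hρ : ∀ (r : P) m, ρ' r m = ρ r m) (S : Subgroup P) (m : M)
    (hm : ∀ s ∈ S, ρ' s m = m) :
    relTrace ρ P (relTrace ρ' S m) = relTrace ρ (S.map P.subtype) m := by
  -- Replace the subgroup `S` of the type `P` by a subgroup `T ≤ P` of `L`, so that cosets of `T` in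
  -- `L` factor as pairs of cosets.
  obtain ⟨T, hT, rfl⟩ : ∃ T ≤ P, T.subgroupOf P = S :=
    ⟨S.map P.subtype, Subgroup.map_subtype_le S, by
      ext x; simp [Subgroup.mem_subgroupOf]⟩
  rw [Subgroup.subgroupOf_map_subtype, inf_eq_left.2 hT]
  have hmT : ∀ t ∈ T, ρ t m = m := fun t ht => by
    have := hm ⟨t, hT ht⟩ ht
    rwa [hρ] at this
  have : Fintype (L ⧸ T) := Fintype.ofFinite _
  have : Fintype (L ⧸ P) := Fintype.ofFinite _
  have : Fintype (P ⧸ T.subgroupOf P) := Fintype.ofFinite _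
  rw [relTrace_eq_sum, relTrace_eq_sum, relTrace_eq_sum]
  simp_rw [map_sum]
  rw [← Fintype.sum_prod_type']
  refine Fintype.sum_equiv (Subgroup.quotientEquivProdOfLE hT).symm _ _ ?_
  rintro ⟨q, r⟩
  have : (Subgroup.quotientEquivProdOfLE hT).symm (q, r) =
      ((q.out * (r.out : L) : L) : L ⧸ T) := by
    conv_lhs => rw [← QuotientGroup.out_eq' r]
    rfl
  rw [this, apply_out_eq ρ T m hmT, map_mul, Module.End.mul_apply, hρ]

variable {ι : Type*}

theorem exists_mulAction_of_basis (ρ : Representation k L M) (b : Module.Basis ι k M)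
    (hb : ∀ l i, ∃ j, ρ l (b i) = b j) :
    ∃ _ : MulAction L ι, ∀ (l : L) i, ρ l (b i) = b (l • i) := by
  choose f hf using hb
  have h1 : ∀ i, f 1 i = i := fun i => b.injective (by rw [← hf]; simp)
  have h2 : ∀ x y i, f (x * y) i = f x (f y i) := fun x y i => b.injective (by
    rw [← hf, ← hf, ← hf, map_mul, Module.End.mul_apply])
  exact ⟨{ smul := f, one_smul := h1, mul_smul := h2 }, hf⟩

theorem repr_smul_of_basis [MulAction L ι] (ρ : Representation k L M)
    (b : Module.Basis ι k M) (hb : ∀ (l : L) i, ρ l (b i) = b (l • i)) (l : L) (m : M) (i : ι) :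
    b.repr (ρ l m) (l • i) = b.repr m i := by
  have : (b.coord (l • i)).comp (ρ l) = b.coord i := by
    classical
    refine b.ext fun j => ?_
    simp [hb, Finsupp.single_apply]
  exact LinearMap.congr_fun this m

/-- For a `p`-group permuting a basis, the sums of relative traces from proper subgroups are the
fixed elements whose coordinates at the fixed basis elements vanish. -/
theorem mem_properTraces_iff (p : ℕ) [Fact p.Prime] [CharP k p] [Finite ι] (hL : IsPGroup p L)
    (ρ : Representation k L M) (b : Module.Basis ι k M) (hb : ∀ l i, ∃ j, ρ l (b i) = b j) (m : M) :
    m ∈ properTraces ρ ↔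
      (∀ l, ρ l m = m) ∧ ∀ i, (∀ l, ρ l (b i) = b i) → b.repr m i = 0 := by
  obtain ⟨_, hb⟩ := exists_mulAction_of_basis ρ b hb
  have : Fintype ι := Fintype.ofFinite _
  constructor
  · intro hm
    induction hm using Submodule.span_induction with
    | zero => simp
    | add x y _ _ hx hy =>
      refine ⟨fun l => by rw [map_add, hx.1, hy.1], fun i hi => ?_⟩
      rw [map_add, Finsupp.add_apply, hx.2 i hi, hy.2 i hi, add_zero]
    | smul c x _ hx =>
      refine ⟨fun l => by rw [map_smul, hx.1], fun i hi => ?_⟩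
      rw [map_smul, Finsupp.smul_apply, hx.2 i hi, smul_zero]
    | mem x hx =>
      obtain ⟨S, hS, m, hm, rfl⟩ := hx
      refine ⟨fun l => apply_relTrace ρ S m hm l, fun i hi => ?_⟩
      have hfix : ∀ l : L, l • i = i := fun l => b.injective (by rw [← hb, hi])
      have : Fintype (L ⧸ S) := Fintype.ofFinite _
      -- All translates of `m` have the same coordinate at a fixed basis element, so the trace
      -- multiplies it by `|L : S|`, a positive power of `p`.
      have h1 : ∀ l : L, b.repr (ρ l m) i = b.repr m i := fun l => by
        conv_lhs => rw [← hfix l]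
        exact repr_smul_of_basis ρ b hb l m i
      rw [relTrace_eq_sum, map_sum, Finsupp.finsetSum_apply]
      simp_rw [h1]
      rw [Finset.sum_const, Finset.card_univ, ← Nat.card_eq_fintype_card]
      obtain ⟨n, hn⟩ := hL.index S
      have hn0 : n ≠ 0 := by
        rintro rfl
        exact hS (Subgroup.index_eq_one.1 (by simpa using hn))
      have : (Nat.card (L ⧸ S) : k) = 0 := by
        change (S.index : k) = 0
        rw [hn, Nat.cast_pow, CharP.cast_eq_zero, zero_pow hn0]
      rw [← Nat.cast_smul_eq_nsmul k, this, zero_smul]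
  · rintro ⟨h1, h2⟩
    -- The expansion of a fixed `m` is an equivariant sum over the basis whose terms at fixed
    -- elements vanish.
    rw [← b.sum_repr m]
    refine sum_mem_properTraces ρ (fun i => b.repr m i • b i) ?_ ?_
    · intro l i
      have := repr_smul_of_basis ρ b hb l m i
      rw [h1] at this
      simp only [this, map_smul, hb]
    · intro i hi
      simp only [h2 i (fun l => by rw [hb, hi]), zero_smul]

theorem mul_mem_properTraces {B : Type*} [Ring B] [Algebra k B] [MulSemiringAction L B]
    [SMulCommClass L k B] {x c : B} (hc : ∀ l : L, l • c = c)
    (hx : x ∈ properTraces (Representation.ofDistribMulAction k L B)) :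
    c * x ∈ properTraces (Representation.ofDistribMulAction k L B) := by
  refine map_properTraces (Representation.ofDistribMulAction k L B) _ (MulEquiv.refl L)
    (LinearMap.mulLeft k c) ?_ hx
  intro l m
  simp [smul_mul', hc]

theorem properTraces_mul_mem {B : Type*} [Ring B] [Algebra k B] [MulSemiringAction L B]
    [SMulCommClass L k B] {x c : B} (hc : ∀ l : L, l • c = c)
    (hx : x ∈ properTraces (Representation.ofDistribMulAction k L B)) :
    x * c ∈ properTraces (Representation.ofDistribMulAction k L B) := by
  refine map_properTraces (Representation.ofDistribMulAction k L B) _ (MulEquiv.refl L)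
    (LinearMap.mulRight k c) ?_ hx
  intro l m
  simp [smul_mul', hc]

end Traces

/-! ### Idempotents of finite-dimensional algebras -/

section Idempotents

variable {k B : Type*} [Field k] [Ring B] [Algebra k B]

/-- Fitting's decomposition by polynomials: write the minimal polynomial as `X^n q` with `q(0) ≠ 0`,
and choose `r` with `1 - X r = q / q(0)`. For `w = r(x)` this gives `x^n (x w) = x^n`, so `(x
w)^(n+1)` is idempotent. As a polynomial in `x` without constant term, it lies in every ideal
containing `x` of a subalgebra containing `x`. -/
theorem exists_fitting_idempotent [FiniteDimensional k B] (x : B) :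
    ∃ (s : Polynomial k) (n : ℕ), (x * Polynomial.aeval x s) * (x * Polynomial.aeval x s) =
      x * Polynomial.aeval x s ∧ 0 < n ∧ x ^ n * (x * Polynomial.aeval x s) = x ^ n := by
  obtain ⟨q, hq, hdvd⟩ := Polynomial.exists_eq_pow_rootMultiplicity_mul_and_not_dvd (minpoly k x)
    (minpoly.ne_zero (Algebra.IsIntegral.isIntegral x)) 0
  set n := (minpoly k x).rootMultiplicity 0
  have hc : q.coeff 0 ≠ 0 := by
    intro h
    apply hdvd
    rw [map_zero, sub_zero]
    exact Polynomial.X_dvd_iff.2 h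
  let r : Polynomial k := Polynomial.C (-(q.coeff 0)⁻¹) * q.divX
  have hr : Polynomial.X ^ n * (1 - Polynomial.X * r) =
      Polynomial.C (q.coeff 0)⁻¹ * minpoly k x := by
    rw [hq]
    obtain ⟨d, c, h1, hd, hc'⟩ : ∃ d c, d * Polynomial.X + Polynomial.C c = q ∧ q.divX = d ∧
        q.coeff 0 = c := ⟨_, _, Polynomial.divX_mul_X_add q, rfl, rfl⟩
    rw [hc'] at hc
    have h2 : Polynomial.C c⁻¹ * Polynomial.C c = 1 := by
      rw [← map_mul, inv_mul_cancel₀ hc, map_one]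
    simp only [r, map_neg, map_zero, sub_zero, hd, hc']
    rw [← h1]
    linear_combination (-(Polynomial.X ^ n)) * h2
  have hw : x ^ n * (x * Polynomial.aeval x r) = x ^ n := by
    have := congrArg (Polynomial.aeval x) hr
    simp only [map_mul, map_pow, map_sub, Polynomial.aeval_X, minpoly.aeval, mul_zero,
      mul_sub, mul_one] at this
    exact (sub_eq_zero.1 this).symm
  have hcomm : Commute x (Polynomial.aeval x r) := by
    have := congrArg (Polynomial.aeval x) (mul_comm Polynomial.X r)
    rw [commute_iff_eq]
    simpa using this
  set w := Polynomial.aeval x r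
  have hm : ∀ m, x ^ n * (x * w) ^ m = x ^ n := by
    intro m
    induction m with
    | zero => simp
    | succ m ih => rw [pow_succ, ← mul_assoc, ih, hw]
  -- The multiplicity `n` may be `0`; the exponent `n + 1` always leaves a factor `x` to split off.
  refine ⟨Polynomial.X ^ n * r ^ (n + 1), n + 1, ?_, Nat.succ_pos n, ?_⟩
  all_goals
    have he : x * Polynomial.aeval x (Polynomial.X ^ n * r ^ (n + 1)) = (x * w) ^ (n + 1) := by
      simp only [map_mul, map_pow, Polynomial.aeval_X]
      rw [hcomm.mul_pow, pow_succ' x, mul_assoc]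
    rw [he]
  · conv_lhs => enter [1]; rw [hcomm.mul_pow, pow_succ x]
    have h1 : w ^ (n + 1) * (x * w) ^ (n + 1) = (x * w) ^ (n + 1) * w ^ (n + 1) :=
      ((hcomm.symm.mul_right (Commute.refl w)).pow_pow _ _)
    have h2 : x * (x * w) ^ (n + 1) = (x * w) ^ (n + 1) * x :=
      (((Commute.refl x).mul_right hcomm).pow_right _)
    rw [mul_assoc, h1, ← mul_assoc, mul_assoc (x ^ n), h2, ← mul_assoc, hm, ← pow_succ,
      hcomm.mul_pow]
  · rw [pow_succ' x, mul_assoc, hm]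

/-- Take the Fitting idempotent `e = x s(x)`. As `Φ x` is idempotent, `x^n e = x^n` with `n > 0`
gives `Φ x · Φ e = Φ x`, while `Φ x · Φ e = Φ e` because `e` is a multiple of `x`. -/
theorem exists_lift_idempotent [FiniteDimensional k B] {D : Type*} [Ring D] [Algebra k D]
    (Φ : B →ₐ[k] D) (x : B) (hx : Φ x * Φ x = Φ x) : ∃ e : B, e * e = e ∧ Φ e = Φ x := by
  obtain ⟨s, n, he, hn, hxn⟩ := exists_fitting_idempotent (k := k) x
  refine ⟨_, he, ?_⟩
  have h1 := congrArg Φ hxn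
  rw [map_mul, map_pow, IsIdempotentElem.pow_eq hx hn.ne', map_mul, ← mul_assoc, hx] at h1
  rw [map_mul, h1]

/-- This is the locality of `iSi`: the Fitting idempotent of `x` lies below `i`, so it is `0` or
`i`. -/
theorem IsPrimitiveIdempotentIn.nilpotent_or [FiniteDimensional k B] {S : Subalgebra k B} {i x : B}
    (hi : IsPrimitiveIdempotentIn S i) (hx : x ∈ S) (h1 : i * x = x) (h2 : x * i = x) :
    IsNilpotent x ∨ ∃ w ∈ S, x * w = i := by
  obtain ⟨s, n, he, hn, hxn⟩ := exists_fitting_idempotent (k := k) x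
  have hw : Polynomial.aeval x s ∈ S := 
    Algebra.adjoin_le (by simpa using hx) (Polynomial.aeval_mem_adjoin_singleton k x)
  have hcomm : x * Polynomial.aeval x s = Polynomial.aeval x s * x := by
    have := congrArg (Polynomial.aeval x) (mul_comm Polynomial.X s)
    simpa using this
  set e := x * Polynomial.aeval x s
  have hie : i * e = e := by rw [← mul_assoc, h1]
  have hei : e * i = e := by rw [hcomm, mul_assoc, h2]
  have heS : e ∈ S := mul_mem hx hw
  rcases hi.2.2.2 e heS (i - e) (sub_mem hi.1 heS) he
    (by rw [mul_sub, sub_mul, sub_mul, hi.2.1, hie, hei, he]; abel)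
    (by rw [mul_sub, hei, he, sub_self]) (by rw [sub_mul, hie, he, sub_self])
    (by abel) with h | h
  · left
    exact ⟨n, by rw [← hxn, h, mul_zero]⟩
  · right
    exact ⟨_, hw, (sub_eq_zero.1 h).symm⟩

/-- Rosenberg's lemma for two ideals. -/
theorem IsPrimitiveIdempotentIn.mem_or_mem [FiniteDimensional k B] {S : Subalgebra k B} {i : B}
    (hi : IsPrimitiveIdempotentIn S i) {J₁ J₂ : Submodule k B}
    (hJ₁ : ∀ x ∈ J₁, x ∈ S ∧ ∀ s ∈ S, s * x ∈ J₁ ∧ x * s ∈ J₁)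
    (hJ₂ : ∀ x ∈ J₂, x ∈ S ∧ ∀ s ∈ S, s * x ∈ J₂ ∧ x * s ∈ J₂) (h : i ∈ J₁ ⊔ J₂) :
    i ∈ J₁ ∨ i ∈ J₂ := by
  obtain ⟨x, hx, y, hy, hxy⟩ := Submodule.mem_sup.1 h
  have hx' : i * x * i ∈ J₁ := ((hJ₁ _ ((hJ₁ _ hx).2 i hi.1).1).2 i hi.1).2
  have hy' : i * y * i ∈ J₂ := ((hJ₂ _ ((hJ₂ _ hy).2 i hi.1).1).2 i hi.1).2
  have hsum : i * x * i + i * y * i = i := by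
    rw [← add_mul, ← mul_add, hxy, hi.2.1, hi.2.1]
  have h1 : i * (i * x * i) = i * x * i := by simp only [← mul_assoc, hi.2.1]
  have h2 : i * x * i * i = i * x * i := by rw [mul_assoc, hi.2.1]
  have h1' : i * (i * y * i) = i * y * i := by simp only [← mul_assoc, hi.2.1]
  generalize i * x * i = x at *
  generalize i * y * i = y at *
  rcases hi.nilpotent_or (hJ₁ x hx').1 h1 h2 with ⟨n, hn⟩ | ⟨w, hw, h⟩
  · right
    -- Geometric series with `i - x = y`: once a power of the nilpotent `x` vanishes, `i` itself is
    -- a multiple of `y`.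
    have key : ∀ m : ℕ, ∃ w ∈ S, i - x ^ (m + 1) = y * w := by
      intro m
      induction m with
      | zero => exact ⟨1, one_mem S, by rw [← hsum]; simp⟩
      | succ m ih =>
        obtain ⟨w, hw, h⟩ := ih
        refine ⟨w * x + i, add_mem (mul_mem hw (hJ₁ x hx').1) hi.1, ?_⟩
        rw [mul_add, ← mul_assoc, ← h, sub_mul, ← pow_succ, h1]
        have : y * i = y := by
          have := congrArg (· * i) hsum
          simp only [add_mul, h2, hi.2.1] at this
          exact add_left_cancel (this.trans hsum.symm)
        rw [this, ← hsum]
        abel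
    obtain ⟨w, hw, h⟩ := key n
    rw [pow_succ, hn, zero_mul, sub_zero] at h
    rw [h]
    exact ((hJ₂ y hy').2 w hw).2
  · left
    rw [← h]
    exact ((hJ₁ x hx').2 w hw).2

/-- Rosenberg's lemma. -/
theorem IsPrimitiveIdempotentIn.exists_mem [FiniteDimensional k B] {S : Subalgebra k B} {i : B}
    (hi : IsPrimitiveIdempotentIn S i) {α : Type*} (s : Finset α) (J : α → Submodule k B)
    (hJ : ∀ a, ∀ x ∈ J a, x ∈ S ∧ ∀ s ∈ S, s * x ∈ J a ∧ x * s ∈ J a) (h : i ∈ s.sup J) :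
    ∃ a ∈ s, i ∈ J a := by
  classical
  -- Finite sums of ideals are ideals, which lets the case of two ideals drive the induction.
  have hsup : ∀ s : Finset α, ∀ x ∈ s.sup J, x ∈ S ∧ ∀ t ∈ S, t * x ∈ s.sup J ∧ x * t ∈ s.sup J := by
    intro s
    induction s using Finset.induction_on with
    | empty =>
      intro x hx
      rw [Finset.sup_empty, Submodule.mem_bot] at hx
      subst hx
      exact ⟨zero_mem S, fun t _ => by simp⟩
    | insert a s _ ih =>
      intro x hx
      rw [Finset.sup_insert] at hx ⊢
      obtain ⟨y, hy, z, hz, rfl⟩ := Submodule.mem_sup.1 hx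
      refine ⟨add_mem (hJ a y hy).1 (ih z hz).1, fun t ht => ?_⟩
      rw [mul_add, add_mul]
      exact ⟨Submodule.add_mem_sup ((hJ a y hy).2 t ht).1 ((ih z hz).2 t ht).1,
        Submodule.add_mem_sup ((hJ a y hy).2 t ht).2 ((ih z hz).2 t ht).2⟩
  induction s using Finset.induction_on with
  | empty => exact absurd (by simpa using h) hi.2.2.1
  | insert a s _ ih =>
    rw [Finset.sup_insert] at h
    rcases hi.mem_or_mem (hJ a) (hsup s) h with h | h
    · exact ⟨a, Finset.mem_insert_self a s, h⟩
    · obtain ⟨b, hb, h⟩ := ih h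
      exact ⟨b, Finset.mem_insert_of_mem hb, h⟩

/-- The decomposition `i = iz + (i - iz)` is orthogonal. -/
theorem IsPrimitiveIdempotentIn.mul_eq_zero_or {S : Subalgebra k B} {i z : B}
    (hi : IsPrimitiveIdempotentIn S i) (hz : z ∈ S) (hzz : z * z = z) (hiz : i * z = z * i) :
    i * z = 0 ∨ i * z = i := by
  have h1 : i * z * (i * z) = i * z := by
    conv_lhs => rw [mul_assoc, ← mul_assoc z, ← hiz, mul_assoc i z z, hzz, ← mul_assoc, hi.2.1]
  have h2 : i * (i * z) = i * z := by rw [← mul_assoc, hi.2.1]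
  have h3 : i * z * i = i * z := by rw [mul_assoc, ← hiz, h2]
  rcases hi.2.2.2 (i * z) (mul_mem hi.1 hz) (i - i * z) (sub_mem hi.1 (mul_mem hi.1 hz)) h1
    (by rw [mul_sub, sub_mul, sub_mul, hi.2.1, h2, h3, h1]; abel)
    (by rw [mul_sub, h3, h1, sub_self]) (by rw [sub_mul, h2, h1, sub_self]) (by abel) with h | h
  · exact Or.inl h
  · exact Or.inr (sub_eq_zero.1 h).symm

theorem IsBlock.comm {e : B} (he : IsBlock k e) (x : B) : e * x = x * e :=
  ((Subalgebra.mem_center_iff.1 he.1) x).symm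

theorem IsBlock.mul_eq_self {e z : B} (he : IsBlock k e) (hz : ∀ x, z * x = x * z)
    (hzz : z * z = z) (h : z * e ≠ 0) : z * e = e := by
  rw [hz e] at h ⊢
  exact (IsPrimitiveIdempotentIn.mul_eq_zero_or he
    (Subalgebra.mem_center_iff.2 fun x => (hz x).symm) hzz (hz e).symm).resolve_left h

theorem IsBlock.eq_of_mul_ne_zero {e e' : B} (he : IsBlock k e) (he' : IsBlock k e')
    (h : e * e' ≠ 0) : e = e' := by
  have h1 := he'.mul_eq_self he.comm he.2.1 h
  rw [he.comm] at h
  have h2 := he.mul_eq_self he'.comm he'.2.1 h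
  rw [← h2, ← he.comm, h1]

/-- Apply `exists_primitive_of_ne_zero` to `1` in the centre, with multiplication by `z` as the
additive map. -/
theorem exists_block_mul_ne_zero [FiniteDimensional k B] {z : B} (hz : z ≠ 0) :
    ∃ e : B, IsBlock k e ∧ z * e ≠ 0 := by
  obtain ⟨j, hj, _, _, h⟩ := exists_primitive_of_ne_zero (Subalgebra.center k B)
    ((AddMonoidHom.mulLeft z).comp (Subalgebra.center k B).subtype.toAddMonoidHom) _ 1 le_rfl
    (one_mul 1) (by simpa using hz)
  exact ⟨j, hj, h⟩

theorem IsBlock.map {D : Type*} [Ring D] [Algebra k D] (Φ : B ≃ₐ[k] D) {e : B}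
    (he : IsBlock k e) : IsBlock k (Φ e) := by
  have hc : ∀ {x : D}, x ∈ Subalgebra.center k D → Φ.symm x ∈ Subalgebra.center k B := by
    intro x hx
    rw [Subalgebra.mem_center_iff] at hx ⊢
    intro y
    apply Φ.injective
    simpa using hx (Φ y)
  refine ⟨Subalgebra.mem_center_iff.2 fun x => ?_, by rw [← map_mul, he.2.1], ?_, ?_⟩
  · have := congrArg Φ (he.comm (Φ.symm x))
    simpa using this.symm
  · simpa using he.2.2.1
  · intro f hf g hg h1 h2 h3 h4 h5
    have := he.2.2.2 (Φ.symm f) (hc hf) (Φ.symm g) (hc hg) (by rw [← map_mul, h1])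
      (by rw [← map_mul, h2]) (by rw [← map_mul, h3, map_zero]) (by rw [← map_mul, h4, map_zero])
      (by rw [← map_add, h5, AlgEquiv.symm_apply_apply])
    simpa using this

/-! ### Defect groups of primitive idempotents -/

variable {L : Type*} [Group L] [Finite L] [MulSemiringAction L B] [SMulCommClass L k B]

theorem mem_fixed_iff {S : Subgroup L} {x : B} :
    x ∈ FixedPoints.subalgebra k B S ↔ ∀ s ∈ S, s • x = x :=
  ⟨fun h s hs => h ⟨s, hs⟩, fun h s => h s s.2⟩

/-- The relative trace as a linear map. -/
noncomputable def relTraceLinear (k : Type*) {L B : Type*} [Field k] [Group L] [Finite L] [Ring B]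
    [Algebra k B] [MulSemiringAction L B] [SMulCommClass L k B] (S : Subgroup L) : B →ₗ[k] B where
  toFun x := relTrace (Representation.ofDistribMulAction k L B) S x
  map_add' x y := by
    have : Fintype (L ⧸ S) := Fintype.ofFinite _
    simp only [relTrace_eq_sum, map_add, Finset.sum_add_distrib]
  map_smul' r x := by
    have : Fintype (L ⧸ S) := Fintype.ofFinite _
    simp only [relTrace_eq_sum, map_smul, Finset.smul_sum, RingHom.id_apply]

/-- The ideal `B_S^L` of `B^L`, as a subspace of `B`. -/
noncomputable def traceSubmodule (k : Type*) {L : Type*} (B : Type*) [Field k] [Group L] [Finite L]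
    [Ring B] [Algebra k B] [MulSemiringAction L B] [SMulCommClass L k B] (S : Subgroup L) :
    Submodule k B :=
  (Subalgebra.toSubmodule (FixedPoints.subalgebra k B S)).map (relTraceLinear k S)

theorem mem_traceSubmodule {S : Subgroup L} {x : B} :
    x ∈ traceSubmodule k B S ↔ x ∈ traceImage k L B S := by
  constructor
  · rintro ⟨a, ha, rfl⟩
    exact ⟨a, (mem_fixed_iff (k := k)).1 ha, rfl⟩
  · rintro ⟨a, ha, rfl⟩
    exact ⟨a, (mem_fixed_iff (k := k)).2 ha, rfl⟩

theorem relTrace_mul (S : Subgroup L) (x : B) {z : B} (hz : ∀ l : L, l • z = z) :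
    relTrace (Representation.ofDistribMulAction k L B) S x * z =
      relTrace (Representation.ofDistribMulAction k L B) S (x * z) := by
  have : Fintype (L ⧸ S) := Fintype.ofFinite _
  simp [relTrace_eq_sum, Finset.sum_mul, smul_mul', hz]

theorem mul_relTrace (S : Subgroup L) (x : B) {z : B} (hz : ∀ l : L, l • z = z) :
    z * relTrace (Representation.ofDistribMulAction k L B) S x =
      relTrace (Representation.ofDistribMulAction k L B) S (z * x) := by
  have : Fintype (L ⧸ S) := Fintype.ofFinite _
  simp [relTrace_eq_sum, Finset.mul_sum, smul_mul', hz]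

theorem traceSubmodule_isIdeal (S : Subgroup L) {x : B} (hx : x ∈ traceSubmodule k B S) :
    x ∈ FixedPoints.subalgebra k B L ∧ ∀ s ∈ FixedPoints.subalgebra k B L,
      s * x ∈ traceSubmodule k B S ∧ x * s ∈ traceSubmodule k B S := by
  obtain ⟨a, ha, rfl⟩ := mem_traceSubmodule.1 hx
  refine ⟨fun l => apply_relTrace (Representation.ofDistribMulAction k L B) S a
    ha l,
    fun s hs => ⟨mem_traceSubmodule.2 ⟨s * a, fun t ht => ?_, mul_relTrace (k := k) S a hs⟩,
      mem_traceSubmodule.2 ⟨a * s, fun t ht => ?_, relTrace_mul (k := k) S a hs⟩⟩⟩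
  · rw [smul_mul', ha t ht, hs t]
  · rw [smul_mul', ha t ht, hs t]

/-- Write `j = Tr_D^L(x)`, so `j = Tr_D^L(x j)`. If `Br_D` killed `j`, then `x j` would be a sum of
traces from proper subgroups of `D`, and transitivity would put `j` into the sum of the ideals
`B_S^L` with `S < D`. By Rosenberg's lemma one of them would contain `j`, against the minimality of
`D`. -/
theorem IsDefectGroup.notMem_properTraces [FiniteDimensional k B] {D : Subgroup L} {j : B}
    (hD : IsDefectGroup k D j) (hj : IsPrimitiveIdempotentIn (FixedPoints.subalgebra k B L) j) :
    j ∉ properTraces (Representation.ofDistribMulAction k D B) := by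
  classical
  intro hmem
  obtain ⟨⟨x, hx, hjx⟩, hmin⟩ := hD
  have hxj : x * j ∈ properTraces (Representation.ofDistribMulAction k D B) :=
    mul_mem_properTraces (fun l => hx l l.2) hmem
  have : Fintype {S : Subgroup L // S < D} := Fintype.ofFinite _
  have hle : properTraces (Representation.ofDistribMulAction k D B) ≤
      ((Finset.univ : Finset {S : Subgroup L // S < D}).sup
        fun S => traceSubmodule k B S.1).comap (relTraceLinear k D) := by
    refine Submodule.span_le.2 ?_
    rintro _ ⟨S, hS, m, hm, rfl⟩
    have hlt : S.map D.subtype < D := by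
      refine lt_of_le_of_ne (Subgroup.map_subtype_le S) fun h => hS ?_
      rw [eq_top_iff]
      intro d _
      have hd : (d : L) ∈ S.map D.subtype := h.symm ▸ d.2
      obtain ⟨d', hd', h'⟩ := hd
      exact (Subtype.ext h' : d' = d) ▸ hd'
    have hle := Finset.le_sup (f := fun S : {S : Subgroup L // S < D} => traceSubmodule k B S.1)
      (Finset.mem_univ ⟨S.map D.subtype, hlt⟩)
    refine hle (mem_traceSubmodule.2 ⟨m, ?_, ?_⟩)
    · rintro _ ⟨s, hs, rfl⟩
      exact hm s hs
    · exact relTrace_relTrace (Representation.ofDistribMulAction k L B) D _ (fun _ _ => rfl) S m hm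
  have hjs : j ∈ (Finset.univ : Finset {S : Subgroup L // S < D}).sup
      fun S => traceSubmodule k B S.1 := by
    have h := hle hxj
    have h2 : relTraceLinear k D (x * j) = j := by
      change relTrace (Representation.ofDistribMulAction k L B) D (x * j) = j
      rw [← relTrace_mul D x hj.1, ← hjx, hj.2.1]
    rwa [Submodule.mem_comap, h2] at h
  obtain ⟨S, _, hS⟩ := hj.exists_mem _ _ (fun S x hx => traceSubmodule_isIdeal S.1 hx) hjs
  exact hmin S.1 S.2 (mem_traceSubmodule.1 hS)

/-- For a Sylow `p`-subgroup `S` of `D` the index `|D : S|` is invertible in `k`, so a `D`-fixed `x`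
is the trace of `|D : S|⁻¹ x` from `S`. Minimality of `D` then forces `S = D`. -/
theorem IsDefectGroup.isPGroup (p : ℕ) [Fact p.Prime] [CharP k p] {D : Subgroup L} {j : B}
    (hD : IsDefectGroup k D j) : IsPGroup p D := by
  obtain ⟨⟨x, hx, hjx⟩, hmin⟩ := hD
  obtain ⟨S⟩ : Nonempty (Sylow p D) := inferInstance
  have hS : (S : Subgroup D) = ⊤ := by
    by_contra hne
    have hlt : (S : Subgroup D).map D.subtype < D := by
      refine lt_of_le_of_ne (Subgroup.map_subtype_le _) fun h => hne ?_
      rw [eq_top_iff]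
      intro d _
      have hd : (d : L) ∈ (S : Subgroup D).map D.subtype := h.symm ▸ d.2
      obtain ⟨d', hd', h'⟩ := hd
      exact (Subtype.ext h' : d' = d) ▸ hd'
    have hidx : ((S : Subgroup D).index : k) ≠ 0 := by
      rw [Ne, CharP.cast_eq_zero_iff k p]
      exact S.not_dvd_index
    refine hmin _ hlt ⟨((S : Subgroup D).index : k)⁻¹ • x, ?_, ?_⟩
    · rintro _ ⟨s, _, rfl⟩
      rw [smul_comm]
      congr 1
      exact hx s s.2
    · rw [← relTrace_relTrace (Representation.ofDistribMulAction k L B) D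
        (Representation.ofDistribMulAction k D B) (fun _ _ => rfl)]
      · rw [hjx]
        congr 1
        have : Fintype (D ⧸ (S : Subgroup D)) := Fintype.ofFinite _
        rw [relTrace_eq_sum]
        have h1 : ∀ d : D, Representation.ofDistribMulAction k D B d
            (((S : Subgroup D).index : k)⁻¹ • x) = ((S : Subgroup D).index : k)⁻¹ • x := fun d => by
          rw [map_smul]
          congr 1
          exact hx d d.2
        simp_rw [h1]
        rw [Finset.sum_const, Finset.card_univ, ← Nat.card_eq_fintype_card,
          ← Nat.cast_smul_eq_nsmul k, ← Subgroup.index, smul_smul, mul_inv_cancel₀ hidx, one_smul]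
      · intro s _
        rw [map_smul]
        congr 1
        exact hx s s.2
  have h := S.isPGroup'
  rw [hS] at h
  exact h.of_equiv Subgroup.topEquiv

end Idempotents

/-! ### Brauer quotients of `p`-permutation algebras -/

section PPermutation

variable {k G C : Type*} [Field k] [Group G] [Finite G] [Ring C] [Algebra k C]
  [MulSemiringAction G C] [SMulCommClass G k C]

theorem br_eq_zero_iff {R : Subgroup G} {x : FixedPoints.subalgebra k C R} :
    BrauerQuotient.br k R x = 0 ↔
      (x : C) ∈ properTraces (Representation.ofDistribMulAction k R C) :=
  Ideal.Quotient.eq_zero_iff_mem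

theorem fixed_mono {R U : Subgroup G} (h : R ≤ U) {a : C}
    (ha : a ∈ FixedPoints.subalgebra k C U) : a ∈ FixedPoints.subalgebra k C R :=
  fun r => ha ⟨r, h r.2⟩

/-- `BPair.Le` tests primitive idempotents only; this makes it usable for arbitrary idempotents. -/
theorem exists_primitive_br_mul_ne_zero [FiniteDimensional k C] {T : Subgroup G}
    (f : BrauerQuotient k C T) (i : FixedPoints.subalgebra k C T) (hi : i * i = i)
    (h : BrauerQuotient.br k T i * f ≠ 0) :
    ∃ j : FixedPoints.subalgebra k C T,
      IsPrimitiveIdempotentIn (FixedPoints.subalgebra k C T) (j : C) ∧ i * j = j ∧ j * i = j ∧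
        BrauerQuotient.br k T j * f ≠ 0 :=
  exists_primitive_of_ne_zero _ ((AddMonoidHom.mulRight f).comp
    (BrauerQuotient.br k (B := C) T).toRingHom.toAddMonoidHom) _ i le_rfl hi h

variable (p : ℕ) [Fact p.Prime] [CharP k p]

/-- In a `p`-permutation algebra, an element which is not killed by `Br_U` is not killed by `Br_R`
for `R ≤ U`. -/
theorem IsPPermutationAlgebra.notMem_properTraces_of_le (hperm : IsPPermutationAlgebra p k G C)
    [FiniteDimensional k C] {R U : Subgroup G} (hU : IsPGroup p U) (hRU : R ≤ U) {a : C}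
    (ha : a ∈ FixedPoints.subalgebra k C U)
    (h : a ∉ properTraces (Representation.ofDistribMulAction k U C)) :
    a ∉ properTraces (Representation.ofDistribMulAction k R C) := by
  obtain ⟨b, hb⟩ := hperm U hU
  intro hR
  apply h
  rw [mem_properTraces_iff p hU _ b fun u i => hb u u.2 i]
  rw [mem_properTraces_iff p (hU.to_le hRU) _ b fun u i => hb u (hRU u.2) i] at hR
  -- One `U`-stable basis serves both groups, and its `U`-fixed elements are `R`-fixed.
  exact ⟨ha, fun i hi => hR.2 i fun r => hi ⟨r, hRU r.2⟩⟩

/-- The classes of the `Q`-fixed elements of a `Q`-stable basis form a basis of `C(Q)`. -/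
theorem exists_basis_brauerQuotient {ι : Type*} [Finite ι] {Q : Subgroup G} (hQ : IsPGroup p Q)
    (b : Module.Basis ι k C) (hb : ∀ q ∈ Q, ∀ i, ∃ j, q • b i = b j) :
    ∃ β : Module.Basis {i // b i ∈ FixedPoints.subalgebra k C Q} k (BrauerQuotient k C Q),
      (∀ j, β j = BrauerQuotient.br k Q ⟨b j.1, j.2⟩) ∧
      ∀ a j, β.repr (BrauerQuotient.br k Q a) j = b.repr a j.1 := by
  classical
  have : Fintype ι := Fintype.ofFinite _
  have hsum : ∀ (g : {i // b i ∈ FixedPoints.subalgebra k C Q} → k) j,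
      b.repr ((∑ j, g j • (⟨b j.1, j.2⟩ : FixedPoints.subalgebra k C Q) :
        FixedPoints.subalgebra k C Q) : C) j.1 = g j := by
    intro g j
    rw [AddSubmonoidClass.coe_finsetSum, map_sum, Finsupp.finsetSum_apply,
      Finset.sum_eq_single j]
    · simp
    · intro i _ hi
      have : i.1 ≠ j.1 := fun h => hi (Subtype.ext h)
      simp [this]
    · simp
  -- The kernel of `Br_Q` is read off from the coordinates at `Q`-fixed basis elements; spanning and
  -- independence both follow.
  have hzero : ∀ a : FixedPoints.subalgebra k C Q, BrauerQuotient.br k Q a = 0 ↔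
      ∀ j : {i // b i ∈ FixedPoints.subalgebra k C Q}, b.repr a j.1 = 0 := by
    intro a
    rw [br_eq_zero_iff, mem_properTraces_iff p hQ _ b fun q i => hb q q.2 i]
    exact ⟨fun h j => h.2 j.1 j.2, fun h => ⟨a.2, fun i hi => h ⟨i, hi⟩⟩⟩
  have hexp : ∀ a : FixedPoints.subalgebra k C Q, BrauerQuotient.br k Q a =
      ∑ j : {i // b i ∈ FixedPoints.subalgebra k C Q},
        b.repr a j.1 • BrauerQuotient.br k Q ⟨b j.1, j.2⟩ := by
    intro a
    simp_rw [← map_smul]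
    rw [← map_sum, ← sub_eq_zero, ← map_sub, hzero]
    intro j
    rw [AddSubgroupClass.coe_sub, map_sub, Finsupp.sub_apply,
      hsum fun j => b.repr (a : C) j.1, sub_self]
  have hli : LinearIndependent k fun j : {i // b i ∈ FixedPoints.subalgebra k C Q} =>
      BrauerQuotient.br k Q ⟨b j.1, j.2⟩ := by
    rw [Fintype.linearIndependent_iff]
    intro g hg j
    simp_rw [← map_smul] at hg
    rw [← map_sum, hzero] at hg
    rw [← hsum g j, hg j]
  let β := Module.Basis.mk hli (by
    intro y _
    obtain ⟨a, rfl⟩ := BrauerQuotient.br_surjective k Q y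
    rw [hexp a]
    exact Submodule.sum_mem _ fun j _ => Submodule.smul_mem _ _ (Submodule.subset_span ⟨j, rfl⟩))
  have hβ : ∀ j, β j = BrauerQuotient.br k Q ⟨b j.1, j.2⟩ := fun j => Module.Basis.mk_apply _ _ j
  refine ⟨β, hβ, fun a j => ?_⟩
  rw [hexp a]
  simp_rw [← hβ]
  rw [β.repr_sum_self]

/-! ### The canonical isomorphism between `C(T)` and `C(Q)(T)` -/

variable {K : Type*} [Group K] [Finite K] {Q : Subgroup G} (θ : K →* G)
  [MulSemiringAction K (BrauerQuotient k C Q)] [SMulCommClass K k (BrauerQuotient k C Q)]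

/-- The action of `K` on `C(Q)` is induced by the action of `G` on `C` along the embedding `θ`. -/
def IsInducedAction (k C : Type*) [Field k] [Ring C] [Algebra k C]
    [MulSemiringAction G C] [SMulCommClass G k C] (Q : Subgroup G) (θ : K →* G)
    [MulSemiringAction K (BrauerQuotient k C Q)] : Prop :=
  Function.Injective θ ∧ ∀ (x : K) (a : C) (ha : a ∈ FixedPoints.subalgebra k C Q),
    ∃ h : θ x • a ∈ FixedPoints.subalgebra k C Q,
      x • BrauerQuotient.br k Q ⟨a, ha⟩ = BrauerQuotient.br k Q ⟨θ x • a, h⟩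

variable {θ}

theorem IsInducedAction.br_mem (hθ : IsInducedAction k C Q θ) {T : Subgroup K} {a : C}
    (haT : a ∈ FixedPoints.subalgebra k C (T.map θ)) (haQ : a ∈ FixedPoints.subalgebra k C Q) :
    BrauerQuotient.br k Q ⟨a, haQ⟩ ∈ FixedPoints.subalgebra k (BrauerQuotient k C Q) T := by
  rintro ⟨t, ht⟩
  obtain ⟨h, h'⟩ := hθ.2 t a haQ
  refine h'.trans ?_
  congr 1
  exact Subtype.ext (haT ⟨θ t, t, ht, rfl⟩)

/-- A `θ(T)`-stable basis of `C` is also `Q`-stable, and its `Q`-fixed elements give a basis of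
`C(Q)` permuted by `T` in the same way. Fixed elements and coordinates can therefore be compared on
both sides. -/
theorem IsInducedAction.exists_stable_basis (hθ : IsInducedAction k C Q θ)
    [FiniteDimensional k C] (hperm : IsPPermutationAlgebra p k G C) {T : Subgroup K}
    (hT : IsPGroup p T) (hQT : Q ≤ T.map θ) :
    ∃ (b : Module.Basis (Fin (Module.finrank k C)) k C)
      (β : Module.Basis {i // b i ∈ FixedPoints.subalgebra k C Q} k (BrauerQuotient k C Q)),
      (∀ r ∈ T.map θ, ∀ i, ∃ j, r • b i = b j) ∧
      (∀ (t : T) j, ∃ j', θ t • b j.1 = b j'.1 ∧ t • β j = β j') ∧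
      ∀ a j, β.repr (BrauerQuotient.br k Q a) j = b.repr a j.1 := by
  obtain ⟨b, hb⟩ := hperm (T.map θ) (hT.map θ)
  obtain ⟨β, hβ, hrepr⟩ := exists_basis_brauerQuotient p ((hT.map θ).to_le hQT) b
    fun q hq => hb q (hQT hq)
  refine ⟨b, β, hb, fun t j => ?_, hrepr⟩
  obtain ⟨j', hj'⟩ := hb (θ t) ⟨t, t.2, rfl⟩ j.1
  obtain ⟨h, h'⟩ := hθ.2 t (b j.1) j.2
  refine ⟨⟨j', hj' ▸ h⟩, hj', ?_⟩
  rw [hβ, hβ]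
  refine h'.trans ?_
  congr 1
  exact Subtype.ext hj'

/-- Each side says that the coordinates at the `θ(T)`-fixed basis elements vanish; these elements
are automatically `Q`-fixed because `Q ≤ θ(T)`. -/
theorem IsInducedAction.br_eq_zero_iff (hθ : IsInducedAction k C Q θ)
    [FiniteDimensional k C] (hperm : IsPPermutationAlgebra p k G C) {T : Subgroup K}
    (hT : IsPGroup p T) (hQT : Q ≤ T.map θ) {a : C}
    (haT : a ∈ FixedPoints.subalgebra k C (T.map θ)) (haQ : a ∈ FixedPoints.subalgebra k C Q)
    (hbr : BrauerQuotient.br k Q ⟨a, haQ⟩ ∈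
      FixedPoints.subalgebra k (BrauerQuotient k C Q) T) :
    BrauerQuotient.br k T ⟨BrauerQuotient.br k Q ⟨a, haQ⟩, hbr⟩ = 0 ↔
      BrauerQuotient.br k (T.map θ) ⟨a, haT⟩ = 0 := by
  obtain ⟨b, β, hb, hβ, hrepr⟩ := hθ.exists_stable_basis p hperm hT hQT
  rw [_root_.br_eq_zero_iff, _root_.br_eq_zero_iff,
    mem_properTraces_iff p hT _ β fun t j => let ⟨j', hj'⟩ := hβ t j; ⟨j', hj'.2⟩,
    mem_properTraces_iff p (hT.map θ) _ b fun t j => hb t t.2 j,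
    and_iff_right (show ∀ t, Representation.ofDistribMulAction k T (BrauerQuotient k C Q) t
      (BrauerQuotient.br k Q ⟨a, haQ⟩) = BrauerQuotient.br k Q ⟨a, haQ⟩ from hbr),
    and_iff_right (show ∀ t, Representation.ofDistribMulAction k (T.map θ) C t a = a from haT)]
  simp only [hrepr]
  constructor
  · intro h i hi
    have hiQ : b i ∈ FixedPoints.subalgebra k C Q := fun q => hi ⟨q, hQT q.2⟩
    refine h ⟨i, hiQ⟩ fun t => ?_
    obtain ⟨j', h1, h2⟩ := hβ t ⟨i, hiQ⟩
    refine h2.trans ?_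
    congr 1
    exact Subtype.ext (b.injective (h1.symm.trans (hi ⟨θ t, t, t.2, rfl⟩)))
  · intro h j hj
    refine h j.1 ?_
    rintro ⟨_, t, ht, rfl⟩
    obtain ⟨j', h1, h2⟩ := hβ ⟨t, ht⟩ j
    have : j' = j := β.injective (h2.symm.trans (hj ⟨t, ht⟩))
    subst this
    exact h1

/-- Copy the coordinates of `y` to the `Q`-fixed elements of the basis of `C`. The `T`-invariance of
`y` makes them constant on orbits, so the lift is `θ(T)`-fixed. -/
theorem IsInducedAction.exists_br_eq (hθ : IsInducedAction k C Q θ)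
    [FiniteDimensional k C] (hperm : IsPPermutationAlgebra p k G C) {T : Subgroup K}
    (hT : IsPGroup p T) (hQT : Q ≤ T.map θ) {y : BrauerQuotient k C Q}
    (hy : y ∈ FixedPoints.subalgebra k (BrauerQuotient k C Q) T) :
    ∃ (a : C) (_ : a ∈ FixedPoints.subalgebra k C (T.map θ))
      (haQ : a ∈ FixedPoints.subalgebra k C Q), BrauerQuotient.br k Q ⟨a, haQ⟩ = y := by
  obtain ⟨b, β, hb, hβ, hrepr⟩ := hθ.exists_stable_basis p hperm hT hQT
  obtain ⟨_, hact⟩ := exists_mulAction_of_basis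
    (Representation.ofDistribMulAction k T (BrauerQuotient k C Q)) β
    fun t j => let ⟨j', hj'⟩ := hβ t j; ⟨j', hj'.2⟩
  have hact' : ∀ (t : T) (j : {i // b i ∈ FixedPoints.subalgebra k C Q}),
      θ t • b j.1 = b (t • j).1 := by
    intro t j
    obtain ⟨j', h1, h2⟩ := hβ t j
    rw [h1]
    have : β j' = β (t • j) := h2.symm.trans (hact t j)
    rw [β.injective this]
  have : Fintype {i // b i ∈ FixedPoints.subalgebra k C Q} := Fintype.ofFinite _
  have hfix : ∑ j, β.repr y j • b j.1 ∈ FixedPoints.subalgebra k C (T.map θ) := by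
    rintro ⟨_, t, ht, rfl⟩
    change θ t • ∑ j, β.repr y j • b j.1 = _
    rw [Finset.smul_sum]
    refine Fintype.sum_equiv (MulAction.toPerm (⟨t, ht⟩ : T)) _ _ fun j => ?_
    have h1 := repr_smul_of_basis _ β hact ⟨t, ht⟩ y j
    have h2 : Representation.ofDistribMulAction k T (BrauerQuotient k C Q) ⟨t, ht⟩ y = y :=
      hy ⟨t, ht⟩
    rw [h2] at h1
    rw [smul_comm, hact' ⟨t, ht⟩ j, MulAction.toPerm_apply, h1]
  refine ⟨_, hfix, fixed_mono hQT hfix, β.repr.injective ?_⟩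
  classical
  ext j
  rw [hrepr]
  change b.repr (∑ j, β.repr y j • b j.1) j.1 = _
  rw [map_sum, Finsupp.finsetSum_apply, Finset.sum_eq_single j]
  · simp
  · intro i _ hi
    have : i.1 ≠ j.1 := fun h => hi (Subtype.ext h)
    simp [this]
  · simp

/-- The homomorphism `C^T → C(Q)`. -/
noncomputable def fixedToBrauer (k : Type*) {G C : Type*} [Field k] [Group G] [Finite G] [Ring C]
    [Algebra k C] [MulSemiringAction G C] [SMulCommClass G k C] {Q T : Subgroup G} (hQT : Q ≤ T) :
    FixedPoints.subalgebra k C T →ₐ[k] BrauerQuotient k C Q :=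
  (BrauerQuotient.br k Q).comp (Subalgebra.inclusion fun _ ha => fixed_mono hQT ha)

/-- The canonical isomorphism `C(T) → C(Q)(T)`. -/
theorem IsInducedAction.exists_algEquiv (hθ : IsInducedAction k C Q θ)
    [FiniteDimensional k C] (hperm : IsPPermutationAlgebra p k G C) {T : Subgroup K}
    (hT : IsPGroup p T) (hQT : Q ≤ T.map θ) :
    ∃ Θ : BrauerQuotient k C (T.map θ) ≃ₐ[k] BrauerQuotient k (BrauerQuotient k C Q) T,
      ∀ a haT haQ hbr, Θ (BrauerQuotient.br k (T.map θ) ⟨a, haT⟩) =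
        BrauerQuotient.br k T ⟨BrauerQuotient.br k Q ⟨a, haQ⟩, hbr⟩ := by
  let ψ : FixedPoints.subalgebra k C (T.map θ) →ₐ[k]
      FixedPoints.subalgebra k (BrauerQuotient k C Q) T :=
    (fixedToBrauer k hQT).codRestrict _ fun a => hθ.br_mem a.2 (fixed_mono hQT a.2)
  let Φ : BrauerQuotient k C (T.map θ) →ₐ[k] BrauerQuotient k (BrauerQuotient k C Q) T :=
    Ideal.Quotient.liftₐ (brauerIdeal k C (T.map θ)) ((BrauerQuotient.br k T).comp ψ) (by
      intro a ha
      exact (hθ.br_eq_zero_iff p hperm hT hQT a.2 (fixed_mono hQT a.2) _).2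
        (_root_.br_eq_zero_iff.2 ha))
  have hΦ : ∀ a, Φ (BrauerQuotient.br k (T.map θ) a) = BrauerQuotient.br k T (ψ a) := fun _ => rfl
  refine ⟨AlgEquiv.ofBijective Φ ⟨?_, ?_⟩, fun a haT haQ hbr => rfl⟩
  · rw [injective_iff_map_eq_zero]
    intro y hy
    obtain ⟨a, rfl⟩ := BrauerQuotient.br_surjective k _ y
    rw [hΦ] at hy
    exact (hθ.br_eq_zero_iff p hperm hT hQT a.2 (fixed_mono hQT a.2) _).1 hy
  · intro z
    obtain ⟨⟨y, hy⟩, rfl⟩ := BrauerQuotient.br_surjective k _ z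
    obtain ⟨a, haT, haQ, rfl⟩ := hθ.exists_br_eq p hperm hT hQT hy
    exact ⟨BrauerQuotient.br k _ ⟨a, haT⟩, rfl⟩

/-! ### Corresponding pairs for `C` and `C(Q)` -/

/-- The pairs `(θ(T), e)`, `e ∈ C(θ(T))`, and `(T, e')`, `e' ∈ C(Q)(T)`, correspond under the
canonical isomorphism `C(θ(T)) → C(Q)(T)`. -/
def CorrespondsAlong (θ : K →* G) (X : BPair k (G := G) C)
    (X' : BPair k (G := K) (BrauerQuotient k C Q)) : Prop :=
  X.subgroup = X'.subgroup.map θ ∧ Q ≤ X.subgroup ∧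
    ∃ (a : C) (hR : a ∈ FixedPoints.subalgebra k C X.subgroup)
      (hQ : a ∈ FixedPoints.subalgebra k C Q)
      (hQR : BrauerQuotient.br k Q ⟨a, hQ⟩ ∈
        FixedPoints.subalgebra k (BrauerQuotient k C Q) X'.subgroup),
      BrauerQuotient.br k X.subgroup ⟨a, hR⟩ = X.elt ∧
      BrauerQuotient.br k X'.subgroup ⟨BrauerQuotient.br k Q ⟨a, hQ⟩, hQR⟩ = X'.elt

/-- The correspondence is the graph of `Θ`; its existence and uniqueness statements reduce to the
bijectivity of `Θ`. -/
theorem IsInducedAction.correspondsAlong_iff (hθ : IsInducedAction k C Q θ) {T : Subgroup K}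
    (hQT : Q ≤ T.map θ)
    (Θ : BrauerQuotient k C (T.map θ) ≃ₐ[k] BrauerQuotient k (BrauerQuotient k C Q) T)
    (hΘ : ∀ a haT haQ hbr, Θ (BrauerQuotient.br k (T.map θ) ⟨a, haT⟩) =
        BrauerQuotient.br k T ⟨BrauerQuotient.br k Q ⟨a, haQ⟩, hbr⟩)
    (e : BrauerQuotient k C (T.map θ)) (e' : BrauerQuotient k (BrauerQuotient k C Q) T) :
    CorrespondsAlong θ ⟨T.map θ, e⟩ ⟨T, e'⟩ ↔ Θ e = e' := by
  constructor
  · rintro ⟨_, _, a, haT, haQ, hbr, h1, h2⟩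
    exact (congrArg Θ h1).symm.trans ((hΘ a haT haQ hbr).trans h2)
  · rintro rfl
    obtain ⟨⟨a, ha⟩, rfl⟩ := BrauerQuotient.br_surjective k _ e
    exact ⟨rfl, hQT, a, ha, fixed_mono hQT ha, hθ.br_mem ha _, rfl, (hΘ _ _ _ _).symm⟩

/-- The canonical isomorphism `C(T) → C(Q)(T)` at corresponding pairs maps one block to the
other. -/
theorem IsInducedAction.exists_equiv_of_corresponds (hθ : IsInducedAction k C Q θ)
    [FiniteDimensional k C] (hperm : IsPPermutationAlgebra p k G C)
    {X : BPair k (G := G) C} {X' : BPair k (G := K) (BrauerQuotient k C Q)}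
    (hX' : IsPGroup p X'.subgroup) (h : CorrespondsAlong θ X X') :
    ∃ Θ : BrauerQuotient k C X.subgroup ≃ₐ[k]
        BrauerQuotient k (BrauerQuotient k C Q) X'.subgroup, Θ X.elt = X'.elt ∧
      ∀ a haT haQ hbr, Θ (BrauerQuotient.br k X.subgroup ⟨a, haT⟩) =
        BrauerQuotient.br k X'.subgroup ⟨BrauerQuotient.br k Q ⟨a, haQ⟩, hbr⟩ := by
  obtain ⟨T, e'⟩ := X'
  obtain ⟨R, e⟩ := X
  obtain ⟨rfl : R = T.map θ, hQT, h2⟩ := id h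
  obtain ⟨Θ, hΘ⟩ := hθ.exists_algEquiv p hperm hX' hQT
  exact ⟨Θ, (hθ.correspondsAlong_iff hQT Θ hΘ e e').1 h, hΘ⟩

variable {X Y : BPair k (G := G) C} {X' Y' : BPair k (G := K) (BrauerQuotient k C Q)}

theorem IsInducedAction.exists_corresponds (hθ : IsInducedAction k C Q θ)
    [FiniteDimensional k C] (hperm : IsPPermutationAlgebra p k G C) {T : Subgroup K}
    (hT : IsPGroup p T) (hQT : Q ≤ T.map θ) (e : BrauerQuotient k C (T.map θ)) :
    ∃ e' : BrauerQuotient k (BrauerQuotient k C Q) T,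
      CorrespondsAlong θ ⟨T.map θ, e⟩ ⟨T, e'⟩ := by
  obtain ⟨Θ, hΘ⟩ := hθ.exists_algEquiv p hperm hT hQT
  exact ⟨_, (hθ.correspondsAlong_iff hQT Θ hΘ e _).2 rfl⟩

theorem IsInducedAction.exists_corresponds_symm (hθ : IsInducedAction k C Q θ)
    [FiniteDimensional k C] (hperm : IsPPermutationAlgebra p k G C)
    (hX' : IsPGroup p X'.subgroup) (hQX : Q ≤ X'.subgroup.map θ) :
    ∃ e, CorrespondsAlong θ ⟨X'.subgroup.map θ, e⟩ X' := by
  obtain ⟨T, e'⟩ := X'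
  obtain ⟨Θ, hΘ⟩ := hθ.exists_algEquiv p hperm hX' hQX
  exact ⟨Θ.symm e', (hθ.correspondsAlong_iff hQX Θ hΘ _ _).2 (Θ.apply_symm_apply e')⟩

theorem IsInducedAction.corresponds_left_unique (hθ : IsInducedAction k C Q θ)
    [FiniteDimensional k C] (hperm : IsPPermutationAlgebra p k G C)
    (hX' : IsPGroup p X'.subgroup) (h : CorrespondsAlong θ X X')
    (h' : CorrespondsAlong θ Y X') : X = Y := by
  obtain ⟨T, e'⟩ := X'
  obtain ⟨R, e⟩ := X
  obtain ⟨S, d⟩ := Y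
  obtain ⟨rfl : R = T.map θ, hQT, _⟩ := id h
  obtain ⟨rfl : S = T.map θ, _, _⟩ := id h'
  obtain ⟨Θ, hΘ⟩ := hθ.exists_algEquiv p hperm hX' hQT
  rw [hθ.correspondsAlong_iff hQT Θ hΘ] at h h'
  rw [Θ.injective (h.trans h'.symm)]

theorem IsInducedAction.corresponds_right_unique (hθ : IsInducedAction k C Q θ)
    [FiniteDimensional k C] (hperm : IsPPermutationAlgebra p k G C)
    (hX' : IsPGroup p X'.subgroup) (h : CorrespondsAlong θ X X')
    (h' : CorrespondsAlong θ X Y') : X' = Y' := by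
  obtain ⟨T, e'⟩ := X'
  obtain ⟨R, e⟩ := X
  obtain ⟨S, d⟩ := Y'
  obtain ⟨rfl : R = T.map θ, hQT, _⟩ := id h
  obtain ⟨h1 : T.map θ = S.map θ, _, _⟩ := id h'
  obtain rfl := Subgroup.map_injective hθ.1 h1
  obtain ⟨Θ, hΘ⟩ := hθ.exists_algEquiv p hperm hX' hQT
  rw [hθ.correspondsAlong_iff hQT Θ hΘ] at h h'
  rw [← h, ← h']

theorem CorrespondsAlong.isPGroup (hX : IsPGroup p X.subgroup) (hθ : IsInducedAction k C Q θ)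
    (h : CorrespondsAlong θ X X') : IsPGroup p X'.subgroup := by
  have := hX
  rw [h.1] at this
  exact this.of_equiv (X'.subgroup.equivMapOfInjective θ hθ.1).symm

theorem IsInducedAction.mul_ne_zero_iff (hθ : IsInducedAction k C Q θ)
    [FiniteDimensional k C] (hperm : IsPPermutationAlgebra p k G C)
    (hX' : IsPGroup p X'.subgroup) (h : CorrespondsAlong θ X X') {a : C}
    (haT : a ∈ FixedPoints.subalgebra k C X.subgroup) (haQ : a ∈ FixedPoints.subalgebra k C Q)
    (hbr : BrauerQuotient.br k Q ⟨a, haQ⟩ ∈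
      FixedPoints.subalgebra k (BrauerQuotient k C Q) X'.subgroup) :
    BrauerQuotient.br k X'.subgroup ⟨BrauerQuotient.br k Q ⟨a, haQ⟩, hbr⟩ * X'.elt ≠ 0 ↔
      BrauerQuotient.br k X.subgroup ⟨a, haT⟩ * X.elt ≠ 0 := by
  obtain ⟨Θ, h1, h2⟩ := hθ.exists_equiv_of_corresponds p hperm hX' h
  rw [← h1, ← h2 a haT haQ hbr, ← map_mul, map_ne_zero_iff _ Θ.injective]

theorem IsInducedAction.isBlock_iff (hθ : IsInducedAction k C Q θ)
    [FiniteDimensional k C] (hperm : IsPPermutationAlgebra p k G C)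
    (hX' : IsPGroup p X'.subgroup) (h : CorrespondsAlong θ X X') :
    IsBlock k X'.elt ↔ IsBlock k X.elt := by
  obtain ⟨Θ, h1, _⟩ := hθ.exists_equiv_of_corresponds p hperm hX' h
  rw [← h1]
  exact ⟨fun h => by simpa using h.map Θ.symm, fun h => h.map Θ⟩

/-- An idempotent of `C(Q)^T` lifts to an idempotent of `C^T`. -/
theorem IsInducedAction.exists_lift_idempotent (hθ : IsInducedAction k C Q θ)
    [FiniteDimensional k C] (hperm : IsPPermutationAlgebra p k G C)
    (hX' : IsPGroup p X'.subgroup) (h : CorrespondsAlong θ X X') {y : BrauerQuotient k C Q}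
    (hy : y ∈ FixedPoints.subalgebra k (BrauerQuotient k C Q) X'.subgroup) (hyy : y * y = y) :
    ∃ e : FixedPoints.subalgebra k C X.subgroup, e * e = e ∧ fixedToBrauer k h.2.1 e = y := by
  obtain ⟨a, haT, haQ, rfl⟩ := hθ.exists_br_eq p hperm hX' (h.1 ▸ h.2.1) hy
  exact _root_.exists_lift_idempotent (fixedToBrauer k h.2.1) ⟨a, h.1 ▸ haT⟩ hyy

/-- Under the canonical isomorphisms, inclusions of pairs for `C` and `C(Q)` agree. -/
theorem IsInducedAction.le_iff (hθ : IsInducedAction k C Q θ)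
    [FiniteDimensional k C] (hperm : IsPPermutationAlgebra p k G C)
    (hX' : IsPGroup p X'.subgroup) (hY' : IsPGroup p Y'.subgroup) (hX : CorrespondsAlong θ X X')
    (hY : CorrespondsAlong θ Y Y') : X'.Le Y' ↔ X.Le Y := by
  have hsub : X'.subgroup ≤ Y'.subgroup ↔ X.subgroup ≤ Y.subgroup := by
    rw [hX.1, hY.1, Subgroup.map_le_map_iff_of_injective hθ.1]
  unfold BPair.Le
  rw [hsub]
  refine and_congr_right fun hle => ?_
  constructor
  · intro h i hT hS hi hne
    have hiQ := fixed_mono hX.2.1 hS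
    have hbrT := hθ.br_mem (T := Y'.subgroup) (hY.1 ▸ hT) hiQ
    have hbrS := hθ.br_mem (T := X'.subgroup) (hX.1 ▸ hS) hiQ
    rw [← hθ.mul_ne_zero_iff p hperm hY' hY hT hiQ hbrT] at hne
    rw [← hθ.mul_ne_zero_iff p hperm hX' hX hS hiQ hbrS]
    have hidem : BrauerQuotient.br k Q ⟨i, hiQ⟩ * BrauerQuotient.br k Q ⟨i, hiQ⟩ =
        BrauerQuotient.br k Q ⟨i, hiQ⟩ := by
      rw [← map_mul]
      congr 1
      exact Subtype.ext hi.2.1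
    -- The image of `i` in `C(Q)` is only used as an idempotent; the hypothesis is tested on a
    -- primitive `j` below it, and `j = j Br_Q(i)` carries the conclusion back.
    obtain ⟨j, hj, h1, h2, h3⟩ := exists_primitive_br_mul_ne_zero Y'.elt
      ⟨BrauerQuotient.br k Q ⟨i, hiQ⟩, hbrT⟩ (Subtype.ext hidem) hne
    have h4 := h j j.2 (fixed_mono (hsub.2 hle) j.2) hj h3
    intro h0
    apply h4
    have h5 : (⟨(j : BrauerQuotient k C Q), fixed_mono (hsub.2 hle) j.2⟩ :
        FixedPoints.subalgebra k (BrauerQuotient k C Q) X'.subgroup) =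
        ⟨j, fixed_mono (hsub.2 hle) j.2⟩ * ⟨BrauerQuotient.br k Q ⟨i, hiQ⟩, hbrS⟩ :=
      Subtype.ext (congrArg Subtype.val h2).symm
    rw [h5, map_mul, mul_assoc, h0, mul_zero]
  · intro h j hT hS hj hne
    -- Conversely, lift `j` to an idempotent of the fixed algebra of `C` and test a primitive
    -- idempotent below the lift.
    obtain ⟨e, he, hej⟩ := hθ.exists_lift_idempotent p hperm hY' hY hT hj.2.1
    have heQ := fixed_mono hY.2.1 e.2
    have hej' : BrauerQuotient.br k Q ⟨(e : C), heQ⟩ = j := hej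
    subst hej'
    rw [hθ.mul_ne_zero_iff p hperm hY' hY e.2 heQ hT] at hne
    obtain ⟨i, hi, h1, h2, h3⟩ := exists_primitive_br_mul_ne_zero Y.elt e he hne
    have h4 := h i i.2 (fixed_mono hle i.2) hi h3
    rw [hθ.mul_ne_zero_iff p hperm hX' hX (fixed_mono hle e.2) heQ hS]
    intro h0
    apply h4
    have h5 : (⟨(i : C), fixed_mono hle i.2⟩ : FixedPoints.subalgebra k C X.subgroup) =
        ⟨i, fixed_mono hle i.2⟩ * ⟨e, fixed_mono hle e.2⟩ :=
      Subtype.ext (congrArg Subtype.val h2).symm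
    rw [h5, map_mul, mul_assoc, h0, mul_zero]

/-! ### Inclusions `(Q, f) ≤ (T, f_T)` with `Q` normal in `T` -/

theorem br_comm {T : Subgroup K} {z : BrauerQuotient k C Q}
    (hz : z ∈ FixedPoints.subalgebra k (BrauerQuotient k C Q) T) (hc : ∀ x, z * x = x * z)
    (y : BrauerQuotient k (BrauerQuotient k C Q) T) :
    BrauerQuotient.br k T ⟨z, hz⟩ * y = y * BrauerQuotient.br k T ⟨z, hz⟩ := by
  obtain ⟨y, rfl⟩ := BrauerQuotient.br_surjective k T y
  rw [← map_mul, ← map_mul]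
  congr 1
  exact Subtype.ext (hc y)

theorem br_mul_eq_self {T : Subgroup K} {z : BrauerQuotient k C Q}
    (hz : z ∈ FixedPoints.subalgebra k (BrauerQuotient k C Q) T) (hc : ∀ x, z * x = x * z)
    (hzz : z * z = z) {e : BrauerQuotient k (BrauerQuotient k C Q) T} (he : IsBlock k e)
    (h : BrauerQuotient.br k T ⟨z, hz⟩ * e ≠ 0) : BrauerQuotient.br k T ⟨z, hz⟩ * e = e := by
  refine he.mul_eq_self (br_comm hz hc) ?_ h
  rw [← map_mul]
  congr 1
  exact Subtype.ext hzz

/-- If `(Q, f) ≤ (T, f_T)`, then `f` is `T`-stable and `Br_T(f) f_T = f_T`. -/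
theorem IsInducedAction.stable_of_le (hθ : IsInducedAction k C Q θ)
    [FiniteDimensional k C] (hperm : IsPPermutationAlgebra p k G C)
    (hY' : IsPGroup p Y'.subgroup) (hY : CorrespondsAlong θ Y Y') (hYb : IsBlock k Y.elt)
    {f : BrauerQuotient k C Q} (hf : IsBlock k f) (hle : BPair.Le ⟨Q, f⟩ Y) :
    ∃ hfix : f ∈ FixedPoints.subalgebra k (BrauerQuotient k C Q) Y'.subgroup,
      BrauerQuotient.br k Y'.subgroup ⟨f, hfix⟩ * Y'.elt = Y'.elt := by
  classical
  have hYb' : IsBlock k Y'.elt := (hθ.isBlock_iff p hperm hY' hY).2 hYb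
  have horb : ∀ x ∈ MulAction.orbit Y'.subgroup f, IsBlock k x := by
    rintro _ ⟨t, rfl⟩
    exact hf.map (MulSemiringAction.toAlgEquiv k (BrauerQuotient k C Q) t)
  have : Fintype (MulAction.orbit Y'.subgroup f) :=
    (Set.finite_range fun t : Y'.subgroup => t • f).fintype
  -- Conjugate blocks are equal or orthogonal, so the orbit sum `E` is a stable central idempotent
  -- above `f`. Write `T` for the group of `Y'` and `f_T` for its block.
  let E : BrauerQuotient k C Q := ∑ x : MulAction.orbit Y'.subgroup f, x.1
  have hEmul : ∀ x : MulAction.orbit Y'.subgroup f, E * x.1 = x.1 := by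
    intro x
    rw [Finset.sum_mul, Finset.sum_eq_single x]
    · exact (horb x x.2).2.1
    · intro y _ hyx
      by_contra hne
      exact hyx (Subtype.ext ((horb y y.2).eq_of_mul_ne_zero (horb x x.2) hne))
    · simp
  have hEE : E * E = E := by
    conv_lhs => enter [2]; rw [show E = ∑ x : MulAction.orbit Y'.subgroup f, x.1 from rfl]
    rw [Finset.mul_sum]
    exact Finset.sum_congr rfl fun x _ => hEmul x
  have hEc : ∀ x, E * x = x * E := by
    intro x
    rw [Finset.sum_mul, Finset.mul_sum]
    exact Finset.sum_congr rfl fun y _ => (horb y y.2).comm x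
  have hEfix : E ∈ FixedPoints.subalgebra k (BrauerQuotient k C Q) Y'.subgroup := by
    intro t
    rw [Finset.smul_sum]
    exact Fintype.sum_equiv (MulAction.toPerm t) _ _ fun _ => rfl
  have hEf : E * f = f := hEmul ⟨f, MulAction.mem_orbit_self f⟩
  -- If `Br_T(E) f_T = 0`, then `1 - E` lifts to an idempotent not killed at `f_T`. A primitive `i`
  -- below the lift has `Br_Q(i) f = 0`, since `(1 - E) f = 0`; this contradicts the inclusion.
  by_cases hE : BrauerQuotient.br k Y'.subgroup ⟨E, hEfix⟩ * Y'.elt = 0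
  · exfalso
    obtain ⟨e, he, heE⟩ := hθ.exists_lift_idempotent p hperm hY' hY
      (sub_mem (one_mem _) hEfix) (y := 1 - E) (by
        rw [mul_sub, sub_mul, sub_mul, hEE, one_mul, one_mul, mul_one, sub_self, sub_zero])
    have heQ := fixed_mono hY.2.1 e.2
    have heE' : BrauerQuotient.br k Q ⟨(e : C), heQ⟩ = 1 - E := heE
    have hbr := hθ.br_mem (T := Y'.subgroup) (hY.1 ▸ e.2) heQ
    have hne : BrauerQuotient.br k Y.subgroup e * Y.elt ≠ 0 := by
      rw [← hθ.mul_ne_zero_iff p hperm hY' hY e.2 heQ hbr]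
      have : (⟨BrauerQuotient.br k Q ⟨(e : C), heQ⟩, hbr⟩ :
          FixedPoints.subalgebra k (BrauerQuotient k C Q) Y'.subgroup) = 1 - ⟨E, hEfix⟩ :=
        Subtype.ext heE'
      rw [this, map_sub, map_one, sub_mul, hE, one_mul, sub_zero]
      exact hYb'.2.2.1
    obtain ⟨i, hi, h1, h2, h3⟩ := exists_primitive_br_mul_ne_zero Y.elt e he hne
    have hiQ := fixed_mono hY.2.1 i.2
    apply hle.2 i i.2 hiQ hi h3
    have h4 : (⟨(i : C), hiQ⟩ : FixedPoints.subalgebra k C Q) = ⟨i, hiQ⟩ * ⟨e, heQ⟩ :=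
      Subtype.ext (congrArg Subtype.val h2).symm
    change BrauerQuotient.br k Q ⟨(i : C), hiQ⟩ * f = 0
    rw [h4, map_mul, heE', mul_assoc, sub_mul, one_mul, hEf, sub_self, mul_zero]
  -- If `f` were not `T`-stable, no member of its orbit would be fixed, and the orbit sum `E` would
  -- be killed by `Br_T`.
  · have hstab : f ∈ FixedPoints.subalgebra k (BrauerQuotient k C Q) Y'.subgroup := by
      by_contra hns
      apply hE
      have : BrauerQuotient.br k Y'.subgroup ⟨E, hEfix⟩ = 0 := by
        rw [_root_.br_eq_zero_iff]
        refine sum_mem_properTraces _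
          (fun x : MulAction.orbit Y'.subgroup f => (x : BrauerQuotient k C Q))
          (fun _ _ => rfl) ?_
        rintro ⟨_, t, rfl⟩ hx
        exfalso
        apply hns
        intro s
        have h1 : (t * s * t⁻¹) • t • f = t • f := congrArg Subtype.val (hx (t * s * t⁻¹))
        have h2 : t • s • f = t • f := by
          rw [← h1]
          simp only [← mul_smul, inv_mul_cancel_right]
        exact MulAction.injective t h2
      rw [this, zero_mul]
    refine ⟨hstab, ?_⟩
    have hE1 : E = f := by
      refine (Finset.sum_eq_single (⟨f, MulAction.mem_orbit_self f⟩ :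
        MulAction.orbit Y'.subgroup f) ?_ (by simp)).trans rfl
      rintro ⟨_, t, rfl⟩ _ hx
      exact absurd (Subtype.ext (hstab t)) hx
    have := br_mul_eq_self hEfix hEc hEE hYb' hE
    simpa only [hE1] using this

/-- Here `f_T = Br_T(f) f_T`, so `Br_Q(i) f = 0` forces `Br_T(Br_Q(i)) f_T = 0`. -/
theorem IsInducedAction.le_of_mul_ne_zero (hθ : IsInducedAction k C Q θ)
    [FiniteDimensional k C] (hperm : IsPPermutationAlgebra p k G C)
    (hY' : IsPGroup p Y'.subgroup) (hY : CorrespondsAlong θ Y Y') (hYb' : IsBlock k Y'.elt)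
    {f : BrauerQuotient k C Q} (hf : IsBlock k f)
    (hfix : f ∈ FixedPoints.subalgebra k (BrauerQuotient k C Q) Y'.subgroup)
    (h : BrauerQuotient.br k Y'.subgroup ⟨f, hfix⟩ * Y'.elt ≠ 0) : BPair.Le ⟨Q, f⟩ Y := by
  have hself := br_mul_eq_self hfix hf.comm hf.2.1 hYb' h
  refine ⟨hY.2.1, fun i hT hS hi hne h0 => ?_⟩
  have hbr := hθ.br_mem (T := Y'.subgroup) (hY.1 ▸ hT) hS
  rw [← hθ.mul_ne_zero_iff p hperm hY' hY hT hS hbr] at hne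
  apply hne
  have : (⟨BrauerQuotient.br k Q ⟨i, hS⟩, hbr⟩ * ⟨f, hfix⟩ :
      FixedPoints.subalgebra k (BrauerQuotient k C Q) Y'.subgroup) = 0 := Subtype.ext h0
  rw [← hself, ← mul_assoc, ← map_mul, this, map_zero, zero_mul]

/-- Distinct blocks are orthogonal, but both `Br_T(f)` and `Br_T(f')` act as the identity on `f_T ≠
0`. -/
theorem IsInducedAction.eq_of_le_of_le (hθ : IsInducedAction k C Q θ)
    [FiniteDimensional k C] (hperm : IsPPermutationAlgebra p k G C)
    (hY' : IsPGroup p Y'.subgroup) (hY : CorrespondsAlong θ Y Y') (hYb : IsBlock k Y.elt)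
    {f f' : BrauerQuotient k C Q} (hf : IsBlock k f) (hf' : IsBlock k f')
    (hle : BPair.Le ⟨Q, f⟩ Y) (hle' : BPair.Le ⟨Q, f'⟩ Y) : f = f' := by
  obtain ⟨h1, h2⟩ := hθ.stable_of_le p hperm hY' hY hYb hf hle
  obtain ⟨h1', h2'⟩ := hθ.stable_of_le p hperm hY' hY hYb hf' hle'
  refine hf.eq_of_mul_ne_zero hf' fun h0 => ((hθ.isBlock_iff p hperm hY' hY).2 hYb).2.2.1 ?_
  have : (⟨f, h1⟩ * ⟨f', h1'⟩ :
      FixedPoints.subalgebra k (BrauerQuotient k C Q) Y'.subgroup) = 0 := Subtype.ext h0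
  rw [← h2, ← h2', ← mul_assoc, ← map_mul, this, map_zero, zero_mul]

end PPermutation

/-! ### Fusion systems of corresponding pairs -/

section Fusion

variable {k G B : Type*} [Field k] [Group G] [Finite G] [Ring B] [Algebra k B]
  [FiniteDimensional k B] [MulSemiringAction G B] [SMulCommClass G k B] {p : ℕ} {c : B}
  {U Q P : BPair k (G := G) B}

theorem FusionSystem.ext_pair {X Y : FusionSystem p c U} (h : X.pair = Y.pair) : X = Y := by
  cases X; cases Y; cases h; rfl

theorem FusionSystem.hom_ext_val {X Y : FusionSystem p c U} {φ ψ : X ⟶ Y}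
    (h : ∀ u, (toMonoidHom φ u : G) = toMonoidHom ψ u) : φ = ψ :=
  Subtype.ext (MonoidHom.ext fun u => Subtype.ext (h u))

theorem FusionSystem.exists_conj {X Y : FusionSystem p c U} (φ : X ⟶ Y) :
    ∃ x : G, (X.pair.conj x).Le Y.pair ∧ ∀ u, (toMonoidHom φ u : G) = x * u * x⁻¹ :=
  φ.2

/-- The morphism of the fusion system given by conjugation with `x`. -/
def FusionSystem.homOfConj {X Y : FusionSystem p c U} (x : G) (h : (X.pair.conj x).Le Y.pair) :
    X ⟶ Y :=
  show FusionSystem.Hom X Y from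
  ⟨{ toFun := fun u => ⟨x * u * x⁻¹, ((BPair.conj_le_iff x _ _).1 h).1 u u.2⟩
     map_one' := Subtype.ext (by simp)
     map_mul' := fun u v => Subtype.ext (by simp) }, x, h, fun _ => rfl⟩

theorem FusionInterval.toMonoidHom_eqToHom {X Y : FusionInterval p c U Q P} (h : X = Y)
    (u : X.obj.pair.subgroup) :
    (FusionSystem.toMonoidHom (CategoryTheory.eqToHom h).hom u : G) = u := by
  subst h
  rfl

theorem FusionInterval.ext_pair {X Y : FusionInterval p c U Q P} (h : X.obj.pair = Y.obj.pair) :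
    X = Y :=
  CategoryTheory.ObjectProperty.FullSubcategory.ext (FusionSystem.ext_pair h)

open CategoryTheory in
theorem FusionInterval.toMonoidHom_comp {X Y Z : FusionInterval p c U Q P} (φ : X ⟶ Y)
    (ψ : Y ⟶ Z) (u : X.obj.pair.subgroup) :
    FusionSystem.toMonoidHom (φ ≫ ψ).hom u =
      FusionSystem.toMonoidHom ψ.hom (FusionSystem.toMonoidHom φ.hom u) := rfl

theorem FusionInterval.hom_ext_val {X Y : FusionInterval p c U Q P} {φ ψ : X ⟶ Y}
    (h : ∀ u, (FusionSystem.toMonoidHom φ.hom u : G) = FusionSystem.toMonoidHom ψ.hom u) :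
    φ = ψ :=
  CategoryTheory.ObjectProperty.hom_ext _ (FusionSystem.hom_ext_val h)

end Fusion

/-! ### Functors between intervals of fusion systems -/

section Comparison

variable {k G H B D : Type*} [Field k] [Group G] [Finite G] [Ring B] [Algebra k B]
  [FiniteDimensional k B] [MulSemiringAction G B] [SMulCommClass G k B]
  [Group H] [Finite H] [Ring D] [Algebra k D]
  [FiniteDimensional k D] [MulSemiringAction H D] [SMulCommClass H k D]
  {p : ℕ} {c : B} {d : D} {U Q P : BPair k (G := G) B} {U' Q' P' : BPair k (G := H) D}

open CategoryTheory in
/-- A functor between intervals of fusion systems is determined by a map on objects, if the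
morphisms correspond along a relation `r` between the elements of the two groups. -/
theorem FusionInterval.exists_functor (r : H → G → Prop)
    (F : FusionInterval p d U' Q' P' → FusionInterval p c U Q P)
    (hmap : ∀ (Y Z : FusionInterval p d U' Q' P') (φ : Y ⟶ Z), ∃ ψ : F Y ⟶ F Z,
      ∀ (s : Y.obj.pair.subgroup) (t : (F Y).obj.pair.subgroup), r s t →
      r (FusionSystem.toMonoidHom φ.hom s) (FusionSystem.toMonoidHom ψ.hom t))
    (hr : ∀ (Y : FusionInterval p d U' Q' P') (t : (F Y).obj.pair.subgroup),
      ∃ s : Y.obj.pair.subgroup, r s t)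
    (huniq : ∀ s t t', r s t → r s t' → t = t') :
    ∃ Φ : FusionInterval p d U' Q' P' ⥤ FusionInterval p c U Q P, (∀ Y, Φ.obj Y = F Y) ∧
      ∀ (Y Z : FusionInterval p d U' Q' P') (φ : Y ⟶ Z) (s : Y.obj.pair.subgroup)
        (t : (Φ.obj Y).obj.pair.subgroup), r s t →
        r (FusionSystem.toMonoidHom φ.hom s) (FusionSystem.toMonoidHom (Φ.map φ).hom t) := by
  choose m hm using hmap
  refine ⟨{ obj := F, map := fun {Y Z} φ => m Y Z φ, map_id := fun Y => ?_,
            map_comp := fun {X Y Z} φ ψ => ?_ }, fun _ => rfl, hm⟩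
  -- Every `t` is related to some `s`, and `s` determines its partner. So the chosen morphisms are
  -- unique, and identities and composites are preserved.
  · refine FusionInterval.hom_ext_val fun t => ?_
    obtain ⟨s, hs⟩ := hr Y t
    exact huniq _ _ _ (hm Y Y (𝟙 Y) s t hs) hs
  · refine FusionInterval.hom_ext_val fun t => ?_
    obtain ⟨s, hs⟩ := hr X t
    exact huniq _ _ _ (hm X Z (φ ≫ ψ) s t hs) (hm Y Z ψ _ _ (hm X Y φ s t hs))

open CategoryTheory in
-- Objects agree only propositionally, so `eqToHom` intervenes; its underlying homomorphism is the
-- identity on elements of `G`, hence comparing values in `G` is enough.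
theorem FusionInterval.functor_eq_id (Φ : FusionInterval p c U Q P ⥤ FusionInterval p c U Q P)
    (hobj : ∀ Y, (Φ.obj Y).obj.pair = Y.obj.pair)
    (hmap : ∀ (Y Z : FusionInterval p c U Q P) (φ : Y ⟶ Z) (s : Y.obj.pair.subgroup)
      (t : (Φ.obj Y).obj.pair.subgroup), (s : G) = t →
        (FusionSystem.toMonoidHom (Φ.map φ).hom t : G) = FusionSystem.toMonoidHom φ.hom s) :
    Φ = 𝟭 _ := by
  refine CategoryTheory.Functor.ext (fun Y => FusionInterval.ext_pair (hobj Y)) ?_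
  intro Y Z φ
  refine FusionInterval.hom_ext_val fun t => ?_
  rw [FusionInterval.toMonoidHom_comp, FusionInterval.toMonoidHom_comp,
    FusionInterval.toMonoidHom_eqToHom]
  exact hmap Y Z φ _ t (FusionInterval.toMonoidHom_eqToHom _ t)

end Comparison

/-! ### Brauer pairs above `(Q, f)` and the group `N_G(Q, f)` -/

section PairNormalizer

variable {k G C : Type*} [Field k] [Group G] [Finite G] [Ring C] [Algebra k C]
  [MulSemiringAction G C] [SMulCommClass G k C] {Q : Subgroup G}

/-- The larger group `N_G(Q)` is needed first: the stability of `f` must be proved before a subgroup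
is known to lie in `N_G(Q, f)`. -/
theorem isInducedAction_normalizer :
    IsInducedAction k C Q (Subgroup.normalizer (Q : Set G)).subtype :=
  ⟨Subtype.val_injective, fun x a ha =>
    ⟨(BrauerQuotient.conjFixed k (x : G) Q Q x.2 ⟨a, ha⟩).2, rfl⟩⟩

theorem isInducedAction_pairNormalizer (f : BrauerQuotient k C Q) :
    IsInducedAction k C Q (pairNormalizerIncl Q f) :=
  ⟨Subtype.val_injective.comp Subtype.val_injective, fun x a ha =>
    ⟨(BrauerQuotient.conjFixed k (x.1 : G) Q Q x.1.2 ⟨a, ha⟩).2, rfl⟩⟩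

theorem mem_range_pairNormalizerIncl {f : BrauerQuotient k C Q} {x : G}
    (hx : x ∈ Subgroup.normalizer (Q : Set G)) (hf : (⟨x, hx⟩ : Subgroup.normalizer (Q : Set G)) •
      f = f) : x ∈ (pairNormalizerIncl Q f).range :=
  ⟨⟨⟨x, hx⟩, hf⟩, rfl⟩

theorem le_range_pairNormalizerIncl (f : BrauerQuotient k C Q) :
    Q ≤ (pairNormalizerIncl Q f).range := by
  intro q hq
  refine mem_range_pairNormalizerIncl (Subgroup.le_normalizer hq) ?_
  obtain ⟨a, rfl⟩ := BrauerQuotient.br_surjective k Q f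
  exact congrArg (BrauerQuotient.br k Q) (Subtype.ext (a.2 ⟨q, hq⟩))

theorem corresponds_basePair (f : BrauerQuotient k C Q) :
    Corresponds Q f ⟨Q, f⟩ (basePair Q f) := by
  obtain ⟨⟨a, ha⟩, haf⟩ := BrauerQuotient.br_surjective k Q f
  refine ⟨(Subgroup.map_comap_eq_self (le_range_pairNormalizerIncl f)).symm, le_rfl, a, ha, ha,
    (isInducedAction_pairNormalizer f).br_mem ?_ ha, haf, ?_⟩
  · change a ∈ FixedPoints.subalgebra k C
      ((Q.comap (pairNormalizerIncl Q f)).map (pairNormalizerIncl Q f))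
    rw [Subgroup.map_comap_eq_self (le_range_pairNormalizerIncl f)]
    exact ha
  · change BrauerQuotient.br k _ _ = BrauerQuotient.br k _ _
    congr 1
    exact Subtype.ext haf

theorem conj_pair_eq {f : BrauerQuotient k C Q} {x : G}
    (hx : x ∈ Subgroup.normalizer (Q : Set G)) :
    (BPair.conj x ⟨Q, f⟩ : BPair k (G := G) C) =
      ⟨Q, (⟨x, hx⟩ : Subgroup.normalizer (Q : Set G)) • f⟩ := by
  -- The type of the block depends on the subgroup, so the subgroup is generalized before `xQx⁻¹ =
  -- Q` is substituted.
  have key : ∀ (T : Subgroup G) (h : ∀ g, g ∈ Q ↔ x * g * x⁻¹ ∈ T), T = Q →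
      (⟨T, BrauerQuotient.conj k x Q T h f⟩ : BPair k (G := G) C) =
        ⟨Q, (⟨x, hx⟩ : Subgroup.normalizer (Q : Set G)) • f⟩ := by
    rintro T h rfl
    rfl
  refine key _ _ ?_
  ext g
  constructor
  · rintro ⟨q, hq, rfl⟩
    exact (hx q).1 hq
  · intro hg
    refine ⟨x⁻¹ * g * x, (hx _).2 (by simpa [mul_assoc] using hg), by simp [mul_assoc]⟩

/-- A common representative `a` is moved to `θ x • a`; that `θ x` normalizes `Q` keeps `Q` inside
the conjugate subgroup. -/
theorem CorrespondsAlong.conj {K : Type*} [Group K] [Finite K] {θ : K →* G}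
    [MulSemiringAction K (BrauerQuotient k C Q)] [SMulCommClass K k (BrauerQuotient k C Q)]
    (hθ : IsInducedAction k C Q θ) {X : BPair k (G := G) C}
    {X' : BPair k (G := K) (BrauerQuotient k C Q)} (h : CorrespondsAlong θ X X') (x : K)
    (hx : θ x ∈ Subgroup.normalizer (Q : Set G)) :
    CorrespondsAlong θ (X.conj (θ x)) (X'.conj x) := by
  obtain ⟨h1, h2, a, haX, haQ, hbr, h3, h4⟩ := h
  obtain ⟨haQ', hx'⟩ := hθ.2 x a haQ
  have hsub : (X.conj (θ x)).subgroup = (X'.conj x).subgroup.map θ := by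
    change X.subgroup.map _ = (X'.subgroup.map _).map θ
    rw [h1, Subgroup.map_map, Subgroup.map_map]
    congr 1
    ext y
    simp
  have haX' : θ x • a ∈ FixedPoints.subalgebra k C (X.conj (θ x)).subgroup := by
    rintro ⟨_, s, hs, rfl⟩
    have hs' : s • a = a := haX ⟨s, hs⟩
    change (θ x * s * (θ x)⁻¹) • θ x • a = θ x • a
    rw [← mul_smul, inv_mul_cancel_right, mul_smul, hs']
  refine ⟨hsub, ?_, θ x • a, haX', haQ', hθ.br_mem (hsub ▸ haX') haQ', ?_, ?_⟩
  · intro q hq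
    exact ⟨(θ x)⁻¹ * q * θ x, h2 ((hx _).2 (by simpa [mul_assoc] using hq)), by simp [mul_assoc]⟩
  · change _ = BrauerQuotient.conj k (θ x) X.subgroup _ _ X.elt
    rw [← h3]
    rfl
  · change _ = BrauerQuotient.conj k x X'.subgroup _ _ X'.elt
    rw [← h4]
    have hmem : x • BrauerQuotient.br k Q ⟨a, haQ⟩ ∈
        FixedPoints.subalgebra k (BrauerQuotient k C Q) (X'.conj x).subgroup :=
      hx' ▸ hθ.br_mem (hsub ▸ haX') haQ'
    exact (congrArg (BrauerQuotient.br k (X'.conj x).subgroup) (a₂ := ⟨_, hmem⟩)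
      (Subtype.ext hx'.symm)).trans rfl

theorem IsInducedAction.exists_corresponds_of_le_range (p : ℕ) [Fact p.Prime] [CharP k p]
    {K : Type*} [Group K] [Finite K] {θ : K →* G}
    [MulSemiringAction K (BrauerQuotient k C Q)] [SMulCommClass K k (BrauerQuotient k C Q)]
    (hθ : IsInducedAction k C Q θ) [FiniteDimensional k C] (hperm : IsPPermutationAlgebra p k G C)
    {X : BPair k (G := G) C} (hX : IsPGroup p X.subgroup) (hQX : Q ≤ X.subgroup)
    (hle : X.subgroup ≤ θ.range) :
    ∃ X' : BPair k (G := K) (BrauerQuotient k C Q), CorrespondsAlong θ X X' := by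
  obtain ⟨R, e⟩ := X
  obtain ⟨T, rfl⟩ : ∃ T : Subgroup K, T.map θ = R :=
    ⟨R.comap θ, Subgroup.map_comap_eq_self hle⟩
  have hT : IsPGroup p T := hX.of_equiv (T.equivMapOfInjective θ hθ.1).symm
  obtain ⟨e', he'⟩ := hθ.exists_corresponds p hperm hT hQX e
  exact ⟨_, he'⟩

variable (p : ℕ) [Fact p.Prime] [CharP k p] [FiniteDimensional k C]

/-- Pairs above `(Q, f)` whose subgroup normalizes `Q` are contained in `N_G(Q, f)`. -/
theorem le_range_of_le (hperm : IsPPermutationAlgebra p k G C) {f : BrauerQuotient k C Q}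
    (hf : IsBlock k f) {X : BPair k (G := G) C} (hX : IsPGroup p X.subgroup)
    (hXb : IsBlock k X.elt) (hle : BPair.Le ⟨Q, f⟩ X)
    (hnorm : X.subgroup ≤ Subgroup.normalizer (Q : Set G)) :
    X.subgroup ≤ (pairNormalizerIncl Q f).range := by
  have hθ : IsInducedAction k C Q (Subgroup.normalizer (Q : Set G)).subtype :=
    isInducedAction_normalizer
  obtain ⟨X', hX'⟩ := hθ.exists_corresponds_of_le_range p hperm hX hle.1
    (by rwa [Subgroup.range_subtype])
  obtain ⟨hfix, _⟩ := hθ.stable_of_le p hperm (hX'.isPGroup p hX hθ) hX' hXb hf hle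
  intro x hx
  rw [hX'.1] at hx
  obtain ⟨y, hy, rfl⟩ := hx
  exact mem_range_pairNormalizerIncl y.2 (hfix ⟨y, hy⟩)

/-- If `x` normalizes `Q` and `ˣ(Q, f)` and `(Q, f)` are both contained in a pair whose subgroup
normalizes `Q`, then `x ∈ N_G(Q, f)`. -/
theorem mem_range_of_conj_le (hperm : IsPPermutationAlgebra p k G C) {f : BrauerQuotient k C Q}
    (hf : IsBlock k f) {X : BPair k (G := G) C} (hX : IsPGroup p X.subgroup)
    (hXb : IsBlock k X.elt) (hle : BPair.Le ⟨Q, f⟩ X)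
    (hnorm : X.subgroup ≤ Subgroup.normalizer (Q : Set G)) {x : G}
    (hx : x ∈ Subgroup.normalizer (Q : Set G)) (hxle : (BPair.conj x ⟨Q, f⟩).Le X) :
    x ∈ (pairNormalizerIncl Q f).range := by
  have hθ : IsInducedAction k C Q (Subgroup.normalizer (Q : Set G)).subtype :=
    isInducedAction_normalizer
  obtain ⟨X', hX'⟩ := hθ.exists_corresponds_of_le_range p hperm hX hle.1
    (by rwa [Subgroup.range_subtype])
  -- The conjugate pair is `(Q, ˣf)`, so uniqueness of the block at `Q` yields `ˣf = f`.
  rw [conj_pair_eq hx] at hxle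
  refine mem_range_pairNormalizerIncl hx ?_
  refine hθ.eq_of_le_of_le p hperm (hX'.isPGroup p hX hθ) hX' hXb ?_ hf hxle hle
  exact hf.map (MulSemiringAction.toAlgEquiv k (BrauerQuotient k C Q)
    (⟨x, hx⟩ : Subgroup.normalizer (Q : Set G)))

theorem IsBrauerPair.notMem_properTraces {c : C} {X : BPair k (G := G) C}
    (hX : IsBrauerPair p c X) :
    c ∉ properTraces (Representation.ofDistribMulAction k X.subgroup C) := by
  obtain ⟨_, _, hc, hne⟩ := hX
  intro h
  apply hne
  rw [br_eq_zero_iff.2 h, zero_mul]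

/-- If `c ∈ C_Q^N` and `c` is not killed by `Br_T`, where `Q ≤ T`, then `T ∩ N = Q`. -/
theorem inf_eq_of_notMem_properTraces (hperm : IsPPermutationAlgebra p k G C) {N : Subgroup G}
    {c : C} (hcG : ∀ g : G, g • c = c) (hQN : Q ≤ N)
    (hQ : c ∈ traceImage k N C (Q.subgroupOf N)) {T : Subgroup G} (hT : IsPGroup p T)
    (hQT : Q ≤ T) (h : c ∉ properTraces (Representation.ofDistribMulAction k T C)) :
    T ⊓ N = Q := by
  have h' := hperm.notMem_properTraces_of_le p hT (inf_le_left : T ⊓ N ≤ T)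
    (fun t : T => hcG t) h
  obtain ⟨m, hm, hcm⟩ := hQ
  by_contra hne
  apply h'
  rw [hcm]
  -- By the Mackey formula, `c` survives at `T ∩ N` only if an `N`-conjugate of `T ∩ N` lies in `Q`.
  -- With `Q ≤ T ∩ N`, comparing orders gives equality.
  refine relTrace_mem_properTraces (Subgroup.inclusion (inf_le_right : T ⊓ N ≤ N)) _ _
    (fun _ _ => rfl) _ m hm fun x => ?_
  by_contra! hx
  apply hne
  symm
  refine Subgroup.eq_of_le_of_card_ge (le_inf hQT hQN) ?_
  refine Nat.card_le_card_of_injective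
    (fun r : (T ⊓ N : Subgroup G) => (⟨(x : G)⁻¹ * r * x, hx r⟩ : Q)) fun r s hrs => ?_
  exact Subtype.ext (mul_left_cancel (mul_right_cancel (congrArg Subtype.val hrs)))

/-- A `(C, c, G)`-Brauer pair above `(Q, f)` corresponds to a `(C(Q), f, H)`-Brauer pair. -/
theorem isBrauerPair_of_corresponds (hperm : IsPPermutationAlgebra p k G C)
    {c : C} {f : BrauerQuotient k C Q} (hf : IsBlock k f) {X : BPair k (G := G) C}
    {X' : BPair k (G := pairNormalizer Q f) (BrauerQuotient k C Q)} (h : Corresponds Q f X X')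
    (hX : IsBrauerPair p c X) (hle : BPair.Le ⟨Q, f⟩ X) : IsBrauerPair p f X' := by
  have hθ := isInducedAction_pairNormalizer (k := k) f
  have hX' := CorrespondsAlong.isPGroup p hX.1 hθ h
  obtain ⟨hfix, hself⟩ := hθ.stable_of_le p hperm hX' h hX.2.1 hf hle
  have hb := (hθ.isBlock_iff p hperm hX' h).2 hX.2.1
  exact ⟨hX', hb, hfix, by rw [hself]; exact hb.2.2.1⟩

/-- If `c` is `G`-stable and `Br_Q(c) f = f`, then a `(C(Q), f, H)`-Brauer pair corresponds to a
`(C, c, G)`-Brauer pair above `(Q, f)`. -/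
theorem isBrauerPair_of_corresponds_symm (hperm : IsPPermutationAlgebra p k G C)
    {c : C} (hcG : ∀ g : G, g • c = c) {f : BrauerQuotient k C Q} (hf : IsBlock k f)
    (hcf : BrauerQuotient.br k Q ⟨c, fun q => hcG q⟩ * f = f) {X : BPair k (G := G) C}
    {X' : BPair k (G := pairNormalizer Q f) (BrauerQuotient k C Q)} (h : Corresponds Q f X X')
    (hX : IsBrauerPair p f X') : IsBrauerPair p c X ∧ BPair.Le ⟨Q, f⟩ X := by
  have hθ := isInducedAction_pairNormalizer (k := k) f
  obtain ⟨hX', hb, hfix, hne⟩ := hX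
  refine ⟨⟨?_, (hθ.isBlock_iff p hperm hX' h).1 hb, fun x => hcG x, ?_⟩,
    hθ.le_of_mul_ne_zero p hperm hX' h hb hf hfix hne⟩
  · rw [h.1]
    exact hX'.map _
  · have hbr := hθ.br_mem (T := X'.subgroup) (a := c) (fun x => hcG x) (fun q => hcG q)
    rw [← hθ.mul_ne_zero_iff p hperm hX' h (fun x => hcG x) (fun q => hcG q) hbr]
    intro h0
    apply hne
    -- As `f = Br_Q(c) f` and the block absorbs `Br(f)`, the image of `c` acts on the block as
    -- `Br(f)` does.
    have h1 : (⟨BrauerQuotient.br k Q ⟨c, fun q => hcG q⟩, hbr⟩ * ⟨f, hfix⟩ :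
        FixedPoints.subalgebra k (BrauerQuotient k C Q) X'.subgroup) = ⟨f, hfix⟩ :=
      Subtype.ext hcf
    have hself := br_mul_eq_self hfix hf.comm hf.2.1 hb hne
    rw [← h1, map_mul, mul_assoc, hself, h0]

end PairNormalizer

/-! ### Points on the extended Brauer quotient -/

section Points

theorem IsPoint.isPrimitive {k L B : Type*} [Field k] [Group L] [Ring B] [Algebra k B]
    [MulSemiringAction L B] [SMulCommClass L k B] {α : Set B} (hα : IsPoint k L α) {i : B}
    (hi : i ∈ α) : IsPrimitiveIdempotentIn (FixedPoints.subalgebra k B L) i := by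
  obtain ⟨i₀, h₀, rfl⟩ := hα
  obtain ⟨u, rfl⟩ := hi
  set v : B := ((u : FixedPoints.subalgebra k B L) : B)
  set w : B := (((u⁻¹ : (FixedPoints.subalgebra k B L)ˣ) : FixedPoints.subalgebra k B L) : B)
  have hvw : v * w = 1 := congrArg Subtype.val u.mul_inv
  have hwv : w * v = 1 := congrArg Subtype.val u.inv_mul
  have hvS : v ∈ FixedPoints.subalgebra k B L := (u : FixedPoints.subalgebra k B L).2
  have hwS : w ∈ FixedPoints.subalgebra k B L :=
    ((u⁻¹ : (FixedPoints.subalgebra k B L)ˣ) : FixedPoints.subalgebra k B L).2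
  have h1 : ∀ x y : B, v * x * w * (v * y * w) = v * (x * y) * w := fun x y => by
    rw [mul_assoc (v * x), ← mul_assoc w, ← mul_assoc w, hwv, one_mul]; simp only [mul_assoc]
  have h2 : ∀ x y : B, w * x * v * (w * y * v) = w * (x * y) * v := fun x y => by
    rw [mul_assoc (w * x), ← mul_assoc v, ← mul_assoc v, hvw, one_mul]; simp only [mul_assoc]
  have h3 : ∀ x : B, w * (v * x * w) * v = x := fun x => by
    rw [mul_assoc v, ← mul_assoc w, hwv, one_mul, mul_assoc, hwv, mul_one]
  have h4 : ∀ x : B, v * (w * x * v) * w = x := fun x => by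
    rw [mul_assoc w, ← mul_assoc v, hvw, one_mul, mul_assoc, hvw, mul_one]
  refine ⟨mul_mem (mul_mem hvS h₀.1) hwS, by rw [h1, h₀.2.1], fun h => h₀.2.2.1 ?_, ?_⟩
  · rw [← h3 i₀, h, mul_zero, zero_mul]
  · intro f hf g hg hff hgg hfg hgf hsum
    rcases h₀.2.2.2 (w * f * v) (mul_mem (mul_mem hwS hf) hvS) (w * g * v)
      (mul_mem (mul_mem hwS hg) hvS) (by rw [h2, hff]) (by rw [h2, hgg])
      (by rw [h2, hfg]; simp) (by rw [h2, hgf]; simp)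
      (by rw [← add_mul, ← mul_add, hsum, h3]) with h | h
    · left; rw [← h4 f, h, mul_zero, zero_mul]
    · right; rw [← h4 g, h, mul_zero, zero_mul]

instance ExtendedBrauerQuotient.finiteDimensional (k : Type*) {G A : Type*} [Field k] [Group G]
    [Finite G] [Ring A] [Algebra k A] [FiniteDimensional k A] (σ : G →* Aˣ) (Q : Subgroup G) :
    FiniteDimensional k (ExtendedBrauerQuotient k σ Q) := by
  have : Finite (MulAut Q) := inferInstance
  have : FiniteDimensional k (MonoidAlgebra A (MulAut Q)) :=
    Module.Finite.equiv (MonoidAlgebra.coeffLinearEquiv k).symm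
  exact Module.Finite.of_surjective (ExtendedBrauerQuotient.mk k σ Q).toLinearMap
    (Ideal.Quotient.mkₐ_surjective k _)

variable {k G C A : Type*} [Field k] [Group G] [Finite G]
  [Ring C] [Algebra k C] [MulSemiringAction G C] [SMulCommClass G k C] [Ring A] [Algebra k A]
  (σ : G →* Aˣ) (ι : C →ₐ[k] A)
  (hι : ∀ (g : G) (a : C), ι (g • a) = (σ g : A) * ι a * ((σ g)⁻¹ : Aˣ)) (Q : Subgroup G)

theorem ExtendedBrauerQuotient.ofBrauerQuotient_smul_scalar (r : k) (y : BrauerQuotient k C Q) :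
    ofBrauerQuotient k σ ι hι Q (r • y) = r • ofBrauerQuotient k σ ι hι Q y := by
  obtain ⟨a, rfl⟩ := BrauerQuotient.br_surjective k Q y
  rw [← map_smul]
  change mk k σ Q _ = r • mk k σ Q _
  rw [← map_smul]
  congr 1
  apply Subtype.ext
  change MonoidAlgebra.single 1 (ι (r • (a : C))) = r • MonoidAlgebra.single 1 (ι (a : C))
  rw [map_smul, MonoidAlgebra.smul_single]

/-- After multiplying by `g` on the right, both sides live in the degree of conjugation by `g`, and
the claim is `ι(g • a) g = g ι(a)`. Equivariance is what carries proper traces from `C(Q)` to `X`.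
-/
theorem ExtendedBrauerQuotient.ofBrauerQuotient_smul (g : Subgroup.normalizer (Q : Set G))
    (y : BrauerQuotient k C Q) :
    ofBrauerQuotient k σ ι hι Q (g • y) = g • ofBrauerQuotient k σ ι hι Q y := by
  obtain ⟨a, rfl⟩ := BrauerQuotient.br_surjective k Q y
  rw [smul_def, Units.eq_mul_inv_iff_mul_eq]
  change mk k σ Q _ * mk k σ Q _ = mk k σ Q _ * mk k σ Q _
  rw [← map_mul, ← map_mul]
  congr 1
  apply Subtype.ext
  change MonoidAlgebra.single 1 (ι ((g : G) • (a : C))) *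
      MonoidAlgebra.single (Q.normalizerMonoidHom g) (σ g : A) =
    MonoidAlgebra.single (Q.normalizerMonoidHom g) (σ g : A) * MonoidAlgebra.single 1 (ι (a : C))
  rw [MonoidAlgebra.single_mul_single, MonoidAlgebra.single_mul_single, one_mul, mul_one, hι,
    Units.inv_mul_cancel_right]

variable {σ ι hι Q}

theorem CoversBlock.isPGroup_defect (p : ℕ) [Fact p.Prime] [CharP k p] {N : Subgroup G}
    {f : BrauerQuotient k C Q} {γ : Set (ExtendedBrauerQuotient k σ Q)}
    (hγ : CoversBlock k σ ι hι N Q f γ) {P : Subgroup (pairNormalizer Q f)}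
    (hP : IsDefectGroupOfPoint k P γ) : IsPGroup p P := by
  obtain ⟨_, i, hi, _⟩ := hγ
  exact (hP i hi).isPGroup p

variable [FiniteDimensional k A]

/-- Proper traces form an ideal of the fixed algebra. If `f` were among them, so would be `i = i f`
in `X`, although `P` is a defect group of `i`. -/
theorem CoversBlock.notMem_properTraces {N : Subgroup G}
    {f : BrauerQuotient k C Q} {γ : Set (ExtendedBrauerQuotient k σ Q)}
    (hγ : CoversBlock k σ ι hι N Q f γ) {P : Subgroup (pairNormalizer Q f)}
    (hP : IsDefectGroupOfPoint k P γ) :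
    f ∉ properTraces (Representation.ofDistribMulAction k P (BrauerQuotient k C Q)) := by
  obtain ⟨hpt, i, hi, _, _, _, hij, _⟩ := hγ
  have hprim := hpt.isPrimitive hi
  intro hf
  refine (hP i hi).notMem_properTraces hprim ?_
  have h1 := map_properTraces (Representation.ofDistribMulAction k P (BrauerQuotient k C Q))
    (Representation.ofDistribMulAction k P (ExtendedBrauerQuotient k σ Q)) (MulEquiv.refl P)
    { toFun := ExtendedBrauerQuotient.ofBrauerQuotient k σ ι hι Q
      map_add' := map_add _
      map_smul' := ExtendedBrauerQuotient.ofBrauerQuotient_smul_scalar σ ι hι Q }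
    (fun g y => ExtendedBrauerQuotient.ofBrauerQuotient_smul σ ι hι Q g.1.1 y) hf
  rw [← hij]
  exact mul_mem_properTraces (fun l => hprim.1 l.1) h1

/-- The element `e = i e` of `ε` survives `Br_Q`, hence so does `i`, a trace from `P`. By the Mackey
formula a conjugate of `Q` under some `h ∈ H` lies in `P`, and `h` normalizes `Q`. -/
theorem CoversBlock.le_defect {N : Subgroup G}
    {f : BrauerQuotient k C Q} {γ : Set (ExtendedBrauerQuotient k σ Q)}
    (hγ : CoversBlock k σ ι hι N Q f γ) {P : Subgroup (pairNormalizer Q f)}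
    (hP : IsDefectGroupOfPoint k P γ) : Q ≤ P.map (pairNormalizerIncl Q f) := by
  obtain ⟨hpt, i, hi, ε, hε, hεQ, _, _, ⟨e, he, hie, _⟩, _⟩ := hγ
  have heprim := hε.isPrimitive he
  obtain ⟨x, hx, hix⟩ := (hP i hi).1
  have hQrange := le_range_pairNormalizerIncl f
  obtain ⟨h, hh⟩ : ∃ h : pairNormalizer Q f, ∀ q : (Q.comap (pairNormalizerIncl Q f)).subgroupOf
      (baseNormal N Q f), h⁻¹ * (q : baseNormal N Q f) * h ∈ P := by
    by_contra! hcon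
    refine (hεQ e he).notMem_properTraces heprim ?_
    rw [← hie]
    refine properTraces_mul_mem (fun l => heprim.1 l.1) ?_
    rw [hix]
    exact relTrace_mem_properTraces ((baseNormal N Q f).subtype.comp (Subgroup.subtype _))
      (Representation.ofDistribMulAction k (pairNormalizer Q f) (ExtendedBrauerQuotient k σ Q)) _
      (fun _ _ => rfl) P x hx hcon
  intro q hq
  have hq' : pairNormalizerIncl Q f h * q * (pairNormalizerIncl Q f h)⁻¹ ∈ Q :=
    (h.1.2 q).1 hq
  obtain ⟨q', hqq'⟩ := hQrange hq'
  have hq'Q : q' ∈ Q.comap (pairNormalizerIncl Q f) := by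
    rw [Subgroup.mem_comap, hqq']
    exact hq'
  have hq'M : q' ∈ baseNormal N Q f := Subgroup.comap_mono le_sup_left hq'Q
  refine ⟨_, hh ⟨⟨q', hq'M⟩, hq'Q⟩, ?_⟩
  change pairNormalizerIncl Q f (h⁻¹ * q' * h) = q
  rw [map_mul, map_mul, hqq', map_inv]
  group

end Points

/-! ### The comparison of the two categories -/

section Main

theorem BPair.conj_one_le_iff {k G B : Type*} [Field k] [Group G] [Finite G]
    [Ring B] [Algebra k B] [MulSemiringAction G B] [SMulCommClass G k B]
    {X Y : BPair k (G := G) B} : (X.conj 1).Le Y ↔ X.Le Y := by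
  rw [BPair.conj_le_iff]
  simp [BPair.Le, SetLike.le_def]

/-- This is the composition of morphisms with both conjugating elements equal to `1`. -/
theorem BPair.Le.trans {k G B : Type*} [Field k] [Group G] [Finite G]
    [Ring B] [Algebra k B] [FiniteDimensional k B] [MulSemiringAction G B] [SMulCommClass G k B]
    {X Y Z : BPair k (G := G) B} (h : X.Le Y) (h' : Y.Le Z) : X.Le Z := by
  have := BPair.conj_mul_le (BPair.conj_one_le_iff.2 h) (BPair.conj_one_le_iff.2 h')
  rwa [mul_one, BPair.conj_one_le_iff] at this

/-- `T` normalizes both itself and `N`. -/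
theorem le_normalizer_of_inf_eq {G : Type*} [Group G] {T N Q : Subgroup G} [N.Normal]
    (h : T ⊓ N = Q) : T ≤ Subgroup.normalizer (Q : Set G) := by
  intro t ht
  rw [Subgroup.mem_normalizer_iff]
  intro g
  subst h
  change g ∈ T ∧ g ∈ N ↔ t * g * t⁻¹ ∈ T ∧ t * g * t⁻¹ ∈ N
  rw [Subgroup.mul_mem_cancel_right _ (inv_mem ht), Subgroup.mul_mem_cancel_left _ ht]
  refine and_congr_right fun _ => ⟨fun hg => Subgroup.Normal.conj_mem ‹_› g hg t, fun hg => ?_⟩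
  have := Subgroup.Normal.conj_mem ‹N.Normal› _ hg t⁻¹
  simpa [mul_assoc] using this

open CategoryTheory in
/-- Correspondences between the objects and between the conjugating elements of the two
categories give an isomorphism of categories. -/
theorem identityIsIsoOfCategories_of_corresponds (p : ℕ) {k G C : Type*} [Field k] [Group G]
    [Finite G] [Ring C] [Algebra k C] [FiniteDimensional k C] [MulSemiringAction G C]
    [SMulCommClass G k C] {c : C} {Q : Subgroup G} {f : BrauerQuotient k C Q}
    {U P : BPair k (G := G) C} {U' P' : BPair k (G := pairNormalizer Q f) (BrauerQuotient k C Q)}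
    (hobj : ∀ Y : FusionInterval p f U' (basePair Q f) P',
      ∃ X : FusionInterval p c U ⟨Q, f⟩ P, Corresponds Q f X.obj.pair Y.obj.pair)
    (hobj' : ∀ X : FusionInterval p c U ⟨Q, f⟩ P,
      ∃ Y : FusionInterval p f U' (basePair Q f) P', Corresponds Q f X.obj.pair Y.obj.pair)
    (hleft : ∀ (X X' : FusionInterval p c U ⟨Q, f⟩ P)
      (Y : FusionInterval p f U' (basePair Q f) P'), Corresponds Q f X.obj.pair Y.obj.pair →
        Corresponds Q f X'.obj.pair Y.obj.pair → X.obj.pair = X'.obj.pair)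
    (hright : ∀ (X : FusionInterval p c U ⟨Q, f⟩ P)
      (Y Y' : FusionInterval p f U' (basePair Q f) P'), Corresponds Q f X.obj.pair Y.obj.pair →
        Corresponds Q f X.obj.pair Y'.obj.pair → Y.obj.pair = Y'.obj.pair)
    (hconj : ∀ (X Z : FusionInterval p c U ⟨Q, f⟩ P)
      (Y W : FusionInterval p f U' (basePair Q f) P'), Corresponds Q f X.obj.pair Y.obj.pair →
        Corresponds Q f Z.obj.pair W.obj.pair → ∀ x : pairNormalizer Q f,
        (Y.obj.pair.conj x).Le W.obj.pair ↔
          (X.obj.pair.conj (pairNormalizerIncl Q f x)).Le Z.obj.pair)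
    (hrange : ∀ (X Z : FusionInterval p c U ⟨Q, f⟩ P) (x : G),
      (X.obj.pair.conj x).Le Z.obj.pair → x ∈ (pairNormalizerIncl Q f).range) :
    IdentityIsIsoOfCategories p c Q f U P U' P' := by
  have hinj : Function.Injective (pairNormalizerIncl Q f) :=
    (isInducedAction_pairNormalizer (k := k) f).1
  choose F hF using hobj
  choose E hE using hobj'
  obtain ⟨Φ, hΦ, hΦm⟩ := FusionInterval.exists_functor
    (fun s t => t = pairNormalizerIncl Q f s) F (fun Y Z φ => by
      obtain ⟨x, hx, hφ⟩ := FusionSystem.exists_conj φ.hom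
      refine ⟨ObjectProperty.homMk (FusionSystem.homOfConj (pairNormalizerIncl Q f x)
        ((hconj _ _ _ _ (hF Y) (hF Z) x).1 hx)), fun s t hst => ?_⟩
      change pairNormalizerIncl Q f x * t * (pairNormalizerIncl Q f x)⁻¹ = _
      rw [hφ, map_mul, map_mul, map_inv, hst])
    (fun Y t => by
      obtain ⟨s, hs, hst⟩ := (hF Y).1.le t.2
      exact ⟨⟨s, hs⟩, hst.symm⟩)
    (fun s t t' h h' => h.trans h'.symm)
  obtain ⟨Ψ, hΨ, hΨm⟩ := FusionInterval.exists_functor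
    (fun t s => t = pairNormalizerIncl Q f s) E (fun X Z φ => by
      obtain ⟨x, hx, hφ⟩ := FusionSystem.exists_conj φ.hom
      -- Only this direction needs the conjugating elements of `G` to come from `N_G(Q, f)`.
      obtain ⟨y, rfl⟩ := hrange X Z x hx
      refine ⟨ObjectProperty.homMk (FusionSystem.homOfConj y
        ((hconj _ _ _ _ (hE X) (hE Z) y).2 hx)), fun t s hst => ?_⟩
      change _ = pairNormalizerIncl Q f (y * s * y⁻¹)
      rw [hφ, map_mul, map_mul, map_inv, hst])
    (fun X s => by
      refine ⟨⟨pairNormalizerIncl Q f s, ?_⟩, rfl⟩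
      rw [(hE X).1]
      exact ⟨s, s.2, rfl⟩)
    (fun t s s' h h' => hinj (h.symm.trans h'))
  have hΦc : ∀ Y, Corresponds Q f (Φ.obj Y).obj.pair Y.obj.pair := fun Y => by
    rw [hΦ]; exact hF Y
  have hΨc : ∀ X, Corresponds Q f X.obj.pair (Ψ.obj X).obj.pair := fun X => by
    rw [hΨ]; exact hE X
  refine ⟨Φ, Ψ, ?_, ?_, hΦc, hΦm⟩
  · refine FusionInterval.functor_eq_id _ (fun Y => hright (Φ.obj Y) _ _ (hΨc _) (hΦc Y)) ?_
    intro Y Z φ s t hst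
    have hs : pairNormalizerIncl Q f s ∈ (Φ.obj Y).obj.pair.subgroup := by
      rw [(hΦc Y).1]
      exact ⟨s, s.2, rfl⟩
    have h1 := hΦm Y Z φ s ⟨_, hs⟩ rfl
    have h2 := hΨm _ _ (Φ.map φ) ⟨_, hs⟩ t (congrArg (pairNormalizerIncl Q f) hst)
    exact hinj (h2.symm.trans h1)
  · refine FusionInterval.functor_eq_id _ (fun X => hleft _ _ (Ψ.obj X) (hΦc _) (hΨc X)) ?_
    intro X Z φ s t hst
    obtain ⟨u, hu, hus⟩ := (hΨc X).1.le s.2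
    have h1 := hΨm X Z φ s ⟨u, hu⟩ hus.symm
    have h2 := hΦm _ _ (Ψ.map φ) ⟨u, hu⟩ t (hst.symm.trans hus.symm)
    exact h2.trans h1.symm

variable (p : ℕ) [Fact p.Prime] {k G C : Type*} [Field k] [CharP k p]
  [Group G] [Finite G] {N : Subgroup G} [N.Normal]
  [Ring C] [Algebra k C] [FiniteDimensional k C] [MulSemiringAction G C] [SMulCommClass G k C]

theorem identityIsIsoOfCategories_of_inf_eq (hperm : IsPPermutationAlgebra p k G C)
    {c : C} (hcG : ∀ g : G, g • c = c) {Q : Subgroup G} (hQN : Q ≤ N)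
    {f : BrauerQuotient k C Q} (hf : IsBlock k f)
    (hcf : BrauerQuotient.br k Q ⟨c, fun q => hcG q⟩ * f = f)
    {U P : BPair k (G := G) C} {U' P' : BPair k (G := pairNormalizer Q f) (BrauerQuotient k C Q)}
    (hU : IsPGroup p U.subgroup) (hP : IsPGroup p P.subgroup)
    (hUU' : Corresponds Q f U U') (hPP' : Corresponds Q f P P') (hPN : P.subgroup ⊓ N = Q) :
    IdentityIsIsoOfCategories p c Q f U P U' P' := by
  have hθ := isInducedAction_pairNormalizer (k := k) f
  have hU' := CorrespondsAlong.isPGroup p hU hθ hUU'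
  have hP' := CorrespondsAlong.isPGroup p hP hθ hPP'
  have hbase := corresponds_basePair f
  have hQ : IsPGroup p (basePair Q f).subgroup :=
    CorrespondsAlong.isPGroup p (hP.to_le hPP'.2.1) hθ hbase
  have hrangeP : P.subgroup ≤ (pairNormalizerIncl Q f).range := by
    rw [hPP'.1]
    exact Subgroup.map_le_range _ _
  have hnorm : ∀ X : FusionInterval p c U ⟨Q, f⟩ P,
      X.obj.pair.subgroup ≤ Subgroup.normalizer (Q : Set G) := fun X =>
    X.property.2.1.trans (le_normalizer_of_inf_eq hPN)
  refine identityIsIsoOfCategories_of_corresponds p ?_ ?_ ?_ ?_ ?_ ?_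
  · intro Y
    have hY := Y.obj.isBrauerPair
    have hQY : Q ≤ Y.obj.pair.subgroup.map (pairNormalizerIncl Q f) := by
      conv_lhs => rw [show Q = _ from hbase.1]
      exact Subgroup.map_mono Y.property.1.1
    obtain ⟨e, he⟩ := hθ.exists_corresponds_symm p hperm hY.1 hQY
    obtain ⟨h1, h2⟩ := isBrauerPair_of_corresponds_symm p hperm hcG hf hcf he hY
    exact ⟨⟨⟨_, h1, (hθ.le_iff p hperm hY.1 hU' he hUU').1 Y.obj.le⟩, h2,
      (hθ.le_iff p hperm hY.1 hP' he hPP').1 Y.property.2⟩, he⟩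
  · intro X
    have hX := X.obj.isBrauerPair
    obtain ⟨Y, hY⟩ := hθ.exists_corresponds_of_le_range p hperm hX.1 X.property.1.1
      (X.property.2.1.trans hrangeP)
    have hYp := isBrauerPair_of_corresponds p hperm hf hY hX X.property.1
    exact ⟨⟨⟨Y, hYp, (hθ.le_iff p hperm hYp.1 hU' hY hUU').2 X.obj.le⟩,
      (hθ.le_iff p hperm hQ hYp.1 hbase hY).2 X.property.1,
      (hθ.le_iff p hperm hYp.1 hP' hY hPP').2 X.property.2⟩, hY⟩
  · intro X X' Y h h'
    exact hθ.corresponds_left_unique p hperm Y.obj.isBrauerPair.1 h h'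
  · intro X Y Y' h h'
    exact hθ.corresponds_right_unique p hperm Y.obj.isBrauerPair.1 h h'
  · intro X Z Y W h h' x
    exact hθ.le_iff p hperm (Y.obj.isBrauerPair.1.map _) W.obj.isBrauerPair.1
      (CorrespondsAlong.conj hθ h x x.1.2) h'
  · intro X Z x hx
    -- Restricting the morphism to `(Q, f)` gives `ˣ(Q, f) ≤ Z`. Then `xQx⁻¹ ≤ P ∩ N = Q`, so `x`
    -- normalizes `Q`, and uniqueness of the block below `Z` shows that `x` fixes `f`.
    have hQx := BPair.conj_mul_le (BPair.conj_one_le_iff.2 X.property.1) hx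
    rw [mul_one] at hQx
    have hxQ : x ∈ Subgroup.normalizer (Q : Set G) := by
      refine Subgroup.mem_normalizer_fintype fun q hq => ?_
      have : x * q * x⁻¹ ∈ P.subgroup ⊓ N :=
        ⟨Z.property.2.1 (((BPair.conj_le_iff x _ _).1 hQx).1 q hq),
          Subgroup.Normal.conj_mem ‹_› q (hQN hq) x⟩
      rwa [hPN] at this
    exact mem_range_of_conj_le p hperm hf Z.obj.isBrauerPair.1 Z.obj.isBrauerPair.2.1
      Z.property.1 (hnorm Z) hxQ hQx

end Main

/-! ### The main theorem -/

theorem theorem6p3 (p : ℕ) [Fact p.Prime] {k G A C : Type*} [Field k] [CharP k p]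
    [Group G] [Finite G] (N : Subgroup G) [N.Normal]
    -- `A` is an interior `G`-algebra with a `G × G`-stable basis, projective over `k[N × 1]`
    -- and over `k[1 × N]`
    [Ring A] [Algebra k A] [FiniteDimensional k A] (σ : G →* Aˣ)
    (hbasis : HasBiStableBasis k σ)
    (hleft : Module.Projective (MonoidAlgebra k N) (leftMulRep k σ N).asModule)
    (hright : Module.Projective (MonoidAlgebra k N) (rightMulRep k σ N).asModule)
    -- `C` is an `N`-interior `p`-permutation `G`-algebra
    [Ring C] [Algebra k C] [FiniteDimensional k C] [MulSemiringAction G C] [SMulCommClass G k C]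
    (τ : N →* Cˣ) (hτ : IsInteriorStructure N τ) (hperm : IsPPermutationAlgebra p k G C)
    -- `C` is contained in `A`, as an `N`-interior `G`-algebra, as a direct summand
    (ι : C →ₐ[k] A)
    (hι : ∀ (g : G) (a : C), ι (g • a) = (σ g : A) * ι a * ((σ g)⁻¹ : Aˣ))
    (hιτ : ∀ n : N, ι (τ n) = (σ n : A))
    (hsplit : ∃ r : A →ₗ[k] C, ∀ a, r (ι a) = a)
    -- `c` is a `G`-invariant primitive idempotent of `C^N` with defect group `Q` in `N`
    (c : C) (hc : IsPrimitiveIdempotentIn (FixedPoints.subalgebra k C N) c)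
    (hcG : ∀ g : G, g • c = c) (Q : Subgroup G) (hQN : Q ≤ N)
    (hQ : IsDefectGroup k (Q.subgroupOf N) c)
    -- `(Q, f_Q)` is a `(C, c, G)`-Brauer pair, with `f_Q` primitive in `C(Q)^{C_N(Q)}`
    (fQ : BrauerQuotient k C Q) (hfQ : IsBrauerPair p c ⟨Q, fQ⟩)
    (hprim : IsPrimitiveIdempotentIn
      (FixedPoints.subalgebra k (BrauerQuotient k C Q)
        ((N ⊓ Subgroup.centralizer (Q : Set G)).subgroupOf (Subgroup.normalizer (Q : Set G)))) fQ)
    -- `γ` is a point of `H = N_G(Q, f_Q)` on `X` which covers `f_Q`, with defect group `P`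
    (γ : Set (ExtendedBrauerQuotient k σ Q)) (hγ : CoversBlock k σ ι hι N Q fQ γ)
    (P : Subgroup (pairNormalizer Q fQ)) (hP : IsDefectGroupOfPoint k P γ) :
    P.map (pairNormalizerIncl Q fQ) ⊓ N = Q ∧
    (∃ fP : BrauerQuotient k C (P.map (pairNormalizerIncl Q fQ)),
      IsBrauerPair p c ⟨_, fP⟩ ∧ BPair.Le ⟨Q, fQ⟩ ⟨_, fP⟩) ∧
    ∀ fP : BrauerQuotient k C (P.map (pairNormalizerIncl Q fQ)),
      IsBrauerPair p c ⟨_, fP⟩ → BPair.Le ⟨Q, fQ⟩ ⟨_, fP⟩ →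
      ∃ fP' : BrauerQuotient k (BrauerQuotient k C Q) P,
        Corresponds Q fQ ⟨_, fP⟩ ⟨P, fP'⟩ ∧ IsBrauerPair p fQ ⟨P, fP'⟩ ∧
        (basePair Q fQ).Le ⟨P, fP'⟩ ∧
        ∀ U : BPair k (G := G) C, IsMaximalBrauerPair p c U → BPair.Le ⟨_, fP⟩ U →
          ∃ U' : BPair k (G := pairNormalizer Q fQ) (BrauerQuotient k C Q),
            Corresponds Q fQ U U' ∧ IsMaximalBrauerPair p fQ U' ∧ BPair.Le ⟨P, fP'⟩ U' ∧
            IdentityIsIsoOfCategories p c Q fQ U ⟨_, fP⟩ U' ⟨P, fP'⟩ := by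
  have hθ := isInducedAction_pairNormalizer (k := k) fQ
  have hf : IsBlock k fQ := hfQ.2.1
  have hcf : BrauerQuotient.br k Q ⟨c, fun q => hcG q⟩ * fQ = fQ := by
    obtain ⟨_, _, _, hne⟩ := hfQ
    rw [← hf.comm] at hne ⊢
    -- `Br_Q(c)` is not known to be central in `C(Q)`, but it is `C_N(Q)`-fixed and commutes with
    -- `f_Q`; so primitivity of `f_Q` in the `C_N(Q)`-fixed algebra applies.
    refine (hprim.mul_eq_zero_or ?_ ?_ (hf.comm _)).resolve_left hne
    · exact fun x => congrArg (BrauerQuotient.br k Q) (Subtype.ext (hcG x.1))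
    · rw [← map_mul]
      congr 1
      exact Subtype.ext hc.2.1
  have hPp : IsPGroup p P := hγ.isPGroup_defect p hP
  have hPpG : IsPGroup p (P.map (pairNormalizerIncl Q fQ)) := hPp.map _
  have hQP : Q ≤ P.map (pairNormalizerIncl Q fQ) := hγ.le_defect hP
  have hfix : fQ ∈ FixedPoints.subalgebra k (BrauerQuotient k C Q) P := fun x => x.1.2
  have hinf : ∀ T : BPair k (G := G) C, IsBrauerPair p c T → Q ≤ T.subgroup →
      T.subgroup ⊓ N = Q := fun T hT hQT =>
    inf_eq_of_notMem_properTraces p hperm hcG hQN hQ.1 hT.1 hQT hT.notMem_properTraces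
  have hexists : ∃ fP : BrauerQuotient k C (P.map (pairNormalizerIncl Q fQ)),
      IsBrauerPair p c ⟨_, fP⟩ ∧ BPair.Le ⟨Q, fQ⟩ ⟨_, fP⟩ := by
    -- `Br_P(f_Q) ≠ 0`, so some block of `C(Q)(P)` is not annihilated by it; its counterpart in
    -- `C(P)` is `f_P`.
    obtain ⟨e', he', hne⟩ := exists_block_mul_ne_zero (k := k)
      (z := BrauerQuotient.br k P ⟨fQ, hfix⟩) fun h0 =>
        hγ.notMem_properTraces hP (br_eq_zero_iff.1 h0)
    obtain ⟨e, he⟩ := hθ.exists_corresponds_symm p hperm (X' := ⟨P, e'⟩) hPp hQP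
    exact ⟨e, isBrauerPair_of_corresponds_symm p hperm hcG hf hcf he ⟨hPp, he', hfix, hne⟩⟩
  have hPN : P.map (pairNormalizerIncl Q fQ) ⊓ N = Q := by
    obtain ⟨e, he, _⟩ := hexists
    exact hinf _ he hQP
  refine ⟨hPN, hexists, fun fP hfP hle => ?_⟩
  have hbase := corresponds_basePair fQ
  have hbp : IsPGroup p (basePair Q fQ).subgroup := CorrespondsAlong.isPGroup p hfQ.1 hθ hbase
  obtain ⟨fP', hcor⟩ := hθ.exists_corresponds p hperm hPp hQP fP
  refine ⟨fP', hcor, isBrauerPair_of_corresponds p hperm hf hcor hfP hle,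
    (hθ.le_iff p hperm hbp hPp hbase hcor).2 hle, fun U hU hPU => ?_⟩
  have hQU := hle.trans hPU
  have hUN := hinf U hU.1 hQU.1
  -- The group of `U` also meets `N` in `Q`, so it normalizes `Q`, hence lies in `H`; this is why a
  -- maximal pair for `G` has a counterpart for `C(Q)`.
  obtain ⟨U', hUU'⟩ := hθ.exists_corresponds_of_le_range p hperm hU.1.1 hQU.1
    (le_range_of_le p hperm hf hU.1.1 hU.1.2.1 hQU (le_normalizer_of_inf_eq hUN))
  have hU' := isBrauerPair_of_corresponds p hperm hf hUU' hU.1 hQU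
  refine ⟨U', hUU', ⟨hU', fun V' hV' hUV => ?_⟩, (hθ.le_iff p hperm hPp hU'.1 hcor hUU').2 hPU,
    identityIsIsoOfCategories_of_inf_eq p hperm hcG hQN hf hcf hU.1.1 hfP.1 hUU' hcor hPN⟩
  -- A Brauer pair above `U'` translates back to a `(C, c, G)`-Brauer pair above `U`, so maximality
  -- of `U` passes to `U'`.
  obtain ⟨e, he⟩ := hθ.exists_corresponds_symm p hperm hV'.1
    (hQU.1.trans (hUU'.1.le.trans (Subgroup.map_mono hUV.1)))
  have hV := (isBrauerPair_of_corresponds_symm p hperm hcG hf hcf he hV').1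
  have hVU := hU.2 _ hV ((hθ.le_iff p hperm hU'.1 hV'.1 hUU' he).1 hUV)
  rw [hVU] at he
  exact hθ.corresponds_right_unique p hperm hV'.1 he hUU'
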